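/- Let $k$ be a field, $r\ge 1$ an integer, and let $B=k\langle x,y\rangle/(y^{r+1})$ with the $\mathbb Z$-grading $\deg x=\deg y=1$. Let $\mathsf{Gr}\,B$ be the category of $\mathbb Z$-graded left $B$-modules with degree-preserving $B$-linear maps, $\mathsf{Fdim}\,B$ its Serre subcategory of modules that are unions of their finite dimensional submodules, $\mathsf{gr}\,B\subset\mathsf{Gr}\,B$ the full subcategory of finitely presented modules, and $\mathsf{fdim}\,B$ the full subcategory of finite dimensional modules. Put $\mathsf{QGr}\,B=\mathsf{Gr}\,B/\mathsf{Fdim}\,B$ and $\mathsf{qgr}\,B=\mathsf{gr}\,B/\mathsf{fdim}\,B$, and let $\mathcal O$ be the image of $B$ in $\mathsf{QGr}\,B$. Define $b_j=2^j$ for $0\le j\le r$ and $b_{j+1}=b_j+b_{j-1}+\cdots+b_{j-r}$ for $j\ge r$. For $n\ge r+1$ let $$S_n=M_{b_{n-1}}(k)\times M_{b_{n-2}}(k)\times\cdots\times M_{b_{n-r-1}}(k),$$ let $\phi_n:S_n\to S_{n+1}$ be the algebra homomorphism $$\phi_n(g_0,\dots,g_r)=\big(\operatorname{diag}(g_0,\dots,g_r),\,g_0,\,\dots,\,g_{r-1}\big),$$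 and let $S=\varinjlim_n(S_n,\phi_n)$ be the direct limit in the category of $k$-algebras. (For $r=1$, with the Fibonacci numbers $f_0=f_1=1$, $f_{n+1}=f_n+f_{n-1}$, this is $S_n=M_{f_n}(k)\times M_{f_{n-1}}(k)$ and $\phi_n(a,b)=(\operatorname{diag}(a,b),a)$.) Let $\mathsf{Mod}\,S$ be the category of right $S$-modules and $\mathsf{mod}\,S$ its full subcategory of finitely presented modules. Then there is an equivalence of categories $\mathsf{QGr}\,B\equiv\mathsf{Mod}\,S$ that sends $\mathcal O$ to a module isomorphic to $S_S$ and that restricts to an equivalence $\mathsf{qgr}\,B\equiv\mathsf{mod}\,S$; that is, there is an equivalence $\mathsf{qgr}\,B\equiv\mathsf{mod}\,S$ such that the square formed by the two equivalences, the canonical functor $\mathsf{qgr}\,B\to\mathsf{QGr}\,B$ and the inclusion $\mathsf{mod}\,S\subset\mathsf{Mod}\,S$ commutes up to natural isomorphism. -/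

import Mathlib

open CategoryTheory

universe u

noncomputable section

namespace NCProj

/-! ### Graded modules -/

section GradedModules

variable (k : Type u) [Field k] {A : Type u} [Ring A] [Algebra k A]

/-- A `ℤ`-graded left module over the `k`-algebra `A` with homogeneous components `𝒜 i`:
a left `A`-module which is the (internal) direct sum of subspaces `deg j`, `j : ℤ`, such that
`𝒜 i • deg j ⊆ deg (i + j)`. The `k`-structure is the one induced by `k → A`. -/
structure GrMod (𝒜 : ℤ → Submodule k A) where
  carrier : Type u
  [addCommGroup : AddCommGroup carrier]
  [moduleBase : Module k carrier]
  [module : Module A carrier]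
  [isScalarTower : IsScalarTower k A carrier]
  deg : ℤ → Submodule k carrier
  isInternal : DirectSum.IsInternal deg
  smul_mem : ∀ {i j : ℤ} {a : A} {m : carrier}, a ∈ 𝒜 i → m ∈ deg j → a • m ∈ deg (i + j)

attribute [instance] GrMod.addCommGroup GrMod.moduleBase GrMod.module GrMod.isScalarTower

namespace GrMod

variable {k} {𝒜 : ℤ → Submodule k A}

/-- Morphisms of graded modules: `A`-linear maps of degree zero. -/
@[ext]
structure Hom (M N : GrMod k 𝒜) where
  toLin : M.carrier →ₗ[A] N.carrier
  map_deg : ∀ (i : ℤ) (m : M.carrier), m ∈ M.deg i → toLin m ∈ N.deg i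

/-- The category of `ℤ`-graded left `A`-modules. -/
instance : Category (GrMod k 𝒜) where
  Hom M N := Hom M N
  id M := ⟨LinearMap.id, fun _ _ h => h⟩
  comp f g := ⟨g.toLin ∘ₗ f.toLin, fun i m h => g.map_deg i _ (f.map_deg i m h)⟩

/-- The graded modules that are finitely presented `A`-modules. -/
def isFP (𝒜 : ℤ → Submodule k A) : ObjectProperty (GrMod k 𝒜) :=
  fun M => Module.FinitePresentation A M.carrier

end GrMod

/-- A module is the union of its finite dimensional submodules. -/
def IsUnionOfFiniteDim (A : Type u) [Ring A] [Algebra k A] (M : Type u) [AddCommGroup M]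
    [Module k M] [Module A M] [IsScalarTower k A M] : Prop :=
  ∀ m : M, ∃ N : Submodule A M, m ∈ N ∧ Module.Finite k N

variable {k} (𝒜 : ℤ → Submodule k A)

/-- The morphisms of graded modules whose kernel and cokernel belong to `Fdim`, i.e. are unions of
their finite dimensional submodules. -/
def isoModFdim : MorphismProperty (GrMod k 𝒜) := fun _ N f =>
  IsUnionOfFiniteDim k A (LinearMap.ker f.toLin) ∧
    IsUnionOfFiniteDim k A (N.carrier ⧸ LinearMap.range f.toLin)

/-- The quotient category `QGr A = Gr A / Fdim A`: the localization of `Gr A` at the morphisms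
whose kernel and cokernel belong to the Serre subcategory `Fdim A`. -/
abbrev QGr : Type (u + 1) := (isoModFdim 𝒜).Localization

/-- The category `gr A` of finitely presented graded modules. -/
abbrev Grfp : Type (u + 1) := (GrMod.isFP 𝒜).FullSubcategory

/-- The morphisms of `gr A` whose kernel and cokernel are finite dimensional. -/
def isoModFiniteDim : MorphismProperty (Grfp 𝒜) := fun _ N f =>
  Module.Finite k (LinearMap.ker ((GrMod.isFP 𝒜).ι.map f).toLin) ∧
    Module.Finite k (N.obj.carrier ⧸ LinearMap.range ((GrMod.isFP 𝒜).ι.map f).toLin)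

/-- The quotient category `qgr A = gr A / fdim A`. -/
abbrev Qgrfp : Type (u + 1) := (isoModFiniteDim 𝒜).Localization

theorem isUnionOfFiniteDim_of_finite (M : Type u) [AddCommGroup M]
    [Module k M] [Module A M] [IsScalarTower k A M] [Module.Finite k M] :
    IsUnionOfFiniteDim k A M :=
  fun _ => ⟨⊤, Submodule.mem_top,
    Module.Finite.equiv ((Submodule.topEquiv (R := A) (M := M)).restrictScalars k).symm⟩

theorem isoModFiniteDim_inverts :
    (isoModFiniteDim 𝒜).IsInvertedBy ((GrMod.isFP 𝒜).ι ⋙ (isoModFdim 𝒜).Q) := by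
  intro M N f hf
  have := hf.1
  have := hf.2
  exact (isoModFdim 𝒜).Q_inverts ((GrMod.isFP 𝒜).ι.map f)
    ⟨isUnionOfFiniteDim_of_finite _, isUnionOfFiniteDim_of_finite _⟩

/-- The canonical functor `qgr A ⥤ QGr A` induced by the inclusion of `gr A` in `Gr A`. -/
def qgrToQGr : Qgrfp 𝒜 ⥤ QGr 𝒜 :=
  Localization.Construction.lift ((GrMod.isFP 𝒜).ι ⋙ (isoModFdim 𝒜).Q) (isoModFiniteDim_inverts 𝒜)

/-- A `ℤ`-graded algebra as a graded left module over itself. -/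
def GrMod.self [GradedAlgebra 𝒜] : GrMod k 𝒜 where
  carrier := A
  deg := 𝒜
  isInternal := DirectSum.Decomposition.isInternal 𝒜
  smul_mem := fun ha hm => SetLike.GradedMul.mul_mem ha hm

/-- The structure sheaf: the image of `A` in `QGr A`. -/
def structureSheaf [GradedAlgebra 𝒜] : QGr 𝒜 := (isoModFdim 𝒜).Q.obj (GrMod.self 𝒜)

end GradedModules

/-! ### The graded algebra `k⟨x,y⟩/(y^(r+1))` -/

section TheAlgebra

variable (k : Type u) [Field k] (r : ℕ)

/-- The relation `y ^ (r + 1) = 0` on the free algebra on `x = ι 0` and `y = ι 1`. -/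
inductive Rel : FreeAlgebra k (Fin 2) → FreeAlgebra k (Fin 2) → Prop
  | y_pow : Rel (FreeAlgebra.ι k 1 ^ (r + 1)) 0

/-- The algebra `B = k⟨x,y⟩/(y^(r+1))`. -/
abbrev B : Type u := RingQuot (Rel k r)

/-- The generators `x = gen 0` and `y = gen 1` of `B`. -/
def gen (i : Fin 2) : B k r := RingQuot.mkAlgHom k (Rel k r) (FreeAlgebra.ι k i)

/-- The `ℤ`-grading of `B` with `deg x = deg y = 1`: the component of degree `n` is spanned by the
words of length `n` in `x` and `y`. -/
def grading (n : ℤ) : Submodule k (B k r) :=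
  Submodule.span k {b | ∃ w : List (Fin 2), (w.length : ℤ) = n ∧ (w.map (gen k r)).prod = b}

theorem gen_mem (i : Fin 2) : gen k r i ∈ grading k r 1 :=
  Submodule.subset_span ⟨[i], by simp, by simp⟩

theorem gen_pow : gen k r 1 ^ (r + 1) = 0 := by
  have h := RingQuot.mkAlgHom_rel k (Rel.y_pow (k := k) (r := r))
  rwa [map_pow, map_zero] at h

instance grading_gradedMonoid : SetLike.GradedMonoid (grading k r) where
  one_mem := Submodule.subset_span ⟨[], by simp, by simp⟩
  mul_mem := by
    intro i j a b ha hb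
    have h := Submodule.mul_mem_mul ha hb
    rw [grading, grading, Submodule.span_mul_span] at h
    refine Submodule.span_mono ?_ h
    rintro _ ⟨_, ⟨v, hv, rfl⟩, _, ⟨w, hw, rfl⟩, rfl⟩
    exact ⟨v ++ w, by simp [hv, hw], by simp⟩

/-- A generator as an element of degree one in the direct sum of the homogeneous components. -/
def genGraded (i : Fin 2) : DirectSum ℤ fun n => grading k r n :=
  DirectSum.of (fun n => grading k r n) 1 ⟨gen k r i, gen_mem k r i⟩

/-- The map from `B` to the direct sum of its homogeneous components. -/
def decomposeHom : B k r →ₐ[k] DirectSum ℤ fun n => grading k r n :=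
  RingQuot.liftAlgHom k ⟨FreeAlgebra.lift k (genGraded k r), by
    rintro _ _ ⟨⟩
    rw [map_pow, map_zero, FreeAlgebra.lift_ι_apply, genGraded, DirectSum.ofPow]
    have h : (GradedMonoid.GMonoid.gnpow (A := fun n => grading k r n) (r + 1)
        (⟨gen k r 1, gen_mem k r 1⟩ : grading k r 1)) = (0 : grading k r ((r + 1) • (1 : ℤ))) :=
      Subtype.ext (gen_pow k r)
    exact (congrArg _ h).trans (map_zero _)⟩

theorem decomposeHom_gen (i : Fin 2) : decomposeHom k r (gen k r i) = genGraded k r i := by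
  rw [decomposeHom, gen, RingQuot.liftAlgHom_mkAlgHom_apply, FreeAlgebra.lift_ι_apply]

theorem decomposeHom_word (w : List (Fin 2)) :
    ∀ (n : ℤ) (h : (w.map (gen k r)).prod ∈ grading k r n), (w.length : ℤ) = n →
    decomposeHom k r (w.map (gen k r)).prod =
      DirectSum.of (fun n => grading k r n) n ⟨(w.map (gen k r)).prod, h⟩ := by
  induction w with
  | nil =>
    rintro n h rfl
    simp only [List.map_nil, List.prod_nil, map_one]
    rfl
  | cons i w ih =>
    rintro n h rfl
    have hw : (w.map (gen k r)).prod ∈ grading k r (w.length : ℤ) :=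
      Submodule.subset_span ⟨w, rfl, rfl⟩
    simp only [List.map_cons, List.prod_cons, map_mul]
    rw [ih _ hw rfl, decomposeHom_gen, genGraded, DirectSum.of_mul_of]
    exact DirectSum.of_eq_of_gradedMonoid_eq
      (Sigma.subtype_ext (add_comm _ _) rfl)

/-- `B` is the direct sum of its homogeneous components. -/
instance gradedAlgebra : GradedAlgebra (grading k r) :=
  GradedAlgebra.ofAlgHom _ (decomposeHom k r)
    (by
      apply RingQuot.ringQuot_ext'
      ext i
      simp only [AlgHom.comp_apply, Function.comp_apply, AlgHom.id_apply]
      change DirectSum.coeAlgHom (grading k r) (decomposeHom k r (gen k r i)) = gen k r i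
      rw [decomposeHom_gen, genGraded, DirectSum.coeAlgHom_of])
    (by
      rintro n ⟨x, hx⟩
      change decomposeHom k r x = _
      induction hx using Submodule.span_induction with
      | mem x h =>
        obtain ⟨w, hw, rfl⟩ := h
        exact decomposeHom_word k r w n _ hw
      | zero =>
        rw [map_zero]
        exact (map_zero (DirectSum.of (fun n => grading k r n) n)).symm
      | add x y hx hy ihx ihy =>
        rw [map_add, ihx, ihy, ← map_add]
        rfl
      | smul a x hx ih =>
        rw [map_smul, ih]
        exact (map_smul (DirectSum.lof k ℤ (fun n => grading k r n) n) a _).symm)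

end TheAlgebra

/-! ### The direct limit of the algebras `S_n` -/

section TheLimit

/-- Put `b_j = 2 ^ j` for `j ≤ r` and `b_{j+1} = b_j + ⋯ + b_{j-r}` for `j ≥ r`, so that
`b_j = dim B_j`. Then `blockSize r m i = b_{m+r-i}` for `0 ≤ i ≤ r`. In terms of `n = m + r + 1`
these are the sizes `b_{n-1}, …, b_{n-r-1}` of the factors of `S_n`, `n ≥ r + 1`. -/
def blockSize (r : ℕ) : ℕ → Fin (r + 1) → ℕ
  | 0 => fun i => 2 ^ (r - (i : ℕ))
  | m + 1 => Fin.cons (∑ j, blockSize r m j) fun i : Fin r => blockSize r m i.castSucc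

/-- For `r = 1` the sizes are consecutive Fibonacci numbers: with `f_0 = f_1 = 1`, that is
`f_n = Nat.fib (n + 1)`, and `n = m + 2`, they are `f_n` and `f_{n-1}`. -/
theorem blockSize_one (m : ℕ) :
    blockSize 1 m 0 = Nat.fib (m + 3) ∧ blockSize 1 m 1 = Nat.fib (m + 2) := by
  induction m with
  | zero => decide
  | succ m ih =>
    refine ⟨?_, ih.1⟩
    change ∑ j, blockSize 1 m j = _
    rw [Fin.sum_univ_two, ih.1, ih.2, add_comm, ← Nat.fib_add_two]

variable (k : Type u) [Field k] (r : ℕ)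

/-- The algebra `S_n`, `n = m + r + 1`, a product of `r + 1` matrix algebras
of sizes `b_{n-1}, …, b_{n-r-1}`. -/
abbrev SAlg (m : ℕ) : Type u :=
  ∀ i : Fin (r + 1), Matrix (Fin (blockSize r m i)) (Fin (blockSize r m i)) k

/-- The block diagonal embedding `(g_0, …, g_r) ↦ diag(g_0, …, g_r)`. -/
def diagHom (m : ℕ) : SAlg k r m →ₐ[k]
    Matrix (Fin (∑ j, blockSize r m j)) (Fin (∑ j, blockSize r m j)) k :=
  (Matrix.reindexAlgEquiv k k finSigmaFinEquiv).toAlgHom.comp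
    { Matrix.blockDiagonal'RingHom (fun j => Fin (blockSize r m j)) k with
      commutes' := fun c => by
        change Matrix.blockDiagonal' _ = _
        rw [Algebra.algebraMap_eq_smul_one, Algebra.algebraMap_eq_smul_one,
          Matrix.blockDiagonal'_smul, Matrix.blockDiagonal'_one] }

/-- The map `φ_n : S_n → S_{n+1}`, `(g_0, …, g_r) ↦ (diag(g_0, …, g_r), g_0, …, g_{r-1})`. -/
def phi (m : ℕ) : SAlg k r m →ₐ[k] SAlg k r (m + 1) :=
  AlgHom.pi (Fin.cases (diagHom k r m)
    fun i : Fin r => Pi.evalAlgHom k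
      (fun i => Matrix (Fin (blockSize r m i)) (Fin (blockSize r m i)) k) i.castSucc)

/-- The composite `φ_{n-1} ∘ ⋯ ∘ φ_m`. -/
def transition (m n : ℕ) (h : m ≤ n) : SAlg k r m →ₐ[k] SAlg k r n :=
  Nat.leRecOn h (fun {l} f => (phi k r l).comp f) (AlgHom.id k (SAlg k r m))

theorem transition_self (m : ℕ) (h : m ≤ m) : transition k r m m h = AlgHom.id k _ :=
  Nat.leRecOn_self _

theorem transition_succ (m n : ℕ) (h : m ≤ n) (h' : m ≤ n + 1) :
    transition k r m (n + 1) h' = (phi k r n).comp (transition k r m n h) :=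
  Nat.leRecOn_succ h _

instance directedSystem :
    DirectedSystem (SAlg k r) (fun m n h => transition k r m n h) where
  map_self m x := by rw [transition_self]; rfl
  map_map := by
    intro n m l hlm hmn x
    induction n, hmn using Nat.le_induction with
    | base => rw [transition_self]; rfl
    | succ n hmn ih =>
      rw [transition_succ k r m n hmn, transition_succ k r l n (hlm.trans hmn)]
      exact congrArg (phi k r n) ih

/-- The `k`-algebra `S`, the direct limit of the system `(S_n, φ_n)`. -/
abbrev SLim : Type u := DirectLimit (SAlg k r) (transition k r)

/-- The category of right `S`-modules. -/
abbrev ModS : Type (u + 1) := ModuleCat.{u} (SLim k r)ᵐᵒᵖ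

/-- The finitely presented right `S`-modules. -/
def isFPModS : ObjectProperty (ModS k r) :=
  fun M => Module.FinitePresentation (SLim k r)ᵐᵒᵖ M

/-- `S` as a right module over itself. -/
abbrev SRight : ModS k r := ModuleCat.of (SLim k r)ᵐᵒᵖ (SLim k r)

end TheLimit

end NCProj

end

noncomputable section

namespace NCProj

/-! ### Homogeneous components, quotients, products and free graded modules -/

section Internal

variable {k : Type u} [Field k] {V : Type*} [AddCommGroup V] [Module k V]

/-! The equivalence is the functor of global sections, M ↦ lim Hom_B(B_{≥n}, M), which is morally
Hom(𝒪, M) in `QGr`. The nonzero words of length n form a basis of B_n, and B_{≥n} is the direct sum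
of the left ideals B w over these words w; if w = y^i x ⋯, the only relation on w is y^(r+1-i) w =
0. A homomorphism from B_{≥n} is thus a family of elements of M_n indexed by words and subject to
these annihilation conditions. `Stage` drops the conditions: the map w ↦ (x w, y w) between stages
enforces them after r+1 steps, so the limit `Sec M` is the same. The matrices in S_n act on families
by mixing words with the same leading power y^i, and the recursion for words of length n+1 is
exactly φ_n, so `Sec M` is a right S-module.

Three facts carry the first equivalence. Every S-submodule of `Sec M` comes from a homogeneous
submodule of M (`secOfSub_subOfSec`), because a submodule is determined by its elementary families
and these can be moved between blocks (`SingleMem.of_rel`). Sections forget exactly the torsion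
(`secOfSub_le_iff`, `isoModFdim_iff`). Free graded modules have free modules of sections, with B
going to S (`secSelfEquiv`, `secFreeMap_surjective`). Hence every S-module, as a quotient of a free
one, is a module of sections; a homomorphism φ of sections is realised by dividing X ⊕ Y by a
submodule with sections {(a, -φ a)}; and two morphisms equal on sections agree after dividing by the
image of their difference. By `isEquivalence_lift` such a functor induces an equivalence on the
localization.

For finitely presented modules the essential point is `exists_relations_trivial`: in large degrees x
a + y c = 0 forces a = 0 and c ∈ y^r M, as in a free module. It makes torsion finite dimensional
(`finite_of_torsMod`) and sections finitely presented (`sec_finitePresentation`), so the same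
constructions, with finiteness recorded, give the second equivalence. -/

theorem isInternal_of_proj (D : ℤ → Submodule k V) (π : ℤ → V →ₗ[k] V)
    (h_self : ∀ n v, v ∈ D n → π n v = v) (h_ne : ∀ n n' v, n ≠ n' → v ∈ D n' → π n v = 0)
    (h_top : ⨆ n, D n = ⊤) : DirectSum.IsInternal D := by
  rw [DirectSum.isInternal_submodule_iff_iSupIndep_and_iSup_eq_top]
  refine ⟨fun n => ?_, h_top⟩
  rw [Submodule.disjoint_def]
  intro v hv hv'
  have : (⨆ j, ⨆ (_ : j ≠ n), D j) ≤ LinearMap.ker (π n) :=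
    iSup_le fun j => iSup_le fun hj w hw => h_ne n j w hj.symm hw
  rw [← h_self n v hv]
  exact this hv'

end Internal

namespace GrMod

variable {k : Type u} [Field k] {A : Type u} [Ring A] [Algebra k A] {𝒜 : ℤ → Submodule k A}

section Proj

variable (M : GrMod k 𝒜)

/-- The isomorphism of a graded module with the direct sum of its components. -/
def decomp : M.carrier ≃ₗ[k] DirectSum ℤ fun n => M.deg n :=
  (LinearEquiv.ofBijective (DirectSum.coeLinearMap M.deg) M.isInternal).symm

/-- The projection of a graded module on its component of degree `n`. -/
def proj (n : ℤ) : M.carrier →ₗ[k] M.carrier :=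
  (M.deg n).subtype ∘ₗ DirectSum.component k ℤ (fun n => M.deg n) n ∘ₗ M.decomp.toLinearMap

theorem proj_mem (n : ℤ) (m : M.carrier) : M.proj n m ∈ M.deg n :=
  ((DirectSum.component k ℤ (fun n => M.deg n) n) (M.decomp m)).2

theorem decomp_of_mem {n : ℤ} {m : M.carrier} (h : m ∈ M.deg n) :
    M.decomp m = DirectSum.lof k ℤ (fun n => M.deg n) n ⟨m, h⟩ := by
  rw [decomp, LinearEquiv.symm_apply_eq]
  exact (DirectSum.coeLinearMap_lof M.deg n ⟨m, h⟩).symm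

variable {M}

theorem proj_of_mem {n : ℤ} {m : M.carrier} (h : m ∈ M.deg n) : M.proj n m = m := by
  simp [proj, decomp_of_mem M h, DirectSum.component.lof_self]

theorem proj_of_mem_ne {n n' : ℤ} {m : M.carrier} (h : m ∈ M.deg n') (hn : n ≠ n') :
    M.proj n m = 0 := by
  simp [proj, decomp_of_mem M h, DirectSum.component.of, hn.symm]

variable (M)

theorem iSup_deg : ⨆ n, M.deg n = ⊤ := M.isInternal.submodule_iSup_eq_top

/-- An element of a graded module is the sum of its components. -/
theorem exists_sum_proj (m : M.carrier) :
    ∃ s : Finset ℤ, m = ∑ n ∈ s, M.proj n m ∧ ∀ n ∉ s, M.proj n m = 0 := by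
  classical
  refine ⟨DFinsupp.support (M.decomp m), ?_, ?_⟩
  · have h := DirectSum.sum_support_of (M.decomp m)
    have h2 := congrArg M.decomp.symm h
    rw [map_sum, LinearEquiv.symm_apply_apply] at h2
    rw [← h2]
    refine Finset.sum_congr (by rw [h2]) fun n _ => ?_
    rw [h2]
    simp only [decomp, LinearEquiv.symm_symm]
    exact DirectSum.coeAddMonoidHom_of _ _ _
  · intro n hn
    rw [DFinsupp.notMem_support_iff] at hn
    change ((M.decomp m n : M.deg n) : M.carrier) = 0
    rw [hn]
    rfl

variable {M}

/-- Induction on homogeneous elements. -/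
theorem homog_induction {p : M.carrier → Prop} (h_homog : ∀ n, ∀ m ∈ M.deg n, p m)
    (h_zero : p 0) (h_add : ∀ m m', p m → p m' → p (m + m')) (m : M.carrier) : p m := by
  have hm : m ∈ ⨆ n, M.deg n := by rw [iSup_deg]; trivial
  exact Submodule.iSup_induction _ (motive := p) hm h_homog h_zero h_add

theorem eq_zero_of_proj {m : M.carrier} (h : ∀ n, M.proj n m = 0) : m = 0 := by
  obtain ⟨s, hs, -⟩ := M.exists_sum_proj m
  rw [hs]
  exact Finset.sum_eq_zero fun n _ => h n

theorem proj_smul {i : ℤ} {a : A} (ha : a ∈ 𝒜 i) (n : ℤ) (m : M.carrier) :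
    M.proj n (a • m) = a • M.proj (n - i) m := by
  induction m using homog_induction with
  | h_homog j m hm =>
    have h := M.smul_mem ha hm
    by_cases hj : n - i = j
    · rw [hj, proj_of_mem hm]
      obtain rfl : n = i + j := by omega
      exact proj_of_mem h
    · rw [proj_of_mem_ne hm hj, proj_of_mem_ne h (by omega), smul_zero]
  | h_zero => simp
  | h_add m m' h h' => simp [h, h']

theorem Hom.map_proj {M N : GrMod k 𝒜} (f : Hom M N) (n : ℤ) (m : M.carrier) :
    N.proj n (f.toLin m) = f.toLin (M.proj n m) := by
  induction m using homog_induction with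
  | h_homog j m hm =>
    have h := f.map_deg j m hm
    by_cases hj : n = j
    · subst hj
      rw [proj_of_mem hm, proj_of_mem h]
    · rw [proj_of_mem_ne hm hj, proj_of_mem_ne h hj, map_zero]
  | h_zero => simp
  | h_add m m' h h' => simp [h, h']

end Proj

/-- Build a graded module from projections on its components. -/
abbrev ofProj (V : Type u) [AddCommGroup V] [Module k V] [Module A V] [IsScalarTower k A V]
    (D : ℤ → Submodule k V) (π : ℤ → V →ₗ[k] V)
    (h_self : ∀ n v, v ∈ D n → π n v = v) (h_ne : ∀ n n' v, n ≠ n' → v ∈ D n' → π n v = 0)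
    (h_top : ⨆ n, D n = ⊤)
    (h_smul : ∀ {i j : ℤ} {a : A} {m : V}, a ∈ 𝒜 i → m ∈ D j → a • m ∈ D (i + j)) :
    GrMod k 𝒜 where
  carrier := V
  deg := D
  isInternal := isInternal_of_proj D π h_self h_ne h_top
  smul_mem := h_smul

/-- A submodule of a graded module is homogeneous if it contains the components of its
elements. -/
def IsHomog (M : GrMod k 𝒜) (U : Submodule A M.carrier) : Prop :=
  ∀ u ∈ U, ∀ n, M.proj n u ∈ U

theorem isHomog_ker {M N : GrMod k 𝒜} (f : M ⟶ N) : M.IsHomog (LinearMap.ker f.toLin) := by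
  intro u hu n
  rw [LinearMap.mem_ker] at hu ⊢
  rw [← Hom.map_proj, hu, map_zero]

theorem isHomog_range {M N : GrMod k 𝒜} (f : M ⟶ N) : N.IsHomog (LinearMap.range f.toLin) := by
  rintro _ ⟨u, rfl⟩ n
  exact ⟨M.proj n u, (Hom.map_proj f n u).symm⟩

/-- The difference of two morphisms of graded modules. -/
def subHom {M N : GrMod k 𝒜} (f g : M ⟶ N) : M ⟶ N where
  toLin := f.toLin - g.toLin
  map_deg i m h := (N.deg i).sub_mem (f.map_deg i m h) (g.map_deg i m h)

section Quotient

variable (M : GrMod k 𝒜) (U : Submodule A M.carrier) (hU : M.IsHomog U)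

/-- The quotient of a graded module by a homogeneous submodule. -/
def quot : GrMod k 𝒜 :=
  ofProj (M.carrier ⧸ U) (fun n => (M.deg n).map (U.mkQ.restrictScalars k))
    (fun n => (U.restrictScalars k).mapQ (U.restrictScalars k) (M.proj n) fun u hu => hU u hu n)
    (by
      rintro n _ ⟨m, hm, rfl⟩
      exact congrArg U.mkQ (proj_of_mem hm))
    (by
      rintro n n' _ hn ⟨m, hm, rfl⟩
      refine (congrArg U.mkQ (proj_of_mem_ne hm hn)).trans (map_zero _))
    (by
      rw [← Submodule.map_iSup, iSup_deg, Submodule.map_top, LinearMap.range_eq_top]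
      exact U.mkQ_surjective)
    (by
      rintro i j a _ ha ⟨m, hm, rfl⟩
      exact ⟨a • m, M.smul_mem ha hm, rfl⟩)

/-- The projection on the quotient by a homogeneous submodule. -/
def quotMk : M ⟶ M.quot U hU where
  toLin := U.mkQ
  map_deg _ m h := ⟨m, h, rfl⟩

theorem ker_quotMk : LinearMap.ker (M.quotMk U hU).toLin = U := Submodule.ker_mkQ U

theorem quotMk_surjective : Function.Surjective (M.quotMk U hU).toLin := U.mkQ_surjective

end Quotient

section Prod

variable (M N : GrMod k 𝒜)

/-- The direct sum of two graded modules. -/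
def prod : GrMod k 𝒜 :=
  ofProj (M.carrier × N.carrier) (fun n => (M.deg n).prod (N.deg n))
    (fun n => (M.proj n).prodMap (N.proj n))
    (by
      rintro n ⟨a, b⟩ ⟨ha, hb⟩
      exact Prod.ext (proj_of_mem ha) (proj_of_mem hb))
    (by
      rintro n n' ⟨a, b⟩ hn ⟨ha, hb⟩
      exact Prod.ext (proj_of_mem_ne ha hn) (proj_of_mem_ne hb hn))
    (by
      rw [eq_top_iff]
      rintro ⟨a, b⟩ -
      have ha : ((a, 0) : M.carrier × N.carrier) ∈ ⨆ n, (M.deg n).prod (N.deg n) := by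
        induction a using homog_induction with
        | h_homog n a h => exact Submodule.mem_iSup_of_mem n ⟨h, zero_mem _⟩
        | h_zero => exact zero_mem _
        | h_add a a' h h' => simpa using add_mem h h'
      have hb : ((0, b) : M.carrier × N.carrier) ∈ ⨆ n, (M.deg n).prod (N.deg n) := by
        induction b using homog_induction with
        | h_homog n a h => exact Submodule.mem_iSup_of_mem n ⟨zero_mem _, h⟩
        | h_zero => exact zero_mem _
        | h_add a a' h h' => simpa using add_mem h h'
      simpa using add_mem ha hb)
    (by
      rintro i j a ⟨m, n⟩ ha ⟨hm, hn⟩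
      exact ⟨M.smul_mem ha hm, N.smul_mem ha hn⟩)

/-- The first inclusion in a direct sum. -/
def inl : M ⟶ M.prod N where
  toLin := LinearMap.inl A M.carrier N.carrier
  map_deg _ _ h := ⟨h, zero_mem _⟩

/-- The second inclusion in a direct sum. -/
def inr : N ⟶ M.prod N where
  toLin := LinearMap.inr A M.carrier N.carrier
  map_deg _ _ h := ⟨zero_mem _, h⟩

/-- The first projection of a direct sum. -/
def fst : M.prod N ⟶ M where
  toLin := LinearMap.fst A M.carrier N.carrier
  map_deg _ _ h := h.1

/-- The second projection of a direct sum. -/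
def snd : M.prod N ⟶ N where
  toLin := LinearMap.snd A M.carrier N.carrier
  map_deg _ _ h := h.2

end Prod

section Free

variable {J : Type u} (d : J → ℤ)

variable (𝒜) in
/-- The component of degree `n` of the free graded module with generators of degrees `d j`. -/
def freeDeg (n : ℤ) : Submodule k (J →₀ A) where
  carrier := {p | ∀ j, p j ∈ 𝒜 (n - d j)}
  add_mem' {p q} hp hq j := by
    rw [Finsupp.add_apply]
    exact add_mem (hp j) (hq j)
  zero_mem' j := zero_mem _
  smul_mem' c p hp j := by
    rw [Finsupp.smul_apply]
    exact Submodule.smul_mem _ c (hp j)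

theorem single_mem_freeDeg {n : ℤ} {a : A} (j : J) (ha : a ∈ 𝒜 n) :
    Finsupp.single j a ∈ freeDeg 𝒜 d (n + d j) := by
  intro j'
  by_cases hj : j = j'
  · subst hj
    rw [Finsupp.single_eq_same, add_sub_cancel_right]
    exact ha
  · rw [Finsupp.single_eq_of_ne' hj]
    exact zero_mem _

variable [GradedAlgebra 𝒜]

theorem iSup_freeDeg : ⨆ n, freeDeg 𝒜 d n = ⊤ := by
  rw [eq_top_iff]
  intro p _
  induction p using Finsupp.induction_linear with
  | zero => exact zero_mem _
  | add p q hp hq => exact add_mem (hp trivial) (hq trivial)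
  | single j a =>
    have ha : a ∈ ⨆ n, 𝒜 n := by
      rw [(DirectSum.Decomposition.isInternal 𝒜).submodule_iSup_eq_top]
      trivial
    induction ha using Submodule.iSup_induction' with
    | mem n a ha => exact Submodule.mem_iSup_of_mem _ (single_mem_freeDeg d j ha)
    | zero =>
      rw [Finsupp.single_zero]
      exact zero_mem _
    | add a b _ _ ha hb =>
      rw [Finsupp.single_add]
      exact add_mem (ha trivial) (hb trivial)

variable (𝒜) in
/-- The free graded module with generators of degrees `d j`. -/
def free : GrMod k 𝒜 :=
  ofProj (J →₀ A) (freeDeg 𝒜 d)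
    (fun n => Finsupp.lsum k fun j => Finsupp.lsingle j ∘ₗ (self 𝒜).proj (n - d j))
    (by
      intro n p hp
      rw [Finsupp.lsum_apply]
      conv_rhs => rw [← Finsupp.sum_single p]
      refine Finsupp.sum_congr fun j _ => ?_
      exact congrArg (Finsupp.single j) (proj_of_mem (M := self 𝒜) (hp j)))
    (by
      intro n n' p hn hp
      rw [Finsupp.lsum_apply]
      refine Finset.sum_eq_zero fun j _ => ?_
      exact (congrArg (Finsupp.single j) (proj_of_mem_ne (M := self 𝒜) (hp j)
        (by omega))).trans (Finsupp.single_zero j))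
    (iSup_freeDeg d)
    (by
      intro i j a p ha hp l
      have := SetLike.GradedMul.mul_mem ha (hp l)
      rwa [← add_sub_assoc] at this)

/-- The morphism from a free graded module given by the images of the generators. -/
def freeLift {M : GrMod k 𝒜} (g : J → M.carrier) (hg : ∀ j, g j ∈ M.deg (d j)) :
    free 𝒜 d ⟶ M where
  toLin := Finsupp.linearCombination A g
  map_deg n p hp := by
    change Finsupp.sum p (fun j a => a • g j) ∈ M.deg n
    refine Submodule.sum_mem _ fun j _ => ?_
    have := M.smul_mem (hp j) (hg j)
    rwa [sub_add_cancel] at this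

theorem range_freeLift {M : GrMod k 𝒜} (g : J → M.carrier) (hg : ∀ j, g j ∈ M.deg (d j)) :
    LinearMap.range (freeLift d g hg).toLin = Submodule.span A (Set.range g) :=
  Finsupp.range_linearCombination A

/-- The span is the image of a free graded module whose generators carry the degrees of the elements
of `T`, and images of graded morphisms are homogeneous. -/
theorem isHomog_span {M : GrMod k 𝒜} {T : Set M.carrier} (hT : ∀ t ∈ T, ∃ n, t ∈ M.deg n) :
    M.IsHomog (Submodule.span A T) := by
  choose d hd using fun t : T => hT t.1 t.2
  have := isHomog_range (freeLift d Subtype.val hd)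
  rwa [range_freeLift, Subtype.range_coe] at this

/-- A finitely generated homogeneous submodule is the image of a finite free graded module. -/
theorem exists_free_range_eq {M : GrMod k 𝒜} {U : Submodule A M.carrier} (hU : M.IsHomog U)
    (hfg : U.FG) : ∃ (J : Type u) (_ : Finite J) (d : J → ℤ) (q : free 𝒜 d ⟶ M),
      LinearMap.range q.toLin = U := by
  obtain ⟨s, hs⟩ := hfg
  have hsU : ∀ g ∈ s, g ∈ U := fun g hg => hs ▸ Submodule.subset_span hg
  choose t ht _ using M.exists_sum_proj
  -- The nonhomogeneous generators are replaced by their components, which lie in `U` by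
  -- homogeneity.
  let J : Type u := Σ g : s, ULift.{u} (t g.1)
  let g : J → M.carrier := fun j => M.proj j.2.down j.1.1
  refine ⟨J, inferInstance, fun j => j.2.down,
    freeLift _ g fun j => proj_mem _ _ _, ?_⟩
  rw [range_freeLift]
  refine le_antisymm (Submodule.span_le.2 ?_) ?_
  · rintro _ ⟨j, rfl⟩
    exact hU _ (hsU _ j.1.2) _
  · rw [← hs, Submodule.span_le]
    intro a ha
    rw [ht a]
    exact Submodule.sum_mem _ fun n hn => Submodule.subset_span ⟨⟨⟨a, ha⟩, ⟨⟨n, hn⟩⟩⟩, rfl⟩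

end Free

end GrMod

/-! ### A monomial basis of `B` -/

section Basis

variable (k : Type u) [Field k] (r : ℕ)

/-- The pair `(i, [l₀, l₁, …])` stands for the word `y^i x y^l₀ x y^l₁ ⋯`. -/
abbrev NWord : Type := Fin (r + 1) × List (Fin (r + 1))

/-- Left multiplication by `x` on the space spanned by the nonzero words. -/
def opX : (NWord r →₀ k) →ₗ[k] (NWord r →₀ k) :=
  Finsupp.lmapDomain k k fun w => (0, w.1 :: w.2)

/-- Left multiplication by `y` on the space spanned by the nonzero words. -/
def opY : (NWord r →₀ k) →ₗ[k] (NWord r →₀ k) :=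
  Finsupp.linearCombination k fun w =>
    if h : (w.1 : ℕ) + 1 < r + 1 then Finsupp.single (⟨w.1 + 1, h⟩, w.2) 1 else 0

variable {k r}

theorem opX_single (w : NWord r) (c : k) :
    opX k r (Finsupp.single w c) = Finsupp.single (0, w.1 :: w.2) c := by
  simp [opX]

theorem opY_single (w : NWord r) :
    opY k r (Finsupp.single w 1) =
      if h : (w.1 : ℕ) + 1 < r + 1 then Finsupp.single (⟨w.1 + 1, h⟩, w.2) 1 else 0 := by
  simp [opY]

theorem opY_pow_single (n : ℕ) (i : Fin (r + 1)) (l : List (Fin (r + 1))) :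
    (opY k r ^ n) (Finsupp.single (i, l) 1) =
      if h : (i : ℕ) + n < r + 1 then Finsupp.single (⟨i + n, h⟩, l) 1 else 0 := by
  induction n with
  | zero => simp [i.is_le]
  | succ n ih =>
    rw [pow_succ', Module.End.mul_apply, ih]
    by_cases h : (i : ℕ) + n < r + 1
    · rw [dif_pos h, opY_single]
      rfl
    · rw [dif_neg h, map_zero, dif_neg (by omega)]

theorem opX_apply_zero_cons (v : NWord r →₀ k) (i : Fin (r + 1)) (l : List (Fin (r + 1))) :
    opX k r v (0, i :: l) = v (i, l) := by
  have hinj : Function.Injective fun w : NWord r => ((0, w.1 :: w.2) : NWord r) := by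
    rintro ⟨i, l⟩ ⟨i', l'⟩ h
    simpa using h
  exact Finsupp.mapDomain_apply hinj v (i, l)

theorem opY_apply_zero (v : NWord r →₀ k) (l : List (Fin (r + 1))) :
    opY k r v (0, l) = 0 := by
  induction v using Finsupp.induction_linear with
  | zero => simp
  | add v w hv hw => simp [hv, hw]
  | single w c =>
    rw [← mul_one c, ← smul_eq_mul, ← Finsupp.smul_single, map_smul, opY_single]
    split_ifs with h
    · rw [Finsupp.smul_apply, Finsupp.single_eq_of_ne, smul_zero]
      intro h
      have := congrArg (fun w : NWord r => (w.1 : ℕ)) h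
      simp at this
    · simp

theorem opY_apply_succ (v : NWord r →₀ k) (i : Fin (r + 1)) (h : (i : ℕ) + 1 < r + 1)
    (l : List (Fin (r + 1))) : opY k r v (⟨i + 1, h⟩, l) = v (i, l) := by
  classical
  induction v using Finsupp.induction_linear with
  | zero => simp
  | add v w hv hw => simp [hv, hw]
  | single w c =>
    obtain ⟨i', l'⟩ := w
    rw [← mul_one c, ← smul_eq_mul, ← Finsupp.smul_single, map_smul, opY_single]
    simp only [Finsupp.smul_apply]
    split_ifs with h'
    · simp only [Finsupp.single_apply, Prod.mk.injEq, Fin.ext_iff]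
      simp
    · rw [Finsupp.single_eq_of_ne]
      · simp
      · rintro ⟨rfl, rfl⟩
        exact h' h

variable (k r)

/-- The action of `B` on the space spanned by the nonzero words. -/
def wordRep : B k r →ₐ[k] Module.End k (NWord r →₀ k) :=
  RingQuot.liftAlgHom k ⟨FreeAlgebra.lift k ![opX k r, opY k r], by
    rintro _ _ ⟨⟩
    rw [map_pow, map_zero, FreeAlgebra.lift_ι_apply]
    refine Finsupp.lhom_ext' fun ⟨i, l⟩ => LinearMap.ext_ring ?_
    change (opY k r ^ (r + 1)) (Finsupp.single (i, l) 1) = 0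
    rw [opY_pow_single, dif_neg (by omega)]⟩

theorem wordRep_gen_zero : wordRep k r (gen k r 0) = opX k r := by
  rw [wordRep, gen, RingQuot.liftAlgHom_mkAlgHom_apply, FreeAlgebra.lift_ι_apply]
  rfl

theorem wordRep_gen_one : wordRep k r (gen k r 1) = opY k r := by
  rw [wordRep, gen, RingQuot.liftAlgHom_mkAlgHom_apply, FreeAlgebra.lift_ι_apply]
  rfl

/-- The element `x y^l₀ x y^l₁ ⋯` of `B`. -/
def wordTail : List (Fin (r + 1)) → B k r
  | [] => 1
  | i :: l => gen k r 0 * (gen k r 1 ^ (i : ℕ) * wordTail l)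

/-- The element `y^i x y^l₀ x y^l₁ ⋯` of `B`. -/
def word (w : NWord r) : B k r := gen k r 1 ^ (w.1 : ℕ) * wordTail k r w.2

/-- The coordinates of an element of `B` in the basis of nonzero words. -/
def coords : B k r →ₗ[k] (NWord r →₀ k) :=
  (LinearMap.applyₗ (Finsupp.single (0, []) 1)) ∘ₗ (wordRep k r).toLinearMap

/-- The element of `B` with given coordinates in the basis of nonzero words. -/
def ofCoords : (NWord r →₀ k) →ₗ[k] B k r := Finsupp.linearCombination k (word k r)

variable {k r}

theorem coords_mul (a b : B k r) : coords k r (a * b) = wordRep k r a (coords k r b) := by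
  simp [coords]

theorem x_mul_word (w : NWord r) : gen k r 0 * word k r w = word k r (0, w.1 :: w.2) := by
  simp [word, wordTail]

theorem y_mul_word (w : NWord r) (h : (w.1 : ℕ) + 1 < r + 1) :
    gen k r 1 * word k r w = word k r (⟨w.1 + 1, h⟩, w.2) := by
  simp [word, pow_succ', mul_assoc]

theorem y_pow_mul_word (w : NWord r) : gen k r 1 ^ (r + 1 - (w.1 : ℕ)) * word k r w = 0 := by
  rw [word, ← mul_assoc, ← pow_add, Nat.sub_add_cancel (by omega), gen_pow, zero_mul]

theorem y_mul_word_of_not_lt (w : NWord r) (h : ¬ (w.1 : ℕ) + 1 < r + 1) :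
    gen k r 1 * word k r w = 0 := by
  have := y_pow_mul_word (k := k) w
  rwa [show r + 1 - (w.1 : ℕ) = 1 by omega, pow_one] at this

theorem ofCoords_single (w : NWord r) : ofCoords k r (Finsupp.single w 1) = word k r w := by
  simp [ofCoords]

theorem ofCoords_opX (v : NWord r →₀ k) :
    ofCoords k r (opX k r v) = gen k r 0 * ofCoords k r v := by
  have : ofCoords k r ∘ₗ opX k r = LinearMap.mulLeft k (gen k r 0) ∘ₗ ofCoords k r := by
    refine Finsupp.lhom_ext' fun w => LinearMap.ext_ring ?_
    simp only [LinearMap.comp_apply, Finsupp.lsingle_apply, opX_single, ofCoords_single,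
      LinearMap.mulLeft_apply, x_mul_word]
  exact LinearMap.congr_fun this v

theorem ofCoords_opY (v : NWord r →₀ k) :
    ofCoords k r (opY k r v) = gen k r 1 * ofCoords k r v := by
  have : ofCoords k r ∘ₗ opY k r = LinearMap.mulLeft k (gen k r 1) ∘ₗ ofCoords k r := by
    refine Finsupp.lhom_ext' fun w => LinearMap.ext_ring ?_
    simp only [LinearMap.comp_apply, Finsupp.lsingle_apply, opY_single, ofCoords_single,
      LinearMap.mulLeft_apply]
    split_ifs with h
    · rw [ofCoords_single, y_mul_word w h]
    · rw [map_zero, y_mul_word_of_not_lt w h]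
  exact LinearMap.congr_fun this v

/-- A subspace of a `B`-module that is stable under `x` and `y` is stable under `B`. -/
theorem smul_mem_of_gen {M : Type*} [AddCommGroup M] [Module k M] [Module (B k r) M]
    [IsScalarTower k (B k r) M] (D : Submodule k M)
    (h : ∀ i, ∀ m ∈ D, gen k r i • m ∈ D) (b : B k r) : ∀ m ∈ D, b • m ∈ D := by
  have hb : b ∈ ⨆ n, grading k r n := by
    rw [(DirectSum.Decomposition.isInternal (grading k r)).submodule_iSup_eq_top]
    trivial
  induction hb using Submodule.iSup_induction' with
  | zero =>
    intro m _
    rw [zero_smul]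
    exact zero_mem _
  | add a b _ _ ha hb =>
    intro m hm
    rw [add_smul]
    exact add_mem (ha m hm) (hb m hm)
  | mem n b hb =>
    induction hb using Submodule.span_induction with
    | zero =>
      intro m _
      rw [zero_smul]
      exact zero_mem _
    | add a b _ _ ha hb =>
      intro m hm
      rw [add_smul]
      exact add_mem (ha m hm) (hb m hm)
    | smul c b _ hb =>
      intro m hm
      rw [smul_assoc]
      exact D.smul_mem c (hb m hm)
    | mem b hb =>
      obtain ⟨w, -, rfl⟩ := hb
      induction w with
      | nil =>
        intro m hm
        simpa using hm
      | cons i w ih =>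
        intro m hm
        rw [List.map_cons, List.prod_cons, mul_smul]
        exact h i _ (ih m hm)

/-- Equivariance is stability under B of the graph of `ofCoords`, and by `smul_mem_of_gen` this need
only be checked for x and y. -/
theorem ofCoords_wordRep (b : B k r) (v : NWord r →₀ k) :
    ofCoords k r (wordRep k r b v) = b * ofCoords k r v := by
  let : Module (B k r) (NWord r →₀ k) := Module.compHom _ (wordRep k r).toRingHom
  have : IsScalarTower k (B k r) (NWord r →₀ k) :=
    ⟨fun c b v => by
      change wordRep k r (c • b) v = c • wordRep k r b v
      rw [map_smul]
      rfl⟩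
  let D : Submodule k ((NWord r →₀ k) × B k r) :=
    LinearMap.ker ((ofCoords k r) ∘ₗ LinearMap.fst k _ _ - LinearMap.snd k _ _)
  have hD : ∀ p, p ∈ D ↔ ofCoords k r p.1 = p.2 := fun p => by
    rw [LinearMap.mem_ker, LinearMap.sub_apply, sub_eq_zero]
    rfl
  refine (hD _).1 (smul_mem_of_gen D (fun i p hp => ?_) b (v, ofCoords k r v) ((hD _).2 rfl))
  rw [hD] at hp ⊢
  obtain ⟨v, a⟩ := p
  change ofCoords k r v = a at hp
  change ofCoords k r (wordRep k r (gen k r i) v) = gen k r i * a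
  subst hp
  fin_cases i
  · change ofCoords k r (wordRep k r (gen k r 0) v) = gen k r 0 * _
    rw [wordRep_gen_zero, ofCoords_opX]
  · change ofCoords k r (wordRep k r (gen k r 1) v) = gen k r 1 * _
    rw [wordRep_gen_one, ofCoords_opY]

theorem ofCoords_coords (b : B k r) : ofCoords k r (coords k r b) = b := by
  change ofCoords k r (wordRep k r b _) = b
  rw [ofCoords_wordRep, ofCoords_single]
  simp [word, wordTail]

theorem coords_injective : Function.Injective (coords k r) :=
  Function.LeftInverse.injective ofCoords_coords

/-- With `ofCoords_coords` this makes `coords` and `ofCoords` mutually inverse: the nonzero words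
are a basis of B. -/
theorem coords_word (w : NWord r) : coords k r (word k r w) = Finsupp.single w 1 := by
  have htail : ∀ l : List (Fin (r + 1)),
      coords k r (wordTail k r l) = Finsupp.single (0, l) 1 := by
    intro l
    induction l with
    | nil => simp [wordTail, coords]
    | cons i l ih =>
      rw [wordTail, coords_mul, coords_mul, ih, wordRep_gen_zero, map_pow, wordRep_gen_one,
        opY_pow_single, dif_pos (by simp [i.is_le]), opX_single]
      simp
  rw [word, coords_mul, htail, map_pow, wordRep_gen_one, opY_pow_single, dif_pos (by simp [w.1.is_le])]
  simp

/-- At words beginning with x, left multiplication by y has zero coordinates, whereas left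
multiplication by x copies there all the coordinates of `a`. -/
theorem eq_zero_of_x_mul_add_y_mul {a c : B k r} (h : gen k r 0 * a + gen k r 1 * c = 0) :
    a = 0 ∧ gen k r 1 * c = 0 := by
  have ha : a = 0 := by
    apply coords_injective
    have h' := congrArg (coords k r) h
    rw [map_add, coords_mul, coords_mul, wordRep_gen_zero, wordRep_gen_one, map_zero] at h'
    ext ⟨i, l⟩
    have h2 := DFunLike.congr_fun h' (0, i :: l)
    rw [Finsupp.add_apply, opX_apply_zero_cons, opY_apply_zero, add_zero] at h2
    simpa using h2
  subst ha
  refine ⟨rfl, ?_⟩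
  simpa using h

/-- Left multiplication by y moves the coordinate at (i, l) to (i+1, l) when i < r, so an element
killed by y only involves words beginning with y^r. -/
theorem exists_eq_y_pow_mul {c : B k r} (h : gen k r 1 * c = 0) :
    ∃ c', c = gen k r 1 ^ r * c' := by
  have h' := congrArg (coords k r) h
  rw [coords_mul, wordRep_gen_one, map_zero] at h'
  have hsupp : ∀ w ∈ (coords k r c).support, (w.1 : ℕ) = r := by
    rintro ⟨i, l⟩ hw
    by_contra hi
    have hi' : (i : ℕ) + 1 < r + 1 := by
      have := i.2
      simp only at hi
      omega
    rw [Finsupp.mem_support_iff] at hw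
    apply hw
    rw [← opY_apply_succ _ i hi', h']
    rfl
  rw [← ofCoords_coords c, ofCoords, Finsupp.linearCombination_apply]
  refine ⟨∑ w ∈ (coords k r c).support, coords k r c w • wordTail k r w.2, ?_⟩
  rw [Finset.mul_sum]
  refine Finset.sum_congr rfl fun w hw => ?_
  simp only [mul_smul_comm, word, hsupp w hw]

/-! ### Homogeneous components of `B` -/

theorem grading_of_neg {n : ℤ} (hn : n < 0) : grading k r n = ⊥ := by
  rw [grading, Submodule.span_eq_bot]
  rintro _ ⟨w, hw, rfl⟩
  omega

instance grading_finite (n : ℤ) : Module.Finite k (grading k r n) := by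
  apply Module.Finite.span_of_finite
  have : {b | ∃ w : List (Fin 2), (w.length : ℤ) = n ∧ (w.map (gen k r)).prod = b} ⊆
      (fun w : List (Fin 2) => (w.map (gen k r)).prod) '' {w | w.length = n.toNat} := by
    rintro _ ⟨w, hw, rfl⟩
    exact ⟨w, by change w.length = n.toNat; omega, rfl⟩
  exact (Set.Finite.image _ (List.finite_length_eq (Fin 2) n.toNat)).subset this

theorem exists_eq_x_mul_add_y_mul {n : ℤ} (hn : 0 ≤ n) {b : B k r}
    (hb : b ∈ grading k r (n + 1)) :
    ∃ a ∈ grading k r n, ∃ c ∈ grading k r n, b = gen k r 0 * a + gen k r 1 * c := by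
  induction hb using Submodule.span_induction with
  | zero => exact ⟨0, zero_mem _, 0, zero_mem _, by simp⟩
  | add b b' _ _ h h' =>
    obtain ⟨a, ha, c, hc, rfl⟩ := h
    obtain ⟨a', ha', c', hc', rfl⟩ := h'
    exact ⟨a + a', add_mem ha ha', c + c', add_mem hc hc', by simp only [mul_add]; abel⟩
  | smul t b _ h =>
    obtain ⟨a, ha, c, hc, rfl⟩ := h
    exact ⟨t • a, Submodule.smul_mem _ t ha, t • c, Submodule.smul_mem _ t hc, by simp⟩
  | mem b h =>
    obtain ⟨w, hw, rfl⟩ := h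
    cases w with
    | nil => simp at hw; omega
    | cons i w =>
      have hw' : (w.map (gen k r)).prod ∈ grading k r n :=
        Submodule.subset_span ⟨w, by simpa using hw, rfl⟩
      fin_cases i
      · exact ⟨_, hw', 0, zero_mem _, by simp⟩
      · exact ⟨0, zero_mem _, _, hw', by simp⟩

/-- Words are split here at the last letter, the one that acts on `u` first;
`exists_eq_x_mul_add_y_mul` splits at the first letter. -/
theorem smul_mem_of_smul_gen_mem {M : Type*} [AddCommGroup M] [Module k M] [Module (B k r) M]
    [IsScalarTower k (B k r) M] (U : Submodule (B k r) M) (L : ℕ) (u : M)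
    (h : ∀ i, ∀ b ∈ grading k r L, b • gen k r i • u ∈ U) :
    ∀ b ∈ grading k r (L + 1), b • u ∈ U := by
  intro b hb
  induction hb using Submodule.span_induction with
  | zero =>
    rw [zero_smul]
    exact zero_mem _
  | add b b' _ _ h h' =>
    rw [add_smul]
    exact add_mem h h'
  | smul t b _ h =>
    rw [smul_assoc]
    exact (U.restrictScalars k).smul_mem t h
  | mem b hb =>
    obtain ⟨w, hw, rfl⟩ := hb
    obtain rfl | ⟨w, i, rfl⟩ := w.eq_nil_or_concat
    · simp at hw
      omega
    · rw [List.concat_eq_append, List.map_append, List.prod_append, List.map_singleton,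
        List.prod_singleton, mul_smul]
      exact h i _ (Submodule.subset_span ⟨w, by simpa using hw, rfl⟩)

theorem y_pow_mem (n : ℕ) : gen k r 1 ^ n ∈ grading k r n :=
  Submodule.subset_span ⟨List.replicate n 1, by simp, by simp⟩

theorem one_mem_grading : (1 : B k r) ∈ grading k r 0 :=
  SetLike.GradedOne.one_mem

theorem exists_eq_y_pow_mul_of_mem {n : ℤ} {c : B k r} (hc : c ∈ grading k r n)
    (h : gen k r 1 * c = 0) : ∃ c' ∈ grading k r (n - r), c = gen k r 1 ^ r * c' := by
  obtain ⟨c', hc'⟩ := exists_eq_y_pow_mul h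
  refine ⟨(GrMod.self (grading k r)).proj (n - r) c', (GrMod.self (grading k r)).proj_mem _ c', ?_⟩
  have h1 := GrMod.proj_smul (M := GrMod.self (grading k r)) (y_pow_mem r) n c'
  have h2 : gen k r 1 ^ r • c' = c := hc'.symm
  have h3 := GrMod.proj_of_mem (M := GrMod.self (grading k r)) hc
  exact h3.symm.trans ((congrArg _ h2.symm).trans h1)

end Basis

/-! ### The words of a given degree -/

section Words

variable {r : ℕ}

/-- The length of the word `x y^l₀ x y^l₁ ⋯`. -/
def tailLength (l : List (Fin (r + 1))) : ℕ := (l.map fun j : Fin (r + 1) => (j : ℕ) + 1).sum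

theorem tailLength_cons (i : Fin (r + 1)) (l : List (Fin (r + 1))) :
    tailLength (i :: l) = (i : ℕ) + 1 + tailLength l := by
  simp [tailLength]

/-- The words `x y^l₀ x y^l₁ ⋯` of length `n ≤ r + 1` correspond to the compositions of `n`. -/
def tailEquivComposition {n : ℕ} (hn : n ≤ r + 1) :
    {l : List (Fin (r + 1)) // tailLength l = n} ≃ Composition n where
  toFun l := ⟨l.1.map fun j : Fin (r + 1) => (j : ℕ) + 1, by simp, l.2⟩
  -- A part b of a composition of n satisfies b ≤ n ≤ r+1, so b-1 is an admissible exponent and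
  -- `Fin.ofNat` does not wrap around.
  invFun c := ⟨c.blocks.map fun b => Fin.ofNat (r + 1) (b - 1), by
    rw [tailLength, List.map_map]
    conv_rhs => rw [← c.blocks_sum]
    congr 1
    conv_rhs => rw [← List.map_id c.blocks]
    refine List.map_congr_left fun b hb => ?_
    have h1 := c.blocks_pos hb
    have h2 := c.blocks_le hb
    simp only [Function.comp_apply, Fin.val_ofNat, id_eq]
    rw [Nat.mod_eq_of_lt (by omega)]
    omega⟩
  left_inv := by
    rintro ⟨l, hl⟩
    apply Subtype.ext
    simp only [List.map_map]
    conv_rhs => rw [← List.map_id l]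
    refine List.map_congr_left fun j _ => ?_
    simp
  right_inv c := by
    apply Composition.ext
    simp only [List.map_map]
    conv_rhs => rw [← List.map_id c.blocks]
    refine List.map_congr_left fun b hb => ?_
    have h1 := c.blocks_pos hb
    have h2 := c.blocks_le hb
    simp only [Function.comp_apply, Fin.val_ofNat, id_eq]
    rw [Nat.mod_eq_of_lt (by omega)]
    omega

/-- An enumeration of the words `y^i x ⋯` of length `r + 1`. -/
def tailEquiv (i : Fin (r + 1)) :
    Fin (blockSize r 0 i) ≃ {l : List (Fin (r + 1)) // tailLength l = r + 1 - (i : ℕ)} :=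
  ((tailEquivComposition (by omega)).trans
    (Fintype.equivFinOfCardEq (by
      -- There are 2^(r-i) compositions of r+1-i; this is the initial value of `blockSize`.
      rw [composition_card]
      change 2 ^ (r + 1 - (i : ℕ) - 1) = 2 ^ (r - (i : ℕ))
      congr 1
      omega))).symm

variable (r) in
/-- The index of the word `x w` in terms of the index of the word `w`. -/
def xIdx (m : ℕ) : (Σ i, Fin (blockSize r m i)) ≃ Fin (blockSize r (m + 1) 0) :=
  finSigmaFinEquiv

/-- The index of the word `y w` in terms of the index of the word `w`. -/
def yIdx (m : ℕ) (i : Fin r) : Fin (blockSize r m i.castSucc) ≃ Fin (blockSize r (m + 1) i.succ) :=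
  Equiv.refl _

/-- An enumeration of the words `y^i x ⋯` of length `m + r + 1`, compatible with left
multiplication by `x` and `y`. -/
def wordList : (m : ℕ) → (i : Fin (r + 1)) → Fin (blockSize r m i) → List (Fin (r + 1))
  | 0 => fun i p => (tailEquiv i p).1
  | m + 1 => Fin.cases (fun p => ((xIdx r m).symm p).1 :: wordList m _ ((xIdx r m).symm p).2)
      (fun i q => wordList m i.castSucc ((yIdx m i).symm q))

theorem wordList_xIdx (m : ℕ) (i : Fin (r + 1)) (p : Fin (blockSize r m i)) :
    wordList (m + 1) 0 (xIdx r m ⟨i, p⟩) = i :: wordList m i p := by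
  simp only [wordList, Fin.cases_zero]
  rw [Equiv.symm_apply_apply]

theorem wordList_yIdx (m : ℕ) (i : Fin r) (q : Fin (blockSize r m i.castSucc)) :
    wordList (m + 1) i.succ (yIdx m i q) = wordList m i.castSucc q := rfl

theorem wordList_injective (m : ℕ) (i : Fin (r + 1)) : Function.Injective (wordList m i) := by
  induction m generalizing i with
  | zero => exact Subtype.val_injective.comp (tailEquiv i).injective
  | succ m ih =>
    induction i using Fin.cases with
    | succ i => exact ih i.castSucc
    | zero =>
      intro p q h
      obtain ⟨⟨i, p⟩, rfl⟩ := (xIdx r m).surjective p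
      obtain ⟨⟨j, q⟩, rfl⟩ := (xIdx r m).surjective q
      rw [wordList_xIdx, wordList_xIdx, List.cons.injEq] at h
      obtain ⟨rfl, h⟩ := h
      rw [ih _ h]

/-- With `wordList_injective` and `tailLength_wordList`: `wordList m i` enumerates without
repetition the tails of all words y^i x ⋯ of length m+r+1. -/
theorem exists_wordList_eq (m : ℕ) (i : Fin (r + 1)) (l : List (Fin (r + 1)))
    (h : (i : ℕ) + tailLength l = m + r + 1) : ∃ p, wordList m i p = l := by
  induction m generalizing i l with
  | zero => exact ⟨(tailEquiv i).symm ⟨l, by omega⟩, by simp [wordList]⟩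
  | succ m ih =>
    induction i using Fin.cases with
    | succ i => exact ih i.castSucc l (by simp at h ⊢; omega)
    | zero =>
      cases l with
      | nil => simp [tailLength] at h
      | cons j l =>
        rw [tailLength_cons] at h
        obtain ⟨q, hq⟩ := ih j l (by simp at h; omega)
        exact ⟨xIdx r m ⟨j, q⟩, by rw [wordList_xIdx, hq]⟩

theorem tailLength_wordList (m : ℕ) (i : Fin (r + 1)) (p : Fin (blockSize r m i)) :
    (i : ℕ) + tailLength (wordList m i p) = m + r + 1 := by
  induction m generalizing i with
  | zero =>
    have := (tailEquiv i p).2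
    simp only [wordList]
    omega
  | succ m ih =>
    induction i using Fin.cases with
    | succ i =>
      have := ih i.castSucc ((yIdx m i).symm p)
      rw [← (yIdx m i).apply_symm_apply p, wordList_yIdx]
      simp at this ⊢
      omega
    | zero =>
      obtain ⟨⟨i, p⟩, rfl⟩ := (xIdx r m).surjective p
      rw [wordList_xIdx, tailLength_cons]
      have := ih i p
      simp
      omega

variable (k : Type u) [Field k]

/-- The nonzero words of length `m + r + 1` as elements of `B`. -/
def omega (m : ℕ) (i : Fin (r + 1)) (p : Fin (blockSize r m i)) : B k r :=
  word k r (i, wordList m i p)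

theorem omega_xIdx (m : ℕ) (i : Fin (r + 1)) (p : Fin (blockSize r m i)) :
    omega k (m + 1) 0 (xIdx r m ⟨i, p⟩) = gen k r 0 * omega k m i p := by
  simp only [omega, x_mul_word, wordList_xIdx]

theorem omega_yIdx (m : ℕ) (i : Fin r) (q : Fin (blockSize r m i.castSucc)) :
    omega k (m + 1) i.succ (yIdx m i q) = gen k r 1 * omega k m i.castSucc q := by
  simp only [omega]
  rw [y_mul_word _ (by simp)]
  rfl

theorem y_pow_mul_omega (m : ℕ) (i : Fin (r + 1)) (p : Fin (blockSize r m i)) :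
    gen k r 1 ^ (r + 1 - (i : ℕ)) * omega k m i p = 0 :=
  y_pow_mul_word (i, wordList m i p)

variable {k}

theorem word_mem (w : NWord r) :
    word k r w ∈ grading k r ((w.1 : ℕ) + tailLength w.2 : ℕ) := by
  have htail : ∀ l : List (Fin (r + 1)), wordTail k r l ∈ grading k r (tailLength l : ℕ) := by
    intro l
    induction l with
    | nil => exact one_mem_grading
    | cons i l ih =>
      have := SetLike.GradedMul.mul_mem (gen_mem k r 0)
        (SetLike.GradedMul.mul_mem (y_pow_mem (i : ℕ)) ih)
      rw [tailLength_cons, wordTail]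
      convert this using 2
      push_cast
      ring
  have := SetLike.GradedMul.mul_mem (y_pow_mem (w.1 : ℕ)) (htail w.2)
  rw [word]
  convert this using 2
  push_cast
  ring

theorem omega_mem (m : ℕ) (i : Fin (r + 1)) (p : Fin (blockSize r m i)) :
    omega k m i p ∈ grading k r (m + r + 1) := by
  have := word_mem (k := k) (i, wordList m i p)
  rw [tailLength_wordList] at this
  push_cast at this
  exact this

theorem grading_le_span_words (n : ℕ) : grading k r n ≤
    Submodule.span k (word k r '' {w | (w.1 : ℕ) + tailLength w.2 = n}) := by
  rw [grading, Submodule.span_le]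
  rintro _ ⟨w, hw, rfl⟩
  induction w generalizing n with
  | nil =>
    refine Submodule.subset_span ⟨(0, []), ?_, by simp [word, wordTail]⟩
    change _ = _
    simp only [List.length_nil, Nat.cast_zero] at hw
    simp [tailLength]
    omega
  | cons i w ih =>
    obtain _ | n := n
    · simp at hw
      omega
    specialize ih n (by simpa using hw)
    rw [List.map_cons, List.prod_cons]
    suffices h : Submodule.span k (word k r '' {w | (w.1 : ℕ) + tailLength w.2 = n}) ≤
        (Submodule.span k (word k r '' {w | (w.1 : ℕ) + tailLength w.2 = n + 1})).comap
          (LinearMap.mulLeft k (gen k r i)) from h ih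
    rw [Submodule.span_le]
    rintro _ ⟨v, hv, rfl⟩
    change (v.1 : ℕ) + tailLength v.2 = n at hv
    rw [SetLike.mem_coe, Submodule.mem_comap, LinearMap.mulLeft_apply]
    fin_cases i
    · refine Submodule.subset_span ⟨_, ?_, (x_mul_word v).symm⟩
      change _ = _
      simp only [tailLength_cons, Fin.val_zero]
      omega
    · by_cases h : (v.1 : ℕ) + 1 < r + 1
      · refine Submodule.subset_span ⟨_, ?_, (y_mul_word v h).symm⟩
        change _ = _
        simp only
        omega
      · have := y_mul_word_of_not_lt (k := k) v h
        simp only [Fin.mk_one, Fin.isValue]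
        rw [this]
        exact zero_mem _

theorem grading_le_span_omega (m : ℕ) : grading k r (m + r + 1) ≤
    Submodule.span k {b | ∃ i p, omega k m i p = b} := by
  have := grading_le_span_words (k := k) (r := r) (m + r + 1)
  push_cast at this
  refine this.trans (Submodule.span_mono ?_)
  rintro _ ⟨⟨i, l⟩, hw, rfl⟩
  obtain ⟨p, hp⟩ := exists_wordList_eq m i l hw
  exact ⟨i, p, by rw [omega, hp]⟩

theorem eq_zero_of_sum_smul_omega {m : ℕ} {i : Fin (r + 1)} {c : Fin (blockSize r m i) → k}
    (h : ∑ p, c p • omega k m i p = 0) : c = 0 := by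
  classical
  ext q
  have h1 := congrArg (coords k r) h
  rw [map_sum, map_zero] at h1
  have h2 := DFunLike.congr_fun h1 (i, wordList m i q)
  simp only [map_smul, omega, coords_word, Finsupp.finsetSum_apply, Finsupp.smul_apply,
    Finsupp.single_apply, Prod.mk.injEq, true_and, (wordList_injective m i).eq_iff] at h2
  simpa using h2

end Words

/-! ### The sections of a graded module -/

section Stages

variable {k : Type u} [Field k] {r : ℕ}

variable (M : GrMod k (grading k r))

/-- The families of elements of degree `m + r + 1` indexed by the words of that degree. -/
def Stage (m : ℕ) :
    Submodule k ((i : Fin (r + 1)) → Fin (blockSize r m i) → M.carrier) where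
  carrier := {h | ∀ i p, h i p ∈ M.deg (m + r + 1)}
  add_mem' ha hb i p := add_mem (ha i p) (hb i p)
  zero_mem' _ _ := zero_mem _
  smul_mem' c _ h i p := Submodule.smul_mem _ c (h i p)

variable {M}

theorem Stage.ext {m : ℕ} {h h' : Stage M m} (H : ∀ i p, h.1 i p = h'.1 i p) : h = h' :=
  Subtype.ext (funext fun i => funext fun p => H i p)

theorem Stage.ext_succ {m : ℕ} {h h' : Stage M (m + 1)}
    (hx : ∀ i p, h.1 0 (xIdx r m ⟨i, p⟩) = h'.1 0 (xIdx r m ⟨i, p⟩))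
    (hy : ∀ i q, h.1 (Fin.succ i) (yIdx m i q) = h'.1 (Fin.succ i) (yIdx m i q)) : h = h' := by
  refine Stage.ext fun i => ?_
  induction i using Fin.cases with
  | zero =>
    intro p
    obtain ⟨⟨i, p⟩, rfl⟩ := (xIdx r m).surjective p
    exact hx i p
  | succ i => exact hy i

theorem Stage.add_val {m : ℕ} (h h' : Stage M m) (i : Fin (r + 1)) (p : Fin (blockSize r m i)) :
    (h + h').1 i p = h.1 i p + h'.1 i p := rfl

theorem Stage.zero_val {m : ℕ} (i : Fin (r + 1)) (p : Fin (blockSize r m i)) :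
    (0 : Stage M m).1 i p = 0 := rfl

/-- The right action of `S_n` by multiplication of row vectors with matrices. -/
def Stage.act {m : ℕ} (h : Stage M m) (g : SAlg k r m) : Stage M m :=
  ⟨fun i q => ∑ p, g i p q • h.1 i p,
    fun i _ => Submodule.sum_mem _ fun p _ => Submodule.smul_mem _ _ (h.2 i p)⟩

/-! ### The matrix action on families and its compatibility with the transition maps. -/

namespace Stage

theorem act_val {m : ℕ} (h : Stage M m) (g : SAlg k r m) (i : Fin (r + 1))
    (q : Fin (blockSize r m i)) : (act h g).1 i q = ∑ p, g i p q • h.1 i p := rfl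

theorem add_act {m : ℕ} (h h' : Stage M m) (g : SAlg k r m) :
    act (h + h') g = act h g + act h' g :=
  Stage.ext fun i q => by
    simp only [act_val, add_val, smul_add, Finset.sum_add_distrib]

theorem act_add {m : ℕ} (h : Stage M m) (g g' : SAlg k r m) :
    act h (g + g') = act h g + act h g' :=
  Stage.ext fun i q => by
    simp only [act_val, add_val, Pi.add_apply, Matrix.add_apply, add_smul, Finset.sum_add_distrib]

theorem act_zero {m : ℕ} (h : Stage M m) : act h 0 = 0 :=
  Stage.ext fun i q => by
    simp only [act_val, zero_val, Pi.zero_apply, Matrix.zero_apply, zero_smul,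
      Finset.sum_const_zero]

theorem zero_act {m : ℕ} (g : SAlg k r m) : act (0 : Stage M m) g = 0 :=
  Stage.ext fun i q => by
    simp only [act_val, zero_val, smul_zero, Finset.sum_const_zero]

theorem act_one {m : ℕ} (h : Stage M m) : act h 1 = h :=
  Stage.ext fun i q => by
    simp [act_val, Matrix.one_apply]

theorem act_mul {m : ℕ} (h : Stage M m) (g g' : SAlg k r m) :
    act h (g * g') = act (act h g) g' :=
  Stage.ext fun i q => by
    simp only [act_val, Pi.mul_apply, Matrix.mul_apply, Finset.sum_smul, Finset.smul_sum,
      smul_smul]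
    rw [Finset.sum_comm]
    simp only [mul_comm]

/-- Pass from words `w` to the words `x w` and `y w`. -/
def step (m : ℕ) : Stage M m →ₗ[k] Stage M (m + 1) where
  toFun h := ⟨Fin.cases
      (fun p => gen k r 0 • h.1 ((xIdx r m).symm p).1 ((xIdx r m).symm p).2)
      -- The index `i.castSucc` is never r: a word beginning with y^r is killed by y, so its value
      -- is only multiplied by x.
      (fun i q => gen k r 1 • h.1 i.castSucc ((yIdx m i).symm q)), by
    have key : ∀ (i : Fin 2) (u : M.carrier), u ∈ M.deg (m + r + 1) →
        gen k r i • u ∈ M.deg ((m + 1 : ℕ) + r + 1) := by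
      intro i u hu
      have := M.smul_mem (gen_mem k r i) hu
      rwa [show (1 : ℤ) + (m + r + 1) = ((m + 1 : ℕ) + r + 1) by push_cast; ring] at this
    intro i
    induction i using Fin.cases with
    | zero => exact fun p => key 0 _ (h.2 _ _)
    | succ i => exact fun p => key 1 _ (h.2 _ _)⟩
  map_add' h h' := by
    refine Stage.ext fun i => ?_
    induction i using Fin.cases with
    | zero => exact fun p => smul_add _ _ _
    | succ i => exact fun p => smul_add _ _ _
  map_smul' c h := by
    refine Stage.ext fun i => ?_
    induction i using Fin.cases with
    | zero => exact fun p => smul_comm _ _ _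
    | succ i => exact fun p => smul_comm _ _ _

theorem step_xIdx {m : ℕ} (h : Stage M m) (i : Fin (r + 1)) (p : Fin (blockSize r m i)) :
    (step m h).1 0 (xIdx r m ⟨i, p⟩) = gen k r 0 • h.1 i p := by
  change gen k r 0 • h.1 ((xIdx r m).symm (xIdx r m ⟨i, p⟩)).1 _ = _
  rw [Equiv.symm_apply_apply]

theorem step_yIdx {m : ℕ} (h : Stage M m) (i : Fin r) (q : Fin (blockSize r m i.castSucc)) :
    (step m h).1 i.succ (yIdx m i q) = gen k r 1 • h.1 i.castSucc q := rfl

theorem phi_xIdx {m : ℕ} (g : SAlg k r m) (a b : Σ i, Fin (blockSize r m i)) :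
    phi k r m g 0 (xIdx r m a) (xIdx r m b) = Matrix.blockDiagonal' g a b := by
  change Matrix.blockDiagonal' g (finSigmaFinEquiv.symm (finSigmaFinEquiv a))
    (finSigmaFinEquiv.symm (finSigmaFinEquiv b)) = _
  rw [Equiv.symm_apply_apply, Equiv.symm_apply_apply]

theorem phi_yIdx {m : ℕ} (g : SAlg k r m) (i : Fin r) (p q : Fin (blockSize r m i.castSucc)) :
    phi k r m g i.succ (yIdx m i p) (yIdx m i q) = g i.castSucc p q := rfl

/-- This is where the shape of φ_n comes from. The words x w run over all old words w, so their
block carries the block diagonal matrix; the words y w with leading power y^(i+1) form a copy of the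
old block i < r. -/
theorem step_act {m : ℕ} (h : Stage M m) (g : SAlg k r m) :
    step m (act h g) = act (step m h) (phi k r m g) := by
  refine Stage.ext_succ (fun i q => ?_) fun i q => ?_
  · rw [step_xIdx, act_val, act_val, ← (xIdx r m).sum_comp, Fintype.sum_sigma,
      Finset.sum_eq_single i]
    · rw [Finset.smul_sum]
      refine Finset.sum_congr rfl fun p _ => ?_
      rw [phi_xIdx, Matrix.blockDiagonal'_apply_eq, step_xIdx, smul_comm]
    · intro j _ hj
      refine Finset.sum_eq_zero fun p _ => ?_
      rw [phi_xIdx, Matrix.blockDiagonal'_apply_ne _ _ _ hj, zero_smul]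
    · simp
  · rw [step_yIdx, act_val, act_val, ← (yIdx m i).sum_comp, Finset.smul_sum]
    refine Finset.sum_congr rfl fun p _ => ?_
    rw [phi_yIdx, step_yIdx, smul_comm]

/-- The composite of the steps from stage `m` to stage `n`. -/
def trans (m n : ℕ) (h : m ≤ n) : Stage M m →ₗ[k] Stage M n :=
  Nat.leRecOn h (fun {l} f => (step l).comp f) LinearMap.id

theorem trans_self (m : ℕ) (h : m ≤ m) : trans (M := M) m m h = LinearMap.id :=
  Nat.leRecOn_self _

theorem trans_succ (m n : ℕ) (h : m ≤ n) (h' : m ≤ n + 1) :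
    trans (M := M) m (n + 1) h' = (step n).comp (trans m n h) :=
  Nat.leRecOn_succ h _

instance directedSystem :
    DirectedSystem (fun m => Stage M m) (fun m n h => trans m n h) where
  map_self m x := by rw [trans_self]; rfl
  map_map := by
    intro n m l hlm hmn x
    induction n, hmn using Nat.le_induction with
    | base => rw [trans_self]; rfl
    | succ n hmn ih =>
      rw [trans_succ m n hmn, trans_succ l n (hlm.trans hmn)]
      exact congrArg (step n) ih

theorem trans_trans {l m n : ℕ} (hlm : l ≤ m) (hmn : m ≤ n) (h : Stage M l) :
    trans m n hmn (trans l m hlm h) = trans l n (hlm.trans hmn) h :=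
  DirectedSystem.map_map (f := fun m n h => trans (M := M) m n h) hlm hmn h

theorem trans_step {m n : ℕ} (hmn : m + 1 ≤ n) (h : Stage M m) :
    trans (m + 1) n hmn (step m h) = trans m n (by omega) h := by
  have : step m h = trans m (m + 1) (by omega) h := by
    rw [trans_succ m m le_rfl, trans_self]
    rfl
  rw [this, trans_trans]

theorem trans_act {m n : ℕ} (hmn : m ≤ n) (h : Stage M m) (g : SAlg k r m) :
    trans m n hmn (act h g) = act (trans m n hmn h) (transition k r m n hmn g) := by
  induction n, hmn using Nat.le_induction with
  | base => rw [trans_self, transition_self]; rfl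
  | succ n hmn ih =>
    rw [trans_succ m n hmn, transition_succ k r m n hmn]
    exact (congrArg (step n) ih).trans (step_act _ _)

end Stage

/-! ### The limit of the families as a right `S`-module. -/

variable (k r) in
/-- The class in `S` of an element of `S_n`. -/
def toLim (m : ℕ) (g : SAlg k r m) : SLim k r := ⟦⟨m, g⟩⟧

theorem toLim_transition {m n : ℕ} (h : m ≤ n) (g : SAlg k r m) :
    toLim k r n (transition k r m n h g) = toLim k r m g :=
  DirectLimit.mk_apply (f := transition k r) m n g h

theorem exists_toLim (s : SLim k r) : ∃ m g, toLim k r m g = s := by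
  obtain ⟨m, g, rfl⟩ := DirectLimit.exists_eq_mk _ s
  exact ⟨m, g, rfl⟩

theorem exists_toLim_ge (m₀ : ℕ) (s : SLim k r) : ∃ m, m₀ ≤ m ∧ ∃ g, toLim k r m g = s := by
  obtain ⟨m, g, rfl⟩ := exists_toLim s
  exact ⟨max m₀ m, le_max_left _ _, _, toLim_transition (le_max_right _ _) g⟩

variable (M) in
/-- The right `S`-module of sections of a graded module. -/
def Sec : Type u := DirectLimit (fun m => Stage M m) (fun m n h => Stage.trans (M := M) m n h)

instance : AddCommGroup (Sec M) :=
  inferInstanceAs (AddCommGroup (DirectLimit (fun m => Stage M m)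
    (fun m n h => Stage.trans (M := M) m n h)))

namespace Sec

variable (M) in
/-- The section represented by a family. -/
def mk (m : ℕ) : Stage M m →+ Sec M where
  toFun h := (⟦⟨m, h⟩⟧ : DirectLimit (fun m => Stage M m)
    (fun m n h => Stage.trans (M := M) m n h))
  map_zero' := (DirectLimit.zero_def m).symm
  map_add' h h' := (DirectLimit.add_def (f := fun m n h => Stage.trans (M := M) m n h) m h h').symm

theorem mk_trans {m n : ℕ} (hmn : m ≤ n) (h : Stage M m) :
    mk M n (Stage.trans m n hmn h) = mk M m h :=
  Quotient.sound (s := DirectLimit.setoid fun m n h => Stage.trans (M := M) m n h)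
    ⟨n, le_rfl, hmn, Stage.trans_trans hmn le_rfl h⟩

theorem mk_step {m : ℕ} (h : Stage M m) : mk M (m + 1) (Stage.step m h) = mk M m h := by
  rw [← mk_trans (Nat.le_succ m) h, Stage.trans_succ m m le_rfl, Stage.trans_self]
  rfl

theorem exists_mk (a : Sec M) : ∃ m h, mk M m h = a := by
  obtain ⟨m, g, h⟩ := DirectLimit.exists_eq_mk _ a
  exact ⟨m, g, h.symm⟩

theorem exists_mk_ge (m₀ : ℕ) (a : Sec M) : ∃ m, m₀ ≤ m ∧ ∃ h, mk M m h = a := by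
  obtain ⟨m, h, rfl⟩ := exists_mk a
  exact ⟨max m₀ m, le_max_left _ _, _, mk_trans (le_max_right _ _) h⟩

theorem mk_eq_mk {m n : ℕ} {h : Stage M m} {h' : Stage M n} :
    mk M m h = mk M n h' ↔ ∃ l, ∃ (hm : m ≤ l) (hn : n ≤ l),
      Stage.trans m l hm h = Stage.trans n l hn h' :=
  Quotient.eq (r := DirectLimit.setoid (fun m n h => Stage.trans (M := M) m n h))

theorem mk_eq_zero {m : ℕ} {h : Stage M m} :
    mk M m h = 0 ↔ ∃ l, ∃ hm : m ≤ l, Stage.trans m l hm h = 0 := by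
  rw [← (mk M m).map_zero, mk_eq_mk]
  simp only [map_zero]
  exact ⟨fun ⟨l, hm, _, h⟩ => ⟨l, hm, h⟩, fun ⟨l, hm, h⟩ => ⟨l, hm, hm, h⟩⟩

/-- The right action of `S` on sections. -/
def act : Sec M → SLim k r → Sec M :=
  DirectLimit.map₂ _ _ _ (fun _ h g => Stage.act h g) fun _ _ hmn h g => Stage.trans_act hmn h g

theorem mk_act (m : ℕ) (h : Stage M m) (g : SAlg k r m) :
    act (mk M m h) (toLim k r m g) = mk M m (Stage.act h g) :=
  DirectLimit.map₂_def ..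

theorem exists_common (a b : Sec M) (s t : SLim k r) : ∃ m h h' g g',
    mk M m h = a ∧ mk M m h' = b ∧ toLim k r m g = s ∧ toLim k r m g' = t := by
  obtain ⟨m₁, h₁, rfl⟩ := exists_mk a
  obtain ⟨m₂, hm₂, h₂, rfl⟩ := exists_mk_ge m₁ b
  obtain ⟨m₃, hm₃, g₁, rfl⟩ := exists_toLim_ge m₁ s
  obtain ⟨m₄, hm₄, g₂, rfl⟩ := exists_toLim_ge m₃ t
  refine ⟨max m₂ m₄, _, _, _, _, mk_trans (by omega) h₁, mk_trans (by omega) h₂,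
    toLim_transition (by omega) g₁, toLim_transition (by omega) g₂⟩

instance : Module (SLim k r)ᵐᵒᵖ (Sec M) where
  smul s a := act a s.unop
  one_smul a := by
    obtain ⟨m, h, rfl⟩ := exists_mk a
    change act _ 1 = _
    have : (1 : SLim k r) = toLim k r m 1 := DirectLimit.one_def m
    rw [this, mk_act, Stage.act_one]
  mul_smul s t a := by
    obtain ⟨m, h, -, g, g', rfl, -, hs, ht⟩ := exists_common a a s.unop t.unop
    change act _ (t.unop * s.unop) = act (act _ t.unop) s.unop
    rw [← hs, ← ht, mk_act, mk_act, ← Stage.act_mul, ← mk_act]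
    exact congrArg _ (DirectLimit.mul_def m g' g)
  smul_zero s := by
    obtain ⟨m, g, hs⟩ := exists_toLim s.unop
    change act 0 s.unop = 0
    rw [← hs, ← (mk M m).map_zero, mk_act, Stage.zero_act]
  smul_add s a b := by
    obtain ⟨m, h, h', g, -, rfl, rfl, hs, -⟩ := exists_common a b s.unop s.unop
    change act _ s.unop = act _ s.unop + act _ s.unop
    rw [← hs, ← map_add, mk_act, mk_act, mk_act, ← map_add, Stage.add_act]
  add_smul s t a := by
    obtain ⟨m, h, -, g, g', rfl, -, hs, ht⟩ := exists_common a a s.unop t.unop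
    change act _ (s.unop + t.unop) = act _ s.unop + act _ t.unop
    rw [← hs, ← ht, mk_act, mk_act, ← map_add, ← Stage.act_add, ← mk_act]
    exact congrArg _ (DirectLimit.add_def m g g')
  zero_smul a := by
    obtain ⟨m, h, rfl⟩ := exists_mk a
    change act _ 0 = 0
    have : (0 : SLim k r) = toLim k r m 0 := DirectLimit.zero_def m
    rw [this, mk_act, Stage.act_zero, map_zero]

theorem op_toLim_smul_mk (m : ℕ) (h : Stage M m) (g : SAlg k r m) :
    MulOpposite.op (toLim k r m g) • mk M m h = mk M m (Stage.act h g) :=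
  mk_act m h g

theorem exists_common_smul (a : Sec M) (s : (SLim k r)ᵐᵒᵖ) : ∃ m h g,
    mk M m h = a ∧ MulOpposite.op (toLim k r m g) = s := by
  obtain ⟨m, h, -, g, -, ha, -, hg, -⟩ := exists_common a a s.unop s.unop
  exact ⟨m, h, g, ha, by rw [hg, MulOpposite.op_unop]⟩

end Sec

/-! ### Functoriality of sections -/

namespace Stage

variable {M N : GrMod k (grading k r)}

/-- The map on families induced by a morphism of graded modules. -/
def map (f : M ⟶ N) (m : ℕ) : Stage M m →ₗ[k] Stage N m where
  toFun h := ⟨fun i p => f.toLin (h.1 i p), fun i p => f.map_deg _ _ (h.2 i p)⟩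
  map_add' _ _ := Stage.ext fun _ _ => map_add f.toLin _ _
  map_smul' c _ := Stage.ext fun _ _ => (f.toLin.restrictScalars k).map_smul c _

theorem map_val (f : M ⟶ N) {m : ℕ} (h : Stage M m) (i : Fin (r + 1))
    (p : Fin (blockSize r m i)) : (map f m h).1 i p = f.toLin (h.1 i p) := rfl

theorem map_step (f : M ⟶ N) {m : ℕ} (h : Stage M m) :
    step m (map f m h) = map f (m + 1) (step m h) := by
  refine Stage.ext fun i => ?_
  induction i using Fin.cases with
  | zero => exact fun p => (map_smul f.toLin _ _).symm
  | succ i => exact fun p => (map_smul f.toLin _ _).symm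

theorem map_trans (f : M ⟶ N) {m n : ℕ} (hmn : m ≤ n) (h : Stage M m) :
    trans m n hmn (map f m h) = map f n (trans m n hmn h) := by
  induction n, hmn using Nat.le_induction with
  | base => simp only [trans_self, LinearMap.id_apply]
  | succ n hmn ih =>
    rw [trans_succ m n hmn, trans_succ m n hmn]
    exact (congrArg (step n) ih).trans (map_step f _)

theorem map_act (f : M ⟶ N) {m : ℕ} (h : Stage M m) (g : SAlg k r m) :
    map f m (act h g) = act (map f m h) g :=
  Stage.ext fun i q => by
    rw [map_val, act_val, act_val, map_sum]
    exact Finset.sum_congr rfl fun p _ => (f.toLin.restrictScalars k).map_smul _ _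

end Stage

namespace Sec

variable {M N : GrMod k (grading k r)}

/-- The map on sections induced by a morphism of graded modules, as a function. -/
def mapFun (f : M ⟶ N) : Sec M → Sec N :=
  DirectLimit.map _ _ (fun m => Stage.map f m) fun _ _ hmn h => Stage.map_trans f hmn h

theorem mapFun_mk (f : M ⟶ N) (m : ℕ) (h : Stage M m) :
    mapFun f (mk M m h) = mk N m (Stage.map f m h) := rfl

/-- The map on sections induced by a morphism of graded modules. -/
def map (f : M ⟶ N) : Sec M →ₗ[(SLim k r)ᵐᵒᵖ] Sec N where
  toFun := mapFun f
  map_add' a b := by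
    obtain ⟨m, h, h', -, -, rfl, rfl, -, -⟩ := exists_common a b (0 : SLim k r) 0
    rw [← map_add, mapFun_mk, mapFun_mk, mapFun_mk, map_add, map_add]
  map_smul' s a := by
    obtain ⟨m, h, g, rfl, rfl⟩ := exists_common_smul a s
    rw [op_toLim_smul_mk, mapFun_mk, mapFun_mk, Stage.map_act, RingHom.id_apply, op_toLim_smul_mk]

theorem map_mk (f : M ⟶ N) (m : ℕ) (h : Stage M m) :
    map f (mk M m h) = mk N m (Stage.map f m h) := rfl

theorem map_id : map (𝟙 M) = LinearMap.id := by
  ext a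
  obtain ⟨m, h, rfl⟩ := exists_mk a
  rfl

theorem map_comp {P : GrMod k (grading k r)} (f : M ⟶ N) (g : N ⟶ P) :
    map (f ≫ g) = map g ∘ₗ map f := by
  ext a
  obtain ⟨m, h, rfl⟩ := exists_mk a
  rfl

theorem map_subHom (f g : M ⟶ N) : map (GrMod.subHom f g) = map f - map g := by
  ext a
  obtain ⟨m, h, rfl⟩ := exists_mk a
  rw [LinearMap.sub_apply, map_mk, map_mk, map_mk, ← map_sub]
  rfl

end Sec

variable (k r) in
/-- The functor of sections from graded `B`-modules to right `S`-modules. -/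
def secFunctor : GrMod k (grading k r) ⥤ ModS k r where
  obj M := ModuleCat.of (SLim k r)ᵐᵒᵖ (Sec M)
  map f := ModuleCat.ofHom (Sec.map f)
  map_id M := by rw [Sec.map_id]; rfl
  map_comp f g := by rw [Sec.map_comp]; rfl

end Stages

/-! ### Elementary sections -/

section Elementary

variable {k : Type u} [Field k] {r : ℕ} {M : GrMod k (grading k r)}

/-- Every block contains a word at which an elementary section can be placed. -/
theorem blockSize_pos (r m : ℕ) (i : Fin (r + 1)) : 0 < blockSize r m i := by
  induction m generalizing i with
  | zero => exact Nat.pow_pos (by norm_num)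
  | succ m ih =>
    induction i using Fin.cases with
    | zero => exact Finset.sum_pos (fun j _ => ih j) ⟨0, Finset.mem_univ _⟩
    | succ i => exact ih i.castSucc

variable (M) in
/-- Multiplication by a generator on the component of degree `m + r + 1`. -/
def genSmul (i : Fin 2) (m : ℕ) :
    M.deg ((m : ℤ) + r + 1) →ₗ[k] M.deg (((m + 1 : ℕ) : ℤ) + r + 1) where
  toFun u := ⟨gen k r i • u.1, by
    have := M.smul_mem (gen_mem k r i) u.2
    rwa [show (1 : ℤ) + (m + r + 1) = ((m + 1 : ℕ) + r + 1) by push_cast; ring] at this⟩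
  map_add' u v := Subtype.ext (smul_add _ _ _)
  map_smul' c u := Subtype.ext (smul_comm _ _ _)

namespace Stage

/-- The family that takes the value `u` at one word and vanishes at the others. -/
def single {m : ℕ} (i : Fin (r + 1)) (p : Fin (blockSize r m i)) :
    M.deg ((m : ℤ) + r + 1) →ₗ[k] Stage M m where
  toFun u := ⟨Pi.single i (Pi.single p u.1), by
    intro j q
    by_cases hj : j = i
    · subst hj
      rw [Pi.single_eq_same]
      by_cases hq : q = p
      · subst hq
        rw [Pi.single_eq_same]
        exact u.2
      · rw [Pi.single_eq_of_ne hq]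
        exact zero_mem _
    · rw [Pi.single_eq_of_ne hj]
      exact zero_mem _⟩
  map_add' u v := Subtype.ext (by simp [Pi.single_add])
  map_smul' c u := Subtype.ext (by simp [Pi.single_smul])

theorem single_val_same {m : ℕ} (i : Fin (r + 1)) (p : Fin (blockSize r m i))
    (u : M.deg ((m : ℤ) + r + 1)) : (single i p u).1 i p = u := by
  simp [single]

theorem single_val_of_ne {m : ℕ} {i : Fin (r + 1)} {p q : Fin (blockSize r m i)} (h : q ≠ p)
    (u : M.deg ((m : ℤ) + r + 1)) : (single i p u).1 i q = 0 := by
  simp [single, h]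

theorem single_val_of_ne' {m : ℕ} {i j : Fin (r + 1)} (p : Fin (blockSize r m i))
    (q : Fin (blockSize r m j)) (h : j ≠ i)
    (u : M.deg ((m : ℤ) + r + 1)) : (single i p u).1 j q = 0 := by
  simp [single, h]

/-- The value of a family at a word, as an element of a homogeneous component. -/
def val {m : ℕ} (h : Stage M m) (i : Fin (r + 1)) (p : Fin (blockSize r m i)) :
    M.deg ((m : ℤ) + r + 1) := ⟨h.1 i p, h.2 i p⟩

theorem eq_sum_single {m : ℕ} (h : Stage M m) : h = ∑ i, ∑ p, single i p (val h i p) := by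
  refine Stage.ext fun j q => ?_
  have : (∑ i, ∑ p, single i p (val h i p)).1 j q = ∑ i, ∑ p, (single i p (val h i p)).1 j q := by
    simp only [AddSubmonoidClass.coe_finsetSum, Finset.sum_apply]
  rw [this, Finset.sum_eq_single j, Finset.sum_eq_single q, single_val_same]
  · rfl
  · exact fun p _ hp => single_val_of_ne hp.symm _
  · simp
  · exact fun i _ hi => Finset.sum_eq_zero fun p _ => single_val_of_ne' p q hi.symm _
  · simp

variable (k) in
/-- The matrix units of `S_n`. -/
def unit {m : ℕ} (i : Fin (r + 1)) (p q : Fin (blockSize r m i)) : SAlg k r m :=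
  Pi.single i (Matrix.single p q 1)

/-- A matrix unit isolates the value at the word p and moves it to the word q. Submodules of
sections are therefore determined by the elementary sections they contain (`Sec.mk_single_mem`,
`Sec.mk_mem_of_single`). -/
theorem act_unit {m : ℕ} (h : Stage M m) (i : Fin (r + 1)) (p q : Fin (blockSize r m i)) :
    act h (unit k i p q) = single i q (val h i p) := by
  refine Stage.ext fun j s => ?_
  rw [act_val, unit]
  by_cases hj : j = i
  · subst hj
    simp only [Pi.single_eq_same, Matrix.single_apply]
    by_cases hs : s = q
    · subst hs
      rw [single_val_same]
      simp [val]
    · rw [single_val_of_ne hs]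
      simp [Ne.symm hs]
  · rw [single_val_of_ne' _ _ hj]
    simp [Pi.single_eq_of_ne hj]

theorem act_smul_one {m : ℕ} (h : Stage M m) (c : k) : act h (c • 1) = c • h := by
  refine Stage.ext fun i q => ?_
  rw [act_val]
  simp [Matrix.one_apply]

theorem val_single {m : ℕ} (i : Fin (r + 1)) (p : Fin (blockSize r m i))
    (u : M.deg ((m : ℤ) + r + 1)) : val (single i p u) i p = u :=
  Subtype.ext (single_val_same i p u)

theorem val_step_xIdx {m : ℕ} (h : Stage M m) (i : Fin (r + 1)) (p : Fin (blockSize r m i)) :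
    val (step m h) 0 (xIdx r m ⟨i, p⟩) = genSmul M 0 m (val h i p) :=
  Subtype.ext (step_xIdx h i p)

theorem val_step_yIdx {m : ℕ} (h : Stage M m) (i : Fin r) (q : Fin (blockSize r m i.castSucc)) :
    val (step m h) i.succ (yIdx m i q) = genSmul M 1 m (val h i.castSucc q) :=
  Subtype.ext (step_yIdx h i q)

end Stage

open Stage

theorem Sec.mk_single_mem {K : Submodule (SLim k r)ᵐᵒᵖ (Sec M)} {m : ℕ} {h : Stage M m}
    (hK : Sec.mk M m h ∈ K) (i : Fin (r + 1)) (p q : Fin (blockSize r m i)) :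
    Sec.mk M m (single i q (val h i p)) ∈ K := by
  rw [← act_unit, ← Sec.op_toLim_smul_mk]
  exact K.smul_mem _ hK

theorem Sec.mk_mem_of_single {K : Submodule (SLim k r)ᵐᵒᵖ (Sec M)} {m : ℕ} {h : Stage M m}
    (hK : ∀ i p, Sec.mk M m (single i p (val h i p)) ∈ K) : Sec.mk M m h ∈ K := by
  rw [eq_sum_single h, map_sum]
  refine sum_mem fun i _ => ?_
  rw [map_sum]
  exact sum_mem fun p _ => hK i p

/-! ### Submodules of sections and submodules of graded modules -/

/-- The elementary sections with value `u` at the words `y^i x ⋯` belong to `K`. -/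
def SingleMem (K : Submodule (SLim k r)ᵐᵒᵖ (Sec M)) (m : ℕ) (i : Fin (r + 1))
    (u : M.deg ((m : ℤ) + r + 1)) : Prop :=
  ∀ p, Sec.mk M m (single i p u) ∈ K

/-! ### Elementary sections contained in a submodule, and moving them between blocks. -/

section SingleMem

variable {K : Submodule (SLim k r)ᵐᵒᵖ (Sec M)}

theorem SingleMem.of_mem {m : ℕ} {i : Fin (r + 1)} {p : Fin (blockSize r m i)}
    {u : M.deg ((m : ℤ) + r + 1)} (h : Sec.mk M m (single i p u) ∈ K) : SingleMem K m i u := by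
  intro q
  have := Sec.mk_single_mem h i p q
  rwa [val_single] at this

theorem SingleMem.zero (m : ℕ) (i : Fin (r + 1)) : SingleMem K m i 0 := by
  intro p
  rw [map_zero, map_zero]
  exact zero_mem _

theorem SingleMem.add {m : ℕ} {i : Fin (r + 1)} {u v : M.deg ((m : ℤ) + r + 1)} (hu : SingleMem K m i u)
    (hv : SingleMem K m i v) : SingleMem K m i (u + v) := by
  intro p
  rw [map_add, map_add]
  exact add_mem (hu p) (hv p)

theorem SingleMem.smul {m : ℕ} {i : Fin (r + 1)} {u : M.deg ((m : ℤ) + r + 1)}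
    (hu : SingleMem K m i u) (c : k) : SingleMem K m i (c • u) := by
  intro p
  have := K.smul_mem (MulOpposite.op (toLim k r m (c • 1))) (hu p)
  rwa [Sec.op_toLim_smul_mk, act_smul_one, ← map_smul] at this

theorem SingleMem.x_smul {m : ℕ} {i : Fin (r + 1)} {u : M.deg ((m : ℤ) + r + 1)} (h : SingleMem K m i u) :
    SingleMem K (m + 1) 0 (genSmul M 0 m u) := by
  let p : Fin (blockSize r m i) := ⟨0, blockSize_pos r m i⟩
  have h1 := h p
  rw [← Sec.mk_step] at h1
  have h2 := Sec.mk_single_mem h1 0 (xIdx r m ⟨i, p⟩) (xIdx r m ⟨i, p⟩)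
  rw [val_step_xIdx, val_single] at h2
  exact SingleMem.of_mem h2

theorem SingleMem.y_smul {m : ℕ} {i : Fin r} {u : M.deg ((m : ℤ) + r + 1)} (h : SingleMem K m i.castSucc u) :
    SingleMem K (m + 1) i.succ (genSmul M 1 m u) := by
  let p : Fin (blockSize r m i.castSucc) := ⟨0, blockSize_pos r m _⟩
  have h1 := h p
  rw [← Sec.mk_step] at h1
  have h2 := Sec.mk_single_mem h1 i.succ (yIdx m i p) (yIdx m i p)
  rw [val_step_yIdx, val_single] at h2
  exact SingleMem.of_mem h2

/-- A section may be read one stage later, where the family with value u at w has at most the two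
nonzero values x u at x w and y u at y w. If i = r there is no word y w, and the condition `hy` is
empty. -/
theorem SingleMem.of_smul {m : ℕ} {i : Fin (r + 1)} {u : M.deg ((m : ℤ) + r + 1)}
    (hx : SingleMem K (m + 1) 0 (genSmul M 0 m u))
    (hy : ∀ j : Fin r, j.castSucc = i → SingleMem K (m + 1) j.succ (genSmul M 1 m u)) :
    SingleMem K m i u := by
  have hval : ∀ (p : Fin (blockSize r m i)) (j : Fin (r + 1)) (q : Fin (blockSize r m j)),
      val (single i p u) j q = 0 ∨ (j = i ∧ val (single i p u) j q = u) := by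
    intro p j q
    by_cases hj : j = i
    · subst hj
      by_cases hq : q = p
      · subst hq
        exact Or.inr ⟨rfl, val_single _ _ _⟩
      · exact Or.inl (Subtype.ext (single_val_of_ne hq u))
    · exact Or.inl (Subtype.ext (single_val_of_ne' p q hj u))
  intro p
  rw [← Sec.mk_step]
  refine Sec.mk_mem_of_single fun j => ?_
  induction j using Fin.cases with
  | zero =>
    intro P
    obtain ⟨⟨j, q⟩, rfl⟩ := (xIdx r m).surjective P
    rw [val_step_xIdx]
    obtain h | ⟨-, h⟩ := hval p j q
    · rw [h, map_zero]
      exact SingleMem.zero _ _ _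
    · rw [h]
      exact hx _
  | succ j =>
    intro P
    obtain ⟨q, rfl⟩ := (yIdx m j).surjective P
    rw [val_step_yIdx]
    obtain h | ⟨hj, h⟩ := hval p j.castSucc q
    · rw [h, map_zero]
      exact SingleMem.zero _ _ _
    · rw [h]
      exact hy j hj _

/-- The relation for `i` implies the relation for `i'` if `i ≤ i'` or if `u` is annihilated by
the power of `y` that annihilates the words `y^i x ⋯`. -/
theorem SingleMem.of_rel {m : ℕ} {i i' : Fin (r + 1)} {u : M.deg ((m : ℤ) + r + 1)} (h : SingleMem K m i u)
    (hu : i ≤ i' ∨ gen k r 1 ^ (r + 1 - (i : ℕ)) • u.1 = 0) : SingleMem K m i' u := by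
  -- Descending induction on i. The part x u sits at words x w, which have index 0 whatever i is.
  -- The part y u sits at index i+1, where the hypothesis recurs for y u. At i = r nothing is known
  -- about y u, but it is needed only if i' < r, and then it vanishes.
  obtain ⟨n, hn⟩ : ∃ n, r - (i : ℕ) = n := ⟨_, rfl⟩
  induction n generalizing m i i' with
  | zero =>
    refine SingleMem.of_smul h.x_smul ?_
    rintro j rfl
    have hi : (i : ℕ) = r := by omega
    have hu' : gen k r 1 • u.1 = 0 := by
      obtain h | h := hu
      · rw [Fin.le_def, Fin.val_castSucc] at h
        omega
      · rwa [hi, show r + 1 - r = 1 by omega, pow_one] at h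
    rw [show genSmul M 1 m u = 0 from Subtype.ext hu']
    exact SingleMem.zero _ _
  | succ n ih =>
    refine SingleMem.of_smul h.x_smul ?_
    rintro j rfl
    obtain ⟨l, rfl⟩ : ∃ l : Fin r, l.castSucc = i := ⟨⟨i, by omega⟩, rfl⟩
    refine ih h.y_smul ?_ ?_
    · refine hu.imp (fun h => Fin.succ_le_succ_iff.2 (Fin.castSucc_le_castSucc_iff.1 h)) fun h => ?_
      change gen k r 1 ^ (r + 1 - (l.succ : ℕ)) • gen k r 1 • u.1 = 0
      rw [← mul_smul, ← pow_succ]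
      rw [← h]
      congr 2
      simp
      omega
    · simp at hn ⊢
      omega

/-- The element y u is first obtained at words y x ⋯; since y^r kills it, `of_rel` moves it back to
words beginning with x. -/
theorem SingleMem.gen_smul (hr : 1 ≤ r) {m : ℕ} {u : M.deg ((m : ℤ) + r + 1)} (h : SingleMem K m 0 u)
    (i : Fin 2) : SingleMem K (m + 1) 0 (genSmul M i m u) := by
  fin_cases i
  · exact h.x_smul
  · have h' : SingleMem K m (Fin.castSucc (⟨0, hr⟩ : Fin r)) u := h
    refine h'.y_smul.of_rel (Or.inr ?_)
    change gen k r 1 ^ (r + 1 - 1) • gen k r 1 • u.1 = 0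
    rw [← mul_smul, ← pow_succ, show r + 1 - 1 + 1 = r + 1 by omega, gen_pow, zero_smul]

end SingleMem

/-- The homogeneous submodule of a graded module that corresponds to a submodule of its
sections. -/
def subOfSec (hr : 1 ≤ r) (K : Submodule (SLim k r)ᵐᵒᵖ (Sec M)) :
    Submodule (B k r) M.carrier :=
  let D : Submodule k M.carrier :=
    -- Index 0 is the strongest condition, since by `of_rel` it implies the one for every other
    -- index. No stage sees the degrees below r+1, so these components are required to vanish.
    { carrier := {z | (∀ n : ℤ, n < r + 1 → M.proj n z = 0) ∧
        ∀ m : ℕ, SingleMem K m 0 ⟨M.proj ((m : ℤ) + r + 1) z, M.proj_mem _ _⟩}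
      add_mem' := by
        rintro z z' ⟨h1, h2⟩ ⟨h1', h2'⟩
        refine ⟨fun n hn => by rw [map_add, h1 n hn, h1' n hn, add_zero], fun m => ?_⟩
        convert (h2 m).add (h2' m) using 1
        exact Subtype.ext (map_add _ _ _)
      zero_mem' := by
        refine ⟨fun n _ => map_zero _, fun m => ?_⟩
        convert SingleMem.zero m 0 using 1
        exact Subtype.ext (map_zero _)
      smul_mem' := by
        rintro c z ⟨h1, h2⟩
        refine ⟨fun n hn => by rw [map_smul, h1 n hn, smul_zero], fun m => ?_⟩
        convert (h2 m).smul c using 1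
        exact Subtype.ext (map_smul _ _ _) }
  { D.toAddSubmonoid with
    smul_mem' := by
      refine fun b z hz => smul_mem_of_gen D ?_ b z hz
      rintro i z ⟨h1, h2⟩
      refine ⟨fun n hn => ?_, fun m => ?_⟩
      · rw [GrMod.proj_smul (gen_mem k r i), h1 _ (by omega), smul_zero]
      · cases m with
        | zero =>
          convert SingleMem.zero 0 0 using 1
          refine Subtype.ext ?_
          change M.proj _ (gen k r i • z) = 0
          rw [GrMod.proj_smul (gen_mem k r i), h1 _ (by push_cast; omega), smul_zero]
        | succ m =>
          convert (h2 m).gen_smul hr i using 1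
          refine Subtype.ext ?_
          change M.proj _ (gen k r i • z) = gen k r i • M.proj _ z
          rw [GrMod.proj_smul (gen_mem k r i)]
          rw [show ((m + 1 : ℕ) : ℤ) + r + 1 - 1 = m + r + 1 by push_cast; ring] }

section SubOfSec

variable (hr : 1 ≤ r) (K : Submodule (SLim k r)ᵐᵒᵖ (Sec M))

theorem mem_subOfSec {z : M.carrier} : z ∈ subOfSec hr K ↔
    (∀ n : ℤ, n < r + 1 → M.proj n z = 0) ∧
      ∀ m : ℕ, SingleMem K m 0 ⟨M.proj ((m : ℤ) + r + 1) z, M.proj_mem _ _⟩ := Iff.rfl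

theorem mem_subOfSec_of_deg {m : ℕ} (u : M.deg ((m : ℤ) + r + 1)) :
    u.1 ∈ subOfSec hr K ↔ SingleMem K m 0 u := by
  rw [mem_subOfSec]
  constructor
  · intro h
    convert h.2 m using 1
    exact Subtype.ext (GrMod.proj_of_mem u.2).symm
  · refine fun h => ⟨fun n hn => GrMod.proj_of_mem_ne u.2 (by omega), fun m' => ?_⟩
    by_cases hm : m' = m
    · subst hm
      convert h using 1
      exact Subtype.ext (GrMod.proj_of_mem u.2)
    · convert SingleMem.zero m' 0 using 1
      exact Subtype.ext (GrMod.proj_of_mem_ne u.2 (by omega))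

theorem isHomog_subOfSec : M.IsHomog (subOfSec hr K) := by
  intro z hz n
  by_cases hn : n < r + 1
  · rw [hz.1 n hn]
    exact zero_mem _
  · obtain ⟨m, rfl⟩ : ∃ m : ℕ, n = (m : ℤ) + r + 1 := ⟨(n - (r + 1)).toNat, by omega⟩
    exact (mem_subOfSec_of_deg hr K ⟨_, M.proj_mem _ z⟩).2 (hz.2 m)

end SubOfSec

/-! ### From submodules of a graded module to submodules of its sections. -/

/-- A family has values in a submodule. -/
def Stage.ValuedIn {m : ℕ} (h : Stage M m) (U : Submodule (B k r) M.carrier) : Prop :=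
  ∀ i p, h.1 i p ∈ U

namespace Stage

variable {U : Submodule (B k r) M.carrier}

theorem ValuedIn.step {m : ℕ} {h : Stage M m} (hU : ValuedIn h U) :
    ValuedIn (step m h) U := by
  intro i
  induction i using Fin.cases with
  | zero => exact fun p => U.smul_mem _ (hU _ _)
  | succ i => exact fun p => U.smul_mem _ (hU _ _)

theorem ValuedIn.trans {m n : ℕ} (hmn : m ≤ n) {h : Stage M m} (hU : ValuedIn h U) :
    ValuedIn (trans m n hmn h) U := by
  induction n, hmn using Nat.le_induction with
  | base => rwa [trans_self]
  | succ n hmn ih =>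
    rw [trans_succ m n hmn]
    exact ih.step

theorem ValuedIn.act {m : ℕ} {h : Stage M m} (hU : ValuedIn h U) (g : SAlg k r m) :
    ValuedIn (Stage.act h g) U := by
  intro i q
  rw [act_val]
  exact Submodule.sum_mem (U.restrictScalars k) fun p _ =>
    Submodule.smul_mem (U.restrictScalars k) _ (hU i p)

end Stage

/-- The sections that are represented by families with values in a given submodule. -/
def secOfSub (U : Submodule (B k r) M.carrier) : Submodule (SLim k r)ᵐᵒᵖ (Sec M) where
  carrier := {a | ∃ m h, Sec.mk M m h = a ∧ ValuedIn h U}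
  add_mem' := by
    rintro _ _ ⟨m, h, rfl, hU⟩ ⟨m', h', rfl, hU'⟩
    refine ⟨max m m', trans m _ (le_max_left _ _) h + trans m' _ (le_max_right _ _) h', ?_,
      fun i p => U.add_mem (hU.trans _ i p) (hU'.trans _ i p)⟩
    rw [map_add, Sec.mk_trans, Sec.mk_trans]
  zero_mem' := ⟨0, 0, map_zero _, fun _ _ => U.zero_mem⟩
  smul_mem' := by
    rintro s _ ⟨m, h, rfl, hU⟩
    obtain ⟨n, hn, g, hg⟩ := exists_toLim_ge m s.unop
    refine ⟨n, Stage.act (trans m n hn h) g, ?_, (hU.trans hn).act g⟩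
    rw [← Sec.op_toLim_smul_mk, hg, MulOpposite.op_unop, Sec.mk_trans]

theorem secOfSub_mono {U V : Submodule (B k r) M.carrier} (h : U ≤ V) :
    secOfSub U ≤ secOfSub V := by
  rintro _ ⟨m, f, rfl, hf⟩
  exact ⟨m, f, rfl, fun i p => h (hf i p)⟩

theorem secOfSub_bot : secOfSub (⊥ : Submodule (B k r) M.carrier) = ⊥ := by
  rw [eq_bot_iff]
  rintro _ ⟨m, f, rfl, hf⟩
  rw [show f = 0 from Stage.ext fun i p => hf i p, map_zero]
  exact zero_mem _

theorem secOfSub_top : secOfSub (⊤ : Submodule (B k r) M.carrier) = ⊤ := by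
  rw [eq_top_iff]
  intro a _
  obtain ⟨m, h, rfl⟩ := Sec.exists_mk a
  exact ⟨m, h, rfl, fun _ _ => trivial⟩

/-- Hence every submodule of sections comes from a homogeneous submodule. One inclusion moves values
from index 0 to the other indices; the other represents a section at a later stage, where all values
come from words beginning with x. -/
theorem secOfSub_subOfSec (hr : 1 ≤ r) (K : Submodule (SLim k r)ᵐᵒᵖ (Sec M)) :
    secOfSub (subOfSec hr K) = K := by
  apply le_antisymm
  · rintro _ ⟨m, h, rfl, hU⟩
    refine Sec.mk_mem_of_single fun i p => ?_
    have := (mem_subOfSec_of_deg hr K (val h i p)).1 (hU i p)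
    exact this.of_rel (Or.inl (Fin.zero_le i)) p
  · intro a ha
    -- After n stages a word with leading power i < n arises from a word x w created on the way, and
    -- the values at such words lie in `subOfSec hr K` by `x_smul`. Taking n = r+1 covers all words.
    suffices H : ∀ n : ℕ, ∃ m h, Sec.mk M m h = a ∧
        ∀ (i : Fin (r + 1)) p, (i : ℕ) < n → h.1 i p ∈ subOfSec hr K by
      obtain ⟨m, h, h1, h2⟩ := H (r + 1)
      exact ⟨m, h, h1, fun i p => h2 i p i.2⟩
    intro n
    induction n with
    | zero =>
      obtain ⟨m, h, rfl⟩ := Sec.exists_mk a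
      exact ⟨m, h, rfl, by simp⟩
    | succ n ih =>
      obtain ⟨m, h, rfl, hU⟩ := ih
      refine ⟨m + 1, step m h, Sec.mk_step h, fun i => ?_⟩
      induction i using Fin.cases with
      | zero =>
        intro P _
        obtain ⟨⟨i, p⟩, rfl⟩ := (xIdx r m).surjective P
        have h1 : SingleMem K m i (val h i p) := SingleMem.of_mem (Sec.mk_single_mem ha i p p)
        have h2 := (mem_subOfSec_of_deg hr K _).2 h1.x_smul
        rwa [← val_step_xIdx] at h2
      | succ i =>
        intro P hi
        exact (subOfSec hr K).smul_mem _ (hU i.castSucc _ (by simpa using hi))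

/-- The submodule `subOfSec hr K` may be too large to be finitely generated. The finitely many
values of families representing generators of `K` span a smaller submodule with the same sections.
-/
theorem exists_fg_secOfSub_eq (hr : 1 ≤ r) {K : Submodule (SLim k r)ᵐᵒᵖ (Sec M)} (hK : K.FG) :
    ∃ U : Submodule (B k r) M.carrier, U.FG ∧ M.IsHomog U ∧ secOfSub U = K := by
  classical
  obtain ⟨s, hs⟩ := hK
  have hsK : ∀ a ∈ s, a ∈ secOfSub (subOfSec hr K) := fun a ha => by
    rw [secOfSub_subOfSec, ← hs]
    exact Submodule.subset_span ha
  choose! m h h1 h2 using hsK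
  let T : Set M.carrier :=
    ⋃ a : s, ⋃ i, Set.range fun p => (h a.1).1 i p
  have hT : T ⊆ subOfSec hr K := by
    refine Set.iUnion_subset fun a => Set.iUnion_subset fun i => ?_
    rintro _ ⟨p, rfl⟩
    exact h2 a.1 a.2 i p
  have hTfin : T.Finite := Set.finite_iUnion fun a => Set.finite_iUnion fun i => Set.finite_range _
  refine ⟨Submodule.span _ T, Submodule.fg_span hTfin, ?_, le_antisymm ?_ ?_⟩
  · refine GrMod.isHomog_span fun t ht => ?_
    obtain ⟨_, ⟨a, rfl⟩, _, ⟨i, rfl⟩, p, rfl⟩ := ht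
    exact ⟨_, (h a.1).2 i p⟩
  · conv_rhs => rw [← secOfSub_subOfSec hr K]
    exact secOfSub_mono (Submodule.span_le.2 hT)
  · rw [← hs, Submodule.span_le]
    intro a ha
    exact ⟨m a, h a, h1 a ha, fun i p => Submodule.subset_span
      (Set.mem_iUnion.2 ⟨⟨a, ha⟩, Set.mem_iUnion.2 ⟨i, p, rfl⟩⟩)⟩

/-- With `range_secMap` this is the exactness of sections: a section that becomes zero does so at a
finite stage. -/
theorem ker_secMap {N : GrMod k (grading k r)} (f : M ⟶ N) :
    LinearMap.ker (Sec.map f) = secOfSub (LinearMap.ker f.toLin) := by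
  ext a
  constructor
  · intro ha
    obtain ⟨m, h, rfl⟩ := Sec.exists_mk a
    rw [LinearMap.mem_ker, Sec.map_mk, Sec.mk_eq_zero] at ha
    obtain ⟨n, hn, ha⟩ := ha
    refine ⟨n, trans m n hn h, Sec.mk_trans hn h, fun i p => ?_⟩
    rw [map_trans] at ha
    exact congrFun (congrFun (congrArg Subtype.val ha) i) p
  · rintro ⟨m, h, rfl, hU⟩
    rw [LinearMap.mem_ker, Sec.map_mk,
      show Stage.map f m h = 0 from Stage.ext fun i p => hU i p, map_zero]

theorem range_secMap {N : GrMod k (grading k r)} (f : M ⟶ N) :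
    LinearMap.range (Sec.map f) = secOfSub (LinearMap.range f.toLin) := by
  ext a
  constructor
  · rintro ⟨a, rfl⟩
    obtain ⟨m, h, rfl⟩ := Sec.exists_mk a
    exact ⟨m, Stage.map f m h, rfl, fun i p => ⟨h.1 i p, rfl⟩⟩
  · rintro ⟨m, h, rfl, hU⟩
    choose z hz using hU
    -- Arbitrary preimages are replaced by their components of degree m+r+1.
    refine ⟨Sec.mk M m ⟨fun i p => M.proj _ (z i p), fun i p => M.proj_mem _ _⟩, ?_⟩
    rw [Sec.map_mk]
    congr 1
    refine Stage.ext fun i p => ?_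
    rw [map_val, ← GrMod.Hom.map_proj, hz]
    exact GrMod.proj_of_mem (h.2 i p)

end Elementary

/-! ### Torsion -/

section Torsion

variable {k : Type u} [Field k] {r : ℕ} {M : GrMod k (grading k r)}

open Stage

/-- Some component `B_L` of `B` maps `u` to the submodule `U`. -/
def TorsMod (U : Submodule (B k r) M.carrier) (u : M.carrier) : Prop :=
  ∃ L : ℕ, ∀ b ∈ grading k r L, b • u ∈ U

variable {U : Submodule (B k r) M.carrier}

theorem smul_mem_of_le {L n : ℕ} {u : M.carrier} (h : ∀ b ∈ grading k r L, b • u ∈ U)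
    (hn : L ≤ n) : ∀ b ∈ grading k r n, b • u ∈ U := by
  induction n, hn using Nat.le_induction with
  | base => exact h
  | succ n hn ih =>
    intro b hb
    push_cast at hb
    obtain ⟨a, ha, c, hc, rfl⟩ := exists_eq_x_mul_add_y_mul (by omega) hb
    rw [add_smul, mul_smul, mul_smul]
    exact U.add_mem (U.smul_mem _ (ih a ha)) (U.smul_mem _ (ih c hc))

theorem TorsMod.zero : TorsMod U 0 := ⟨0, fun b _ => by rw [smul_zero]; exact zero_mem _⟩

theorem TorsMod.add {u v : M.carrier} (hu : TorsMod U u) (hv : TorsMod U v) :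
    TorsMod U (u + v) := by
  obtain ⟨L, hu⟩ := hu
  obtain ⟨L', hv⟩ := hv
  refine ⟨max L L', fun b hb => ?_⟩
  rw [smul_add]
  exact U.add_mem (smul_mem_of_le hu (le_max_left _ _) b hb)
    (smul_mem_of_le hv (le_max_right _ _) b hb)

theorem TorsMod.of_gen {u : M.carrier} (h : ∀ i, TorsMod U (gen k r i • u)) : TorsMod U u := by
  choose L hL using h
  refine ⟨max (L 0) (L 1) + 1, fun b hb => ?_⟩
  refine smul_mem_of_smul_gen_mem U (max (L 0) (L 1)) u (fun i => ?_) b (by exact_mod_cast hb)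
  refine smul_mem_of_le (hL i) ?_
  fin_cases i
  · exact le_max_left _ _
  · exact le_max_right _ _

/-- If u is placed at a word w = y^i x ⋯, its values L stages later are the v u for words v of
length L with v w ≠ 0. The remaining v contain y^(r+1), hence vanish in B, or end in y^(r+1-i), and
then `hu` applies. -/
theorem smul_mem_of_trans_single {L m n : ℕ} (hn : m + L = n) {i : Fin (r + 1)}
    {p : Fin (blockSize r m i)} {u : M.deg ((m : ℤ) + r + 1)}
    (hU : ValuedIn (trans m n (by omega) (single i p u)) U)
    (hu : gen k r 1 ^ (r + 1 - (i : ℕ)) • u.1 ∈ U) : ∀ b ∈ grading k r L, b • u.1 ∈ U := by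
  induction L generalizing m i with
  | zero =>
    obtain rfl : m = n := by omega
    intro b _
    rw [trans_self] at hU
    have := hU i p
    rw [LinearMap.id_apply, single_val_same] at this
    exact U.smul_mem b this
  | succ L ih =>
    have key : ∀ (j : Fin (r + 1)) (q : Fin (blockSize r (m + 1) j)),
        ValuedIn (trans (m + 1) n (by omega)
          (single j q (val (step m (single i p u)) j q))) U := by
      intro j q
      rw [← act_unit, trans_act, trans_step]
      exact hU.act _
    intro b hb
    refine smul_mem_of_smul_gen_mem U L u.1 (fun j => ?_) b (by exact_mod_cast hb)
    fin_cases j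
    · have h1 := key 0 (xIdx r m ⟨i, p⟩)
      rw [val_step_xIdx, val_single] at h1
      refine ih (by omega) h1 ?_
      change gen k r 1 ^ (r + 1) • gen k r 0 • u.1 ∈ U
      rw [gen_pow, zero_smul]
      exact zero_mem _
    · by_cases hi : (i : ℕ) < r
      · obtain ⟨l, rfl⟩ : ∃ l : Fin r, l.castSucc = i := ⟨⟨i, hi⟩, rfl⟩
        have h1 := key l.succ (yIdx m l p)
        rw [val_step_yIdx, val_single] at h1
        refine ih (by omega) h1 ?_
        change gen k r 1 ^ (r + 1 - (l.succ : ℕ)) • gen k r 1 • u.1 ∈ U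
        rw [← mul_smul, ← pow_succ]
        convert hu using 3
        simp
        omega
      · rw [show r + 1 - (i : ℕ) = 1 by omega, pow_one] at hu
        exact fun b _ => U.smul_mem b hu

theorem exists_trans_val {m n : ℕ} (hmn : m ≤ n) (h : Stage M m) (i : Fin (r + 1))
    (p : Fin (blockSize r n i)) :
    ∃ b ∈ grading k r ((n - m : ℕ) : ℤ), ∃ j q, (trans m n hmn h).1 i p = b • h.1 j q := by
  induction n, hmn using Nat.le_induction generalizing i with
  | base => exact ⟨1, by simpa using one_mem_grading, i, p, by simp [trans_self]⟩
  | succ n hmn ih =>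
    have key : ∀ (l : Fin 2) (i : Fin (r + 1)) (p : Fin (blockSize r n i)),
        ∃ b ∈ grading k r ((n + 1 - m : ℕ) : ℤ), ∃ j q,
          gen k r l • (trans m n hmn h).1 i p = b • h.1 j q := by
      intro l i p
      obtain ⟨b, hb, j, q, hq⟩ := ih i p
      refine ⟨gen k r l * b, ?_, j, q, by rw [hq, mul_smul]⟩
      have := SetLike.GradedMul.mul_mem (gen_mem k r l) hb
      rwa [show (1 : ℤ) + ((n - m : ℕ) : ℤ) = ((n + 1 - m : ℕ) : ℤ) by omega] at this
    rw [trans_succ m n hmn, LinearMap.comp_apply]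
    induction i using Fin.cases with
    | zero =>
      obtain ⟨⟨i, p⟩, rfl⟩ := (xIdx r n).surjective p
      rw [step_xIdx]
      exact key 0 i p
    | succ i =>
      obtain ⟨p, rfl⟩ := (yIdx n i).surjective p
      rw [step_yIdx]
      exact key 1 i.castSucc p

/-- Sections see submodules exactly up to torsion. An element v is tested by placing it at a word
with i = 0, for which the hypothesis y^(r+1) v ∈ U of `smul_mem_of_trans_single` is automatic. -/
theorem secOfSub_le_iff {V : Submodule (B k r) M.carrier} (hV : M.IsHomog V) :
    secOfSub V ≤ secOfSub U ↔ ∀ v ∈ V, TorsMod U v := by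
  constructor
  · intro h
    have h_deg : ∀ (m : ℕ), ∀ v ∈ V, v ∈ M.deg ((m : ℤ) + r + 1) → TorsMod U v := by
      intro m v hv hm
      let p : Fin (blockSize r m 0) := ⟨0, blockSize_pos r m 0⟩
      have h1 : Sec.mk M m (single 0 p ⟨v, hm⟩) ∈ secOfSub V := by
        refine ⟨m, _, rfl, fun i q => ?_⟩
        by_cases hi : i = 0
        · subst hi
          by_cases hq : q = p
          · subst hq
            rwa [single_val_same]
          · rw [single_val_of_ne hq]
            exact zero_mem _
        · rw [single_val_of_ne' _ _ hi]
          exact zero_mem _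
      obtain ⟨m', f, hf, hfU⟩ := h h1
      obtain ⟨n, hn', hn, he⟩ := Sec.mk_eq_mk.1 hf
      refine ⟨n - m, smul_mem_of_trans_single (m := m) (n := n) (i := 0) (p := p)
        (u := ⟨v, hm⟩) (by omega) ?_ ?_⟩
      · rw [← he]
        exact hfU.trans hn'
      · change gen k r 1 ^ (r + 1) • v ∈ U
        rw [gen_pow, zero_smul]
        exact zero_mem _
    -- Elements of degree below r+1 belong to no stage; `TorsMod.of_gen` reduces them to higher
    -- degrees, and n bounds the remaining distance.
    have h_all : ∀ (n : ℕ) (d : ℤ), (r : ℤ) + 1 ≤ d + n → ∀ v ∈ V, v ∈ M.deg d →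
        TorsMod U v := by
      intro n
      induction n with
      | zero =>
        intro d hd v hv hm
        refine h_deg (d - r - 1).toNat v hv ?_
        rwa [show (((d - r - 1).toNat : ℕ) : ℤ) + r + 1 = d by omega]
      | succ n ih =>
        intro d hd v hv hm
        exact TorsMod.of_gen fun i => ih (1 + d) (by omega) _ (V.smul_mem _ hv)
          (M.smul_mem (gen_mem k r i) hm)
    intro v hv
    obtain ⟨s, hs, -⟩ := M.exists_sum_proj v
    rw [hs]
    refine Finset.sum_induction _ (TorsMod U) (fun _ _ => TorsMod.add) TorsMod.zero fun d _ => ?_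
    exact h_all (r + 1 - d).toNat d (by omega) _ (hV v hv d) (M.proj_mem _ _)
  · rintro h _ ⟨m, f, rfl, hf⟩
    choose L hL using fun i p => h _ (hf i p)
    -- The sum is a crude common bound for the finitely many exponents L i p.
    let N : ℕ := ∑ i, ∑ p, L i p
    have hN : ∀ i p, L i p ≤ N := fun i p =>
      (Finset.single_le_sum (f := fun p => L i p) (fun _ _ => Nat.zero_le _)
        (Finset.mem_univ p)).trans
      (Finset.single_le_sum (f := fun i => ∑ p, L i p) (fun _ _ => Nat.zero_le _)
        (Finset.mem_univ i))
    refine ⟨m + N, trans m (m + N) (by omega) f, Sec.mk_trans _ f, fun i p => ?_⟩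
    obtain ⟨b, hb, j, q, hq⟩ := exists_trans_val (show m ≤ m + N by omega) f i p
    rw [hq]
    rw [show m + N - m = N by omega] at hb
    exact smul_mem_of_le (hL j q) (hN j q) b hb

theorem secOfSub_eq_bot_iff {V : Submodule (B k r) M.carrier} (hV : M.IsHomog V) :
    secOfSub V = ⊥ ↔ ∀ v ∈ V, TorsMod ⊥ v := by
  rw [← secOfSub_le_iff hV, secOfSub_bot, le_bot_iff]

theorem secOfSub_eq_top_iff : secOfSub U = ⊤ ↔ ∀ v, TorsMod U v := by
  have := secOfSub_le_iff (M := M) (U := U) (V := ⊤) fun _ _ _ => trivial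
  rw [secOfSub_top, top_le_iff] at this
  simpa using this

/-! ### Finite dimensional submodules -/

theorem exists_proj_eq_zero_of_finite (N : Submodule k M.carrier) [Module.Finite k N] :
    ∃ D : ℤ, ∀ v ∈ N, ∀ n, D < n → M.proj n v = 0 := by
  obtain ⟨s, hs⟩ := Module.Finite.iff_fg.1 (inferInstance : Module.Finite k N)
  choose t _ ht using M.exists_sum_proj
  obtain ⟨D, hD⟩ : ∃ D : ℤ, ∀ v ∈ s, ∀ n ∈ t v, n ≤ D := by
    classical
    obtain ⟨D, hD⟩ := (s.biUnion t).bddAbove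
    exact ⟨D, fun v hv n hn => hD (Finset.mem_coe.2 (Finset.mem_biUnion.2 ⟨v, hv, hn⟩))⟩
  refine ⟨D, fun v hv n hn => ?_⟩
  have : N ≤ LinearMap.ker (M.proj n) := by
    rw [← hs, Submodule.span_le]
    intro v hv
    exact ht v n fun h => absurd (hD v hv n h) (by omega)
  exact this hv

/-- A finite dimensional submodule lives in bounded degrees, so large components of B leave it;
conversely B m is spanned by the images of finitely many components of B, each finite dimensional.
-/
theorem exists_finite_submodule_iff (m : M.carrier) :
    (∃ N : Submodule (B k r) M.carrier, m ∈ N ∧ Module.Finite k N) ↔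
      TorsMod (M := M) ⊥ m := by
  constructor
  · rintro ⟨N, hm, hN⟩
    have : Module.Finite k (N.restrictScalars k) := hN
    obtain ⟨D, hD⟩ := exists_proj_eq_zero_of_finite (N.restrictScalars k)
    obtain ⟨s, -, hs⟩ := M.exists_sum_proj m
    obtain ⟨d, hd⟩ := s.bddBelow
    -- The components of m have degree at least d and those of N degree at most D, so a factor of
    -- degree D+1-d or more moves all of m out of the degrees of N.
    refine ⟨(D + 1 - d).toNat, fun b hb => ?_⟩
    rw [Submodule.mem_bot]
    refine GrMod.eq_zero_of_proj fun n => ?_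
    by_cases hn : D < n
    · exact hD _ (N.smul_mem b hm) n hn
    · rw [GrMod.proj_smul hb, hs, smul_zero]
      intro h
      have := hd h
      omega
  · rintro ⟨L, hL⟩
    let q : B k r →ₗ[k] M.carrier := (LinearMap.toSpanSingleton (B k r) M.carrier m).restrictScalars k
    let G : Submodule k (B k r) := (Finset.range L).sup fun n => grading k r (n : ℤ)
    have hG : Module.Finite k G := Submodule.finiteDimensional_finset_sup _ _
    refine ⟨Submodule.span _ {m}, Submodule.mem_span_singleton_self m, ?_⟩
    have hle : (Submodule.span (B k r) {m}).restrictScalars k ≤ G.map q := by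
      intro v hv
      obtain ⟨b, rfl⟩ := Submodule.mem_span_singleton.1 hv
      have hb : b ∈ ⨆ n, grading k r n := by
        rw [(DirectSum.Decomposition.isInternal (grading k r)).submodule_iSup_eq_top]
        trivial
      clear hv
      change q b ∈ _
      induction hb using Submodule.iSup_induction' with
      | zero =>
        rw [map_zero]
        exact zero_mem _
      | add a b _ _ ha hb =>
        rw [map_add]
        exact add_mem ha hb
      | mem n b hb =>
        by_cases hn : n < 0
        · rw [grading_of_neg hn, Submodule.mem_bot] at hb
          rw [hb, map_zero]
          exact zero_mem _
        · obtain ⟨n, rfl⟩ := Int.eq_ofNat_of_zero_le (not_lt.1 hn)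
          by_cases hn : n < L
          · exact ⟨b, Finset.le_sup (f := fun n : ℕ => grading k r (n : ℤ))
              (Finset.mem_range.2 hn) hb, rfl⟩
          · have : q b = 0 := smul_mem_of_le hL (not_lt.1 hn) b hb
            rw [this]
            exact zero_mem _
    exact Submodule.finiteDimensional_of_le hle

theorem isUnionOfFiniteDim_submodule_iff (V : Submodule (B k r) M.carrier) :
    IsUnionOfFiniteDim k (B k r) V ↔ ∀ v ∈ V, TorsMod (M := M) ⊥ v := by
  constructor
  · intro h v hv
    obtain ⟨N, hN, hfin⟩ := h ⟨v, hv⟩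
    refine (exists_finite_submodule_iff v).1 ⟨N.map V.subtype, ⟨⟨v, hv⟩, hN, rfl⟩, ?_⟩
    exact Module.Finite.equiv ((N.equivMapOfInjective V.subtype
      V.subtype_injective).restrictScalars k)
  · rintro h ⟨v, hv⟩
    obtain ⟨N, hN, hfin⟩ := (exists_finite_submodule_iff v).2 (h v hv)
    refine ⟨N.comap V.subtype, hN, ?_⟩
    let q : N.comap V.subtype →ₗ[k] N :=
      (V.subtype.restrict (p := N.comap V.subtype) (q := N) fun _ h => h).restrictScalars k
    refine Module.Finite.of_injective q ?_
    rintro ⟨a, ha⟩ ⟨b, hb⟩ hab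
    exact Subtype.ext (Subtype.ext (congrArg (fun z : N => z.1) hab))

theorem isUnionOfFiniteDim_quotient_iff (hU : M.IsHomog U) :
    IsUnionOfFiniteDim k (B k r) (M.carrier ⧸ U) ↔ ∀ v, TorsMod U v := by
  have key : ∀ v : M.carrier,
      TorsMod (M := M.quot U hU) ⊥ ((M.quotMk U hU).toLin v) ↔ TorsMod U v := by
    intro v
    refine exists_congr fun L => forall₂_congr fun b _ => ?_
    rw [← map_smul, Submodule.mem_bot, ← LinearMap.mem_ker, GrMod.ker_quotMk]
  constructor
  · intro h v
    exact (key v).1 ((exists_finite_submodule_iff (M := M.quot U hU) _).1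
      (h ((M.quotMk U hU).toLin v)))
  · intro h w
    obtain ⟨v, rfl⟩ := M.quotMk_surjective U hU w
    exact (exists_finite_submodule_iff (M := M.quot U hU) _).2 ((key v).2 (h v))

theorem isoModFdim_iff {N : GrMod k (grading k r)} (f : M ⟶ N) :
    isoModFdim (grading k r) f ↔ Function.Bijective (Sec.map f) := by
  rw [isoModFdim, isUnionOfFiniteDim_submodule_iff,
    isUnionOfFiniteDim_quotient_iff (GrMod.isHomog_range f),
    ← secOfSub_eq_bot_iff (GrMod.isHomog_ker f), ← secOfSub_eq_top_iff, ← ker_secMap,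
    ← range_secMap, LinearMap.ker_eq_bot, LinearMap.range_eq_top]
  rfl

theorem isoModFdim_iff_isIso {N : GrMod k (grading k r)} (f : M ⟶ N) :
    isoModFdim (grading k r) f ↔ IsIso ((secFunctor k r).map f) := by
  rw [isoModFdim_iff, ConcreteCategory.isIso_iff_bijective]
  rfl

end Torsion

/-! ### Localization by calculus of fractions -/

section Localization

universe v₁ v₂ u₁ u₂

variable {C : Type u₁} [Category.{v₁} C] {D : Type u₂} [Category.{v₂} D]

/-- A functor that is full, faithful and essentially surjective up to the morphisms which it
inverts is a localization functor. -/
theorem isEquivalence_lift (F : C ⥤ D) (W : MorphismProperty C)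
    (hW : ∀ ⦃X Y : C⦄ (f : X ⟶ Y), W f ↔ IsIso (F.map f))
    (h_faithful : ∀ ⦃X Y : C⦄ (f g : X ⟶ Y), F.map f = F.map g →
      ∃ (Y' : C) (t : Y ⟶ Y'), W t ∧ f ≫ t = g ≫ t)
    (h_full : ∀ ⦃X Y : C⦄ (φ : F.obj X ⟶ F.obj Y),
      ∃ (Y' : C) (s : Y ⟶ Y') (f : X ⟶ Y'), W s ∧ F.map f = φ ≫ F.map s)
    [F.EssSurj] :
    (Localization.Construction.lift (W := W) F fun _ _ f hf => (hW f).1 hf).IsEquivalence := by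
  have : W.IsMultiplicative :=
    { id_mem := fun X => (hW _).2 (by rw [F.map_id]; infer_instance)
      comp_mem := fun f g hf hg => (hW _).2 (by
        have := (hW f).1 hf
        have := (hW g).1 hg
        rw [F.map_comp]
        infer_instance) }
  have : W.HasLeftCalculusOfFractions :=
    { exists_leftFraction := by
        intro X Y φ
        have := (hW φ.s).1 φ.hs
        -- The missing sides of the square come from realising F(s)⁻¹ ≫ F(f) as a fraction. The
        -- square commutes only after applying F, and `h_faithful` supplies the morphism t that
        -- repairs this.
        obtain ⟨Y', s, f, hs, hf⟩ := h_full (inv (F.map φ.s) ≫ F.map φ.f)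
        obtain ⟨Y'', t, ht, h⟩ := h_faithful (φ.f ≫ s) (φ.s ≫ f) (by
          rw [F.map_comp, F.map_comp, hf]
          simp)
        exact ⟨.mk (f ≫ t) (s ≫ t) (W.comp_mem _ _ hs ht), by simpa using h⟩
      ext := by
        intro X' X Y f₁ f₂ s hs h
        have := (hW s).1 hs
        obtain ⟨Y', t, ht, h⟩ := h_faithful f₁ f₂ (by
          rw [← cancel_epi (F.map s), ← F.map_comp, ← F.map_comp, h])
        exact ⟨Y', t, ht, h⟩ }
  set E := Localization.Construction.lift (W := W) F fun _ _ f hf => (hW f).1 hf with hE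
  have hQE : W.Q ⋙ E = F := Localization.Construction.fac _ _
  have e : W.Q ⋙ E ≅ F := eqToIso hQE
  have h_surj : E.EssSurj :=
    ⟨fun Y => ⟨W.Q.obj (F.objPreimage Y), ⟨e.app _ ≪≫ F.objObjPreimageIso Y⟩⟩⟩
  -- The localization has the objects of C, so fullness and faithfulness need only be tested on
  -- objects in the image of Q.
  have h_obj : ∀ X : W.Localization, ∃ X' : C, W.Q.obj X' = X := fun X =>
    ⟨(Localization.Construction.objEquiv W).symm X,
      (Localization.Construction.objEquiv W).apply_symm_apply X⟩
  have h_map : ∀ {X Y : C} (f : X ⟶ Y), E.map (W.Q.map f) = e.hom.app X ≫ F.map f ≫ e.inv.app Y := by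
    intro X Y f
    rw [← e.hom.naturality_assoc]
    simp
  have h_ful : E.Full := by
    refine ⟨fun {X Y} φ => ?_⟩
    obtain ⟨X, rfl⟩ := h_obj X
    obtain ⟨Y, rfl⟩ := h_obj Y
    obtain ⟨Y', s, f, hs, hf⟩ := h_full (e.inv.app X ≫ φ ≫ e.hom.app Y)
    have hiso := W.Q_inverts s hs
    refine ⟨W.Q.map f ≫ inv (W.Q.map s), ?_⟩
    rw [E.map_comp, Functor.map_inv, IsIso.comp_inv_eq, h_map, h_map, hf]
    simp
  have h_fai : E.Faithful := by
    refine ⟨fun {X Y} f g h => ?_⟩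
    obtain ⟨X, rfl⟩ := h_obj X
    obtain ⟨Y, rfl⟩ := h_obj Y
    -- Two parallel morphisms are given a common denominator; their numerators agree under F, hence
    -- after composition with some t in W.
    obtain ⟨φ, rfl, rfl⟩ := Localization.exists_leftFraction₂ W.Q W f g
    have hiso := W.Q_inverts φ.s φ.hs
    rw [← cancel_mono (W.Q.map φ.s), φ.fst.map_comp_map_s W.Q, φ.snd.map_comp_map_s W.Q]
    have h' : F.map φ.f = F.map φ.f' := by
      have h1 := h =≫ E.map (W.Q.map φ.s)
      rw [← E.map_comp, ← E.map_comp, φ.fst.map_comp_map_s W.Q, φ.snd.map_comp_map_s W.Q,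
        h_map, h_map] at h1
      exact (cancel_mono _).1 ((cancel_epi _).1 h1)
    obtain ⟨Y'', t, ht, h2⟩ := h_faithful _ _ h'
    have hiso' := W.Q_inverts t ht
    change W.Q.map φ.f = W.Q.map φ.f'
    rw [← cancel_mono (W.Q.map t), ← W.Q.map_comp, ← W.Q.map_comp, h2]
  exact { }

end Localization

/-! ### Sections of free modules -/

section FreeSections

variable (k : Type u) [Field k] (r : ℕ)

open Stage

/-- The family of all words of length `m + r + 1`. -/
def omegaStage (m : ℕ) : Stage (GrMod.self (grading k r)) m :=
  ⟨fun i p => omega k m i p, fun i p => omega_mem m i p⟩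

theorem step_omegaStage (m : ℕ) : step m (omegaStage k r m) = omegaStage k r (m + 1) := by
  refine Stage.ext_succ (fun i p => ?_) fun i q => ?_
  · rw [step_xIdx]
    exact (omega_xIdx k m i p).symm
  · rw [step_yIdx]
    exact (omega_yIdx k m i q).symm

theorem trans_omegaStage {m n : ℕ} (hmn : m ≤ n) :
    trans m n hmn (omegaStage k r m) = omegaStage k r n := by
  induction n, hmn using Nat.le_induction with
  | base => rw [trans_self]; rfl
  | succ n hmn ih =>
    rw [trans_succ m n hmn, LinearMap.comp_apply, ih, step_omegaStage]

/-- The canonical generator of the sections of `B`. -/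
def secOne : Sec (GrMod.self (grading k r)) := Sec.mk _ 0 (omegaStage k r 0)

theorem mk_omegaStage (m : ℕ) : Sec.mk _ m (omegaStage k r m) = secOne k r := by
  rw [secOne, ← Sec.mk_trans (Nat.zero_le m), trans_omegaStage]

variable {k r}

theorem eq_zero_of_act_omegaStage {m : ℕ} {g : SAlg k r m} (h : act (omegaStage k r m) g = 0) :
    g = 0 := by
  ext i p q
  have h1 := congrFun (congrFun (congrArg Subtype.val h) i) q
  exact congrFun (eq_zero_of_sum_smul_omega (c := fun p => g i p q) h1) p

/-- If an element of S kills the generator, then at a finite stage a matrix kills the family of all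
words, and the words in each block are linearly independent. -/
theorem smul_secOne_injective :
    Function.Injective (LinearMap.toSpanSingleton (SLim k r)ᵐᵒᵖ _ (secOne k r)) := by
  rw [← LinearMap.ker_eq_bot, Submodule.eq_bot_iff]
  intro s hs
  obtain ⟨m, g, hg⟩ := exists_toLim s.unop
  have hs' : MulOpposite.op (toLim k r m g) • secOne k r = 0 := by
    rw [hg]
    exact hs
  rw [← mk_omegaStage k r m, Sec.op_toLim_smul_mk, Sec.mk_eq_zero] at hs'
  obtain ⟨n, hn, h⟩ := hs'
  rw [trans_act, trans_omegaStage] at h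
  have h0 : toLim k r m g = 0 := by
    rw [← toLim_transition hn, eq_zero_of_act_omegaStage h]
    exact (DirectLimit.zero_def n).symm
  rw [hg] at h0
  exact MulOpposite.unop_injective h0

theorem span_secOne : Submodule.span (SLim k r)ᵐᵒᵖ {secOne k r} = ⊤ := by
  rw [eq_top_iff]
  intro a _
  obtain ⟨m, h, rfl⟩ := Sec.exists_mk a
  set K := Submodule.span (SLim k r)ᵐᵒᵖ {secOne k r}
  refine Sec.mk_mem_of_single fun i p => ?_
  suffices H : ∀ b ∈ Submodule.span k {b | ∃ i p, omega k m i p = b},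
      ∀ hb : b ∈ (GrMod.self (grading k r)).deg ((m : ℤ) + r + 1),
        SingleMem K m i ⟨b, hb⟩ from
    H _ (grading_le_span_omega m (h.2 i p)) (h.2 i p) p
  have hle : Submodule.span k {b | ∃ i p, omega k m i p = b} ≤
      (GrMod.self (grading k r)).deg ((m : ℤ) + r + 1) := by
    refine Submodule.span_le.2 ?_
    rintro _ ⟨i, p, rfl⟩
    exact omega_mem m i p
  intro b hb
  induction hb using Submodule.span_induction with
  | zero => exact fun _ => SingleMem.zero m i
  | add a b ha hb iha ihb =>
    exact fun _ => (iha (hle ha)).add (ihb (hle hb))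
  | smul c b hb ih =>
    exact fun _ => (ih (hle hb)).smul c
  | mem b hb =>
    obtain ⟨j, q, rfl⟩ := hb
    intro hb
    have h1 : SingleMem K m j ⟨omega k m j q, hb⟩ := by
      have h2 : Sec.mk _ m (omegaStage k r m) ∈ K := by
        rw [mk_omegaStage]
        exact Submodule.mem_span_singleton_self _
      exact SingleMem.of_mem (Sec.mk_single_mem h2 j q q)
    -- The generator has the value `omega k m j q` in the block j. Since y^(r+1-j) kills this word
    -- of B, it may be moved to any block i.
    exact h1.of_rel (Or.inr (y_pow_mul_omega k m j q))

/-- The sections of `B` form a free module of rank one. -/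
def secSelfEquiv : (SLim k r)ᵐᵒᵖ ≃ₗ[(SLim k r)ᵐᵒᵖ] Sec (GrMod.self (grading k r)) :=
  LinearEquiv.ofBijective (LinearMap.toSpanSingleton (SLim k r)ᵐᵒᵖ _ (secOne k r))
    ⟨smul_secOne_injective, by
      rw [← LinearMap.range_eq_top, LinearMap.range_toSpanSingleton, span_secOne]⟩

variable (J : Type u)

variable (k r) in
/-- The free graded module on generators of degree zero. -/
abbrev freeZero : GrMod k (grading k r) := GrMod.free (grading k r) fun _ : J => 0

variable {J}

/-- The inclusion of a summand of a free module. -/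
def freeIncl (j : J) : GrMod.self (grading k r) ⟶ freeZero k r J where
  toLin := Finsupp.lsingle j
  map_deg n a ha := by
    have := GrMod.single_mem_freeDeg (𝒜 := grading k r) (fun _ : J => 0) j ha
    rwa [add_zero] at this

/-- The projection on a summand of a free module. -/
def freeProj (j : J) : freeZero k r J ⟶ GrMod.self (grading k r) where
  toLin := Finsupp.lapply j
  map_deg n p hp := by
    have := hp j
    rwa [sub_zero] at this

theorem Sec.map_eq_zero {M N : GrMod k (grading k r)} {f : M ⟶ N} (hf : f.toLin = 0) :
    Sec.map f = 0 := by
  ext a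
  obtain ⟨m, h, rfl⟩ := Sec.exists_mk a
  rw [Sec.map_mk, show Stage.map f m h = 0 from
    Stage.ext fun i p => by rw [map_val, hf]; rfl, map_zero]
  rfl

theorem Sec.map_eq_id {M : GrMod k (grading k r)} {f : M ⟶ M} (hf : f.toLin = LinearMap.id) :
    Sec.map f = LinearMap.id := by
  rw [← Sec.map_id]
  congr 1
  exact GrMod.Hom.ext hf

variable (k r J) in
/-- The map from a free `S`-module to the sections of a free graded module. -/
def secFreeMap : (J →₀ (SLim k r)ᵐᵒᵖ) →ₗ[(SLim k r)ᵐᵒᵖ] Sec (freeZero k r J) :=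
  Finsupp.linearCombination _ fun j => Sec.map (freeIncl j) (secOne k r)

theorem map_freeProj_secFreeMap (j : J) (s : J →₀ (SLim k r)ᵐᵒᵖ) :
    Sec.map (freeProj j) (secFreeMap k r J s) = s j • secOne k r := by
  classical
  have h : ∀ j' : J, Sec.map (freeProj j) (Sec.map (freeIncl j') (secOne k r)) =
      if j' = j then secOne k r else 0 := by
    intro j'
    rw [← LinearMap.comp_apply, ← Sec.map_comp]
    split_ifs with hj
    · subst hj
      rw [Sec.map_eq_id]
      · rfl
      · refine LinearMap.ext fun b => ?_
        exact Finsupp.single_eq_same (M := B k r)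
    · rw [Sec.map_eq_zero]
      · rfl
      · refine LinearMap.ext fun b => ?_
        exact Finsupp.single_eq_of_ne' (M := B k r) hj
  induction s using Finsupp.induction_linear with
  | zero => simp
  | add s t hs ht => simp [hs, ht, add_smul]
  | single j' c =>
    rw [secFreeMap, Finsupp.linearCombination_single, map_smul, h]
    split_ifs with hj
    · subst hj
      rw [Finsupp.single_eq_same]
    · rw [Finsupp.single_eq_of_ne' hj, smul_zero, zero_smul]

theorem secFreeMap_injective : Function.Injective (secFreeMap k r J) := by
  intro s t h
  ext j : 1
  apply smul_secOne_injective
  have := congrArg (Sec.map (freeProj j)) h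
  rwa [map_freeProj_secFreeMap, map_freeProj_secFreeMap] at this

theorem secFreeMap_surjective : Function.Surjective (secFreeMap k r J) := by
  classical
  rw [← LinearMap.range_eq_top, eq_top_iff]
  intro a _
  obtain ⟨m, h, rfl⟩ := Sec.exists_mk a
  -- J may be infinite, but a family has finitely many values, each of finite support.
  let T : Finset J := Finset.univ.biUnion fun i => Finset.univ.biUnion fun p =>
    Finsupp.support (h.1 i p : J →₀ B k r)
  have hT : h = ∑ j ∈ T, Stage.map (freeIncl j) m (Stage.map (freeProj j) m h) := by
    refine Stage.ext fun i p => ?_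
    have h1 : (∑ j ∈ T, Stage.map (freeIncl j) m (Stage.map (freeProj j) m h)).1 i p =
        ∑ j ∈ T, (Stage.map (freeIncl j) m (Stage.map (freeProj j) m h)).1 i p := by
      simp only [AddSubmonoidClass.coe_finsetSum, Finset.sum_apply]
    rw [h1]
    have h2 : ∀ f : J →₀ B k r, f.support ⊆ T →
        f = ∑ j ∈ T, Finsupp.single j (f j) := by
      intro f hf
      conv_lhs => rw [← Finsupp.sum_single f]
      exact Finset.sum_subset hf fun j _ hj => by
        rw [Finsupp.notMem_support_iff.1 hj, Finsupp.single_zero]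
    refine h2 (h.1 i p) fun j hj => ?_
    exact Finset.mem_biUnion.2 ⟨i, Finset.mem_univ _, Finset.mem_biUnion.2 ⟨p, Finset.mem_univ _, hj⟩⟩
  rw [hT, map_sum]
  refine sum_mem fun j _ => ?_
  rw [← Sec.map_mk]
  have h3 : Sec.mk _ m (Stage.map (freeProj j) m h) ∈
      Submodule.span (SLim k r)ᵐᵒᵖ {secOne k r} := by
    rw [span_secOne]
    trivial
  obtain ⟨s, hs⟩ := Submodule.mem_span_singleton.1 h3
  rw [← hs, map_smul]
  exact ⟨Finsupp.single j s, by rw [secFreeMap, Finsupp.linearCombination_single]⟩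

variable (k r J) in
/-- The sections of a free graded module form a free `S`-module. -/
def secFreeEquiv : (J →₀ (SLim k r)ᵐᵒᵖ) ≃ₗ[(SLim k r)ᵐᵒᵖ] Sec (freeZero k r J) :=
  LinearEquiv.ofBijective _ ⟨secFreeMap_injective, secFreeMap_surjective⟩

end FreeSections

/-! ### Lifting objects and morphisms to graded modules -/

section Lifting

variable {k : Type u} [Field k] {r : ℕ}

/-- A single choice of `U` serves both categories: finite generation is recorded when `K` has it,
and no restriction is put on `K` otherwise. -/
theorem exists_secOfSub_eq (hr : 1 ≤ r) {M : GrMod k (grading k r)}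
    (K : Submodule (SLim k r)ᵐᵒᵖ (Sec M)) :
    ∃ U : Submodule (B k r) M.carrier, M.IsHomog U ∧ secOfSub U = K ∧ (K.FG → U.FG) := by
  by_cases hK : K.FG
  · obtain ⟨U, h1, h2, h3⟩ := exists_fg_secOfSub_eq hr hK
    exact ⟨U, h2, h3, fun _ => h1⟩
  · exact ⟨_, isHomog_subOfSec hr K, secOfSub_subOfSec hr K, fun h => absurd h hK⟩

theorem secMap_surjective {M N : GrMod k (grading k r)} {f : M ⟶ N}
    (hf : Function.Surjective f.toLin) : Function.Surjective (Sec.map f) := by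
  rw [← LinearMap.range_eq_top, range_secMap, LinearMap.range_eq_top.2 hf, secOfSub_top]

theorem ker_secMap_quotMk {M : GrMod k (grading k r)} (U : Submodule (B k r) M.carrier)
    (hU : M.IsHomog U) : LinearMap.ker (Sec.map (M.quotMk U hU)) = secOfSub U := by
  rw [ker_secMap, GrMod.ker_quotMk]

theorem finitePresentation_quot {M : GrMod k (grading k r)} {U : Submodule (B k r) M.carrier}
    (hU : M.IsHomog U) (hM : Module.FinitePresentation (B k r) M.carrier) (hfg : U.FG) :
    Module.FinitePresentation (B k r) (M.quot U hU).carrier :=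
  Module.finitePresentation_of_surjective (M.quotMk U hU).toLin (M.quotMk_surjective U hU)
    (by rwa [GrMod.ker_quotMk])

/-- Morphisms with the same action on sections agree up to torsion. -/
theorem exists_comp_eq_of_secMap_eq {X Y : GrMod k (grading k r)} {f g : X ⟶ Y}
    (h : Sec.map f = Sec.map g) : ∃ (Y' : GrMod k (grading k r)) (t : Y ⟶ Y'),
      Function.Bijective (Sec.map t) ∧ f ≫ t = g ≫ t ∧
      (Module.Finite (B k r) X.carrier → Module.FinitePresentation (B k r) Y.carrier →
        Module.FinitePresentation (B k r) Y'.carrier) := by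
  -- The module Y' is Y divided by the image of f - g. The sections of this image are zero, so the
  -- projection does not change sections.
  have hI := GrMod.isHomog_range (GrMod.subHom f g)
  refine ⟨Y.quot _ hI, Y.quotMk _ hI, ⟨?_, secMap_surjective (Y.quotMk_surjective _ hI)⟩, ?_, ?_⟩
  · rw [← LinearMap.ker_eq_bot, ker_secMap_quotMk, ← range_secMap, Sec.map_subHom, h, sub_self,
      LinearMap.range_zero]
  · refine GrMod.Hom.ext (LinearMap.ext fun x => ?_)
    refine (Submodule.Quotient.eq _).2 ⟨x, rfl⟩
  · intro hX hY
    exact finitePresentation_quot hI hY (Module.Finite.iff_fg.1 inferInstance)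

/-- A homomorphism of sections comes from a morphism of graded modules up to torsion. -/
theorem exists_secMap_eq (hr : 1 ≤ r) {X Y : GrMod k (grading k r)}
    (φ : Sec X →ₗ[(SLim k r)ᵐᵒᵖ] Sec Y) : ∃ (Y' : GrMod k (grading k r)) (s : Y ⟶ Y') (f : X ⟶ Y'),
      Function.Bijective (Sec.map s) ∧ Sec.map f = Sec.map s ∘ₗ φ ∧
      (Module.Finite (SLim k r)ᵐᵒᵖ (Sec X) → Module.FinitePresentation (B k r) X.carrier →
        Module.FinitePresentation (B k r) Y.carrier →
        Module.FinitePresentation (B k r) Y'.carrier) := by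
  let Z := X.prod Y
  -- The kernel of Φ is {(a, -φ a)}. Dividing X ⊕ Y by a graded submodule with these sections
  -- identifies, on sections, (a, 0) with (0, φ a), and Y maps bijectively to the quotient.
  let Φ : Sec Z →ₗ[(SLim k r)ᵐᵒᵖ] Sec Y := φ ∘ₗ Sec.map (X.fst Y) + Sec.map (X.snd Y)
  have h11 : Sec.map (X.fst Y) ∘ₗ Sec.map (X.inl Y) = LinearMap.id := by
    rw [← Sec.map_comp]
    exact Sec.map_eq_id rfl
  have h22 : Sec.map (X.snd Y) ∘ₗ Sec.map (X.inr Y) = LinearMap.id := by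
    rw [← Sec.map_comp]
    exact Sec.map_eq_id rfl
  have h12 : Sec.map (X.fst Y) ∘ₗ Sec.map (X.inr Y) = 0 := by
    rw [← Sec.map_comp]
    exact Sec.map_eq_zero rfl
  have h21 : Sec.map (X.snd Y) ∘ₗ Sec.map (X.inl Y) = 0 := by
    rw [← Sec.map_comp]
    exact Sec.map_eq_zero rfl
  have hsum : ∀ z, Sec.map (X.inl Y) (Sec.map (X.fst Y) z) +
      Sec.map (X.inr Y) (Sec.map (X.snd Y) z) = z := by
    intro z
    obtain ⟨m, h, rfl⟩ := Sec.exists_mk z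
    simp only [Sec.map_mk]
    rw [← map_add]
    congr 1
    refine Stage.ext fun i p => ?_
    exact Prod.fst_add_snd (h.1 i p)
  have e11 := LinearMap.congr_fun h11
  have e22 := LinearMap.congr_fun h22
  have e12 := LinearMap.congr_fun h12
  have e21 := LinearMap.congr_fun h21
  simp only [LinearMap.comp_apply, LinearMap.id_apply, LinearMap.zero_apply] at e11 e22 e12 e21
  obtain ⟨U, hU, hUK, hfg⟩ := exists_secOfSub_eq hr (LinearMap.ker Φ)
  let q := Z.quotMk U hU
  have hker : ∀ z, Sec.map q z = 0 ↔ φ (Sec.map (X.fst Y) z) + Sec.map (X.snd Y) z = 0 := by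
    intro z
    rw [← LinearMap.mem_ker, ker_secMap_quotMk, hUK]
    rfl
  refine ⟨Z.quot U hU, X.inr Y ≫ q, X.inl Y ≫ q, ⟨?_, ?_⟩, ?_, ?_⟩
  · rw [Sec.map_comp, ← LinearMap.ker_eq_bot, Submodule.eq_bot_iff]
    intro b hb
    rw [LinearMap.mem_ker, LinearMap.comp_apply, hker, e12, e22, map_zero, zero_add] at hb
    exact hb
  · intro c
    obtain ⟨z, rfl⟩ := secMap_surjective (Z.quotMk_surjective U hU) c
    refine ⟨φ (Sec.map (X.fst Y) z) + Sec.map (X.snd Y) z, ?_⟩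
    rw [Sec.map_comp, LinearMap.comp_apply, ← sub_eq_zero, ← map_sub, hker]
    rw [map_sub, map_sub, map_sub, e12, e22, map_zero]
    abel
  · refine LinearMap.ext fun a => ?_
    rw [Sec.map_comp, Sec.map_comp, LinearMap.comp_apply, LinearMap.comp_apply,
      LinearMap.comp_apply, ← sub_eq_zero, ← map_sub, hker, map_sub, map_sub, map_sub, e11, e12, e21, e22]
    simp
  · intro hfin hX hY
    have hZ : Module.FinitePresentation (B k r) Z.carrier :=
      inferInstanceAs (Module.FinitePresentation (B k r) (X.carrier × Y.carrier))
    refine finitePresentation_quot hU hZ (hfg ?_)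
    -- The kernel is the image of `Sec X` under a ↦ (a, -φ a), hence finitely generated together
    -- with `Sec X`.
    have : LinearMap.ker Φ = LinearMap.range (Sec.map (X.inl Y) - Sec.map (X.inr Y) ∘ₗ φ) := by
      ext z
      constructor
      · intro hz
        refine ⟨Sec.map (X.fst Y) z, ?_⟩
        have hz' : φ (Sec.map (X.fst Y) z) = - Sec.map (X.snd Y) z :=
          eq_neg_of_add_eq_zero_left hz
        rw [LinearMap.sub_apply, LinearMap.comp_apply, hz', map_neg, sub_neg_eq_add, hsum]
      · rintro ⟨a, rfl⟩
        change φ (Sec.map (X.fst Y) _) + Sec.map (X.snd Y) _ = 0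
        rw [LinearMap.sub_apply, LinearMap.comp_apply, map_sub, map_sub, map_sub,
          e11, e12, e21, e22]
        simp
    rw [this]
    exact Module.Finite.iff_fg.1 inferInstance

/-- A right `S`-module given by generators and relations is the module of sections of a graded
module. -/
theorem exists_sec_equiv (hr : 1 ≤ r) {J N : Type u} [AddCommGroup N] [Module (SLim k r)ᵐᵒᵖ N]
    (b : J → N) (hb : Submodule.span (SLim k r)ᵐᵒᵖ (Set.range b) = ⊤) :
    ∃ M : GrMod k (grading k r), Nonempty (Sec M ≃ₗ[(SLim k r)ᵐᵒᵖ] N) ∧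
      (Finite J → (LinearMap.ker (Finsupp.linearCombination (SLim k r)ᵐᵒᵖ b)).FG →
        Module.FinitePresentation (B k r) M.carrier) := by
  let Z := freeZero k r J
  -- The relations are read as sections of a free graded module; dividing by a submodule with these
  -- sections gives M.
  let K := (LinearMap.ker (Finsupp.linearCombination (SLim k r)ᵐᵒᵖ b)).map (secFreeMap k r J)
  obtain ⟨U, hU, hUK, hfg⟩ := exists_secOfSub_eq hr (M := Z) K
  let p := Sec.map (Z.quotMk U hU) ∘ₗ secFreeMap k r J
  have hp : Function.Surjective p :=
    (secMap_surjective (Z.quotMk_surjective U hU)).comp secFreeMap_surjective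
  have hker : LinearMap.ker p =
      LinearMap.ker (Finsupp.linearCombination (SLim k r)ᵐᵒᵖ b) := by
    rw [LinearMap.ker_comp, ker_secMap_quotMk, hUK]
    exact Submodule.comap_map_eq_of_injective secFreeMap_injective _
  have hsurj : Function.Surjective (Finsupp.linearCombination (SLim k r)ᵐᵒᵖ b) := by
    rw [← LinearMap.range_eq_top, Finsupp.range_linearCombination, hb]
  refine ⟨Z.quot U hU, ⟨(p.quotKerEquivOfSurjective hp).symm ≪≫ₗ
    Submodule.quotEquivOfEq _ _ hker ≪≫ₗ LinearMap.quotKerEquivOfSurjective _ hsurj⟩, ?_⟩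
  intro hJ hK
  have : Module.FinitePresentation (B k r) Z.carrier :=
    inferInstanceAs (Module.FinitePresentation (B k r) (J →₀ B k r))
  exact finitePresentation_quot hU this (hfg (hK.map _))

end Lifting

/-! ### Finitely generated and finitely presented graded modules -/

section FinitelyGenerated

variable {k : Type u} [Field k] {r : ℕ}

/-! ### Free graded modules, mostly of finite rank. -/

section FreeModule

variable {J : Type u} {d : J → ℤ}

theorem free_eq_zero_of_add_eq_zero {a c : (GrMod.free (grading k r) d).carrier}
    (h : gen k r 0 • a + gen k r 1 • c = 0) : a = 0 ∧ gen k r 1 • c = 0 := by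
  have h' : ∀ j, gen k r 0 * (show J →₀ B k r from a) j +
      gen k r 1 * (show J →₀ B k r from c) j = 0 := fun j =>
    DFunLike.congr_fun (F := J →₀ B k r) h j
  exact ⟨Finsupp.ext fun j => (eq_zero_of_x_mul_add_y_mul (h' j)).1,
    Finsupp.ext fun j => (eq_zero_of_x_mul_add_y_mul (h' j)).2⟩

variable [Finite J]

theorem free_exists_eq_add {n : ℤ} (hn : ∀ j, d j ≤ n) {p : (GrMod.free (grading k r) d).carrier}
    (hp : p ∈ (GrMod.free (grading k r) d).deg (n + 1)) :
    ∃ a ∈ (GrMod.free (grading k r) d).deg n, ∃ c ∈ (GrMod.free (grading k r) d).deg n,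
      p = gen k r 0 • a + gen k r 1 • c := by
  have h : ∀ j, ∃ a ∈ grading k r (n - d j), ∃ c ∈ grading k r (n - d j),
      (show J →₀ B k r from p) j = gen k r 0 * a + gen k r 1 * c := by
    intro j
    refine exists_eq_x_mul_add_y_mul (by linarith [hn j]) ?_
    have := hp j
    rwa [show n + 1 - d j = n - d j + 1 by ring] at this
  choose a ha c hc h using h
  exact ⟨Finsupp.equivFunOnFinite.symm a, ha, Finsupp.equivFunOnFinite.symm c, hc,
    Finsupp.ext h⟩

theorem free_exists_eq_y_pow_smul {n : ℤ} {c : (GrMod.free (grading k r) d).carrier}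
    (hc : c ∈ (GrMod.free (grading k r) d).deg n) (h : gen k r 1 • c = 0) :
    ∃ c' ∈ (GrMod.free (grading k r) d).deg (n - r), c = gen k r 1 ^ r • c' := by
  have h' : ∀ j, ∃ c' ∈ grading k r (n - d j - r),
      (show J →₀ B k r from c) j = gen k r 1 ^ r * c' := fun j =>
    exists_eq_y_pow_mul_of_mem (hc j) (DFunLike.congr_fun (F := J →₀ B k r) h j)
  choose c' hc' h' using h'
  refine ⟨Finsupp.equivFunOnFinite.symm c', fun j => ?_, Finsupp.ext h'⟩
  have := hc' j
  rwa [show n - d j - r = n - r - d j by ring] at this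

theorem finite_free_deg (n : ℤ) : Module.Finite k ((GrMod.free (grading k r) d).deg n) := by
  have : Module.Finite k (∀ j, grading k r (n - d j)) := Module.Finite.pi
  let q : (∀ j, grading k r (n - d j)) →ₗ[k] (GrMod.free (grading k r) d).deg n :=
    { toFun := fun a => ⟨Finsupp.equivFunOnFinite.symm fun j => (a j).1, fun j => (a j).2⟩
      map_add' := fun _ _ => Subtype.ext (Finsupp.ext fun _ => rfl)
      map_smul' := fun _ _ => Subtype.ext (Finsupp.ext fun _ => rfl) }
  exact Module.Finite.of_surjective q fun p =>
    ⟨fun j => ⟨(show J →₀ B k r from p.1) j, p.2 j⟩, Subtype.ext (Finsupp.ext fun _ => rfl)⟩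

theorem exists_free_deg_eq_bot :
    ∃ n₁ : ℤ, ∀ n < n₁, (GrMod.free (grading k r) d).deg n = ⊥ := by
  obtain ⟨n₁, hn₁⟩ := (Set.finite_range d).bddBelow
  refine ⟨n₁, fun n hn => (Submodule.eq_bot_iff _).2 fun p hp => Finsupp.ext fun j => ?_⟩
  have h1 := hn₁ ⟨j, rfl⟩
  have h2 := hp j
  rw [grading_of_neg (by omega)] at h2
  exact h2

end FreeModule

variable {M : GrMod k (grading k r)}

theorem exists_deg_of_mem_range {P : GrMod k (grading k r)} (q : P ⟶ M) {n : ℤ} {u : M.carrier}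
    (hu : u ∈ LinearMap.range q.toLin) (hn : u ∈ M.deg n) : ∃ p ∈ P.deg n, q.toLin p = u := by
  obtain ⟨p, rfl⟩ := hu
  exact ⟨P.proj n p, P.proj_mem _ _, by rw [← GrMod.Hom.map_proj, GrMod.proj_of_mem hn]⟩

/-- In large degrees a finitely generated homogeneous submodule is generated by its component of
the preceding degree. -/
theorem exists_tail_generated {U : Submodule (B k r) M.carrier} (hU : M.IsHomog U) (hfg : U.FG) :
    ∃ n₀ : ℤ, ∀ n, n₀ ≤ n → ∀ u ∈ U, u ∈ M.deg (n + 1) →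
      ∃ a ∈ U, a ∈ M.deg n ∧ ∃ c ∈ U, c ∈ M.deg n ∧ u = gen k r 0 • a + gen k r 1 • c := by
  obtain ⟨J, hJ, d, q, rfl⟩ := GrMod.exists_free_range_eq hU hfg
  -- Beyond the degrees of the generators all coefficients have positive degree, so a leading letter
  -- x or y can be split off.
  obtain ⟨n₀, hn₀⟩ := (Set.finite_range d).bddAbove
  refine ⟨n₀, fun n hn u hu hdeg => ?_⟩
  obtain ⟨p, hp, rfl⟩ := exists_deg_of_mem_range q hu hdeg
  obtain ⟨a, ha, c, hc, rfl⟩ := free_exists_eq_add (fun j => (hn₀ ⟨j, rfl⟩).trans hn) hp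
  refine ⟨_, ⟨a, rfl⟩, q.map_deg _ _ ha, _, ⟨c, rfl⟩, q.map_deg _ _ hc, ?_⟩
  rw [map_add, map_smul, map_smul]

theorem finite_deg (hM : Module.Finite (B k r) M.carrier) (n : ℤ) :
    Module.Finite k (M.deg n) := by
  obtain ⟨J, hJ, d, q, hq⟩ := GrMod.exists_free_range_eq (M := M) (U := ⊤)
    (fun _ _ _ => trivial) hM.fg_top
  have := finite_free_deg (k := k) (r := r) (d := d) n
  let q' : (GrMod.free (grading k r) d).deg n →ₗ[k] M.deg n :=
    { toFun := fun p => ⟨q.toLin p.1, q.map_deg _ _ p.2⟩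
      map_add' := fun _ _ => Subtype.ext (map_add q.toLin _ _)
      map_smul' := fun c _ => Subtype.ext ((q.toLin.restrictScalars k).map_smul c _) }
  refine Module.Finite.of_surjective q' ?_
  rintro ⟨u, hu⟩
  obtain ⟨p, hp, rfl⟩ := exists_deg_of_mem_range q (by rw [hq]; trivial) hu
  exact ⟨⟨p, hp⟩, rfl⟩

theorem exists_deg_eq_bot (hM : Module.Finite (B k r) M.carrier) :
    ∃ n₁ : ℤ, ∀ n < n₁, M.deg n = ⊥ := by
  obtain ⟨J, hJ, d, q, hq⟩ := GrMod.exists_free_range_eq (M := M) (U := ⊤)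
    (fun _ _ _ => trivial) hM.fg_top
  obtain ⟨n₁, hn₁⟩ := exists_free_deg_eq_bot (k := k) (r := r) (d := d)
  refine ⟨n₁, fun n hn => ?_⟩
  rw [Submodule.eq_bot_iff]
  intro u hu
  obtain ⟨p, hp, rfl⟩ := exists_deg_of_mem_range q (by rw [hq]; trivial) hu
  rw [(Submodule.eq_bot_iff _).1 (hn₁ n hn) p hp, map_zero]

/-- The sections with values in a submodule are finitely generated if the submodule is generated in
large degrees by components of finite dimension. -/
theorem secOfSub_fg (hr : 1 ≤ r) {U : Submodule (B k r) M.carrier}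
    (hfin : ∀ n, Module.Finite k (M.deg n)) {n₀ : ℤ}
    (h : ∀ n, n₀ ≤ n → ∀ u ∈ U, u ∈ M.deg (n + 1) →
      ∃ a ∈ U, a ∈ M.deg n ∧ ∃ c ∈ U, c ∈ M.deg n ∧ u = gen k r 0 • a + gen k r 1 • c) :
    (secOfSub U).FG := by
  obtain ⟨m₀, hm₀⟩ : ∃ m₀ : ℕ, n₀ ≤ (m₀ : ℤ) + r + 1 := ⟨n₀.toNat, by omega⟩
  have := hfin ((m₀ : ℤ) + r + 1)
  -- In degree m₀+r+1 the submodule has a finite spanning set; the elementary sections with these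
  -- values will generate.
  let D : Submodule k (M.deg ((m₀ : ℤ) + r + 1)) :=
    (U.restrictScalars k).comap (M.deg ((m₀ : ℤ) + r + 1)).subtype
  obtain ⟨s, hs⟩ : D.FG := IsNoetherian.noetherian D
  let T : Set (Sec M) := ⋃ u : s, ⋃ i, Set.range fun p => Sec.mk M m₀ (Stage.single i p u.1)
  have hTfin : T.Finite := Set.finite_iUnion fun u => Set.finite_iUnion fun i => Set.finite_range _
  let K := Submodule.span (SLim k r)ᵐᵒᵖ T
  have hbase : ∀ u ∈ D, SingleMem K m₀ 0 u := by
    intro u hu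
    rw [← hs] at hu
    induction hu using Submodule.span_induction with
    | mem u hu =>
      exact fun p => Submodule.subset_span
        (Set.mem_iUnion.2 ⟨⟨u, hu⟩, Set.mem_iUnion.2 ⟨0, p, rfl⟩⟩)
    | zero => exact SingleMem.zero _ _
    | add u v _ _ hu hv => exact hu.add hv
    | smul c u _ hu => exact hu.smul c
  -- Since `subOfSec hr K` is stable under B and contains U in degree m₀+r+1, it contains the later
  -- components, which that one generates.
  have htail : ∀ m, m₀ ≤ m → ∀ u ∈ U, u ∈ M.deg ((m : ℤ) + r + 1) → u ∈ subOfSec hr K := by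
    intro m hm
    induction m, hm using Nat.le_induction with
    | base =>
      intro u hu hdeg
      exact (mem_subOfSec_of_deg hr K ⟨u, hdeg⟩).2 (hbase _ hu)
    | succ m hm ih =>
      intro u hu hdeg
      rw [show ((m + 1 : ℕ) : ℤ) + r + 1 = (m + r + 1) + 1 by push_cast; ring] at hdeg
      obtain ⟨a, ha, ha', c, hc, hc', rfl⟩ := h _ (by omega) u hu hdeg
      exact add_mem (Submodule.smul_mem _ _ (ih a ha ha')) (Submodule.smul_mem _ _ (ih c hc hc'))
  have hle : secOfSub U ≤ K := by
    rintro _ ⟨m, f, rfl, hf⟩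
    rw [← secOfSub_subOfSec hr K]
    refine ⟨max m m₀, Stage.trans m _ (le_max_left _ _) f, Sec.mk_trans _ f, fun i p => ?_⟩
    exact htail _ (le_max_right _ _) _ (hf.trans _ i p) ((Stage.trans m _ (le_max_left _ _) f).2 i p)
  have hge : K ≤ secOfSub U := by
    refine Submodule.span_le.2 (Set.iUnion_subset fun u => Set.iUnion_subset fun i => ?_)
    rintro _ ⟨p, rfl⟩
    have huD : u.1 ∈ D := by
      rw [← hs]
      exact Submodule.subset_span u.2
    refine ⟨m₀, _, rfl, fun j q => ?_⟩
    by_cases hj : j = i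
    · subst hj
      by_cases hq : q = p
      · subst hq
        rw [Stage.single_val_same]
        exact huD
      · rw [Stage.single_val_of_ne hq]
        exact zero_mem _
    · rw [Stage.single_val_of_ne' _ _ hj]
      exact zero_mem _
  rw [le_antisymm hle hge]
  exact Submodule.fg_span hTfin

theorem sec_finite (hr : 1 ≤ r) (hM : Module.Finite (B k r) M.carrier) :
    Module.Finite (SLim k r)ᵐᵒᵖ (Sec M) := by
  obtain ⟨n₀, h⟩ := exists_tail_generated (M := M) (U := ⊤) (fun _ _ _ => trivial) hM.fg_top
  refine ⟨?_⟩
  rw [← secOfSub_top]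
  exact secOfSub_fg hr (finite_deg hM) h

/-- In large degrees a finitely presented module has no relations except `y ^ (r + 1) = 0`. -/
theorem exists_relations_trivial (hM : Module.FinitePresentation (B k r) M.carrier) :
    ∃ n₀ : ℤ, ∀ n, n₀ ≤ n → ∀ a ∈ M.deg n, ∀ c ∈ M.deg n,
      gen k r 0 • a + gen k r 1 • c = 0 →
        a = 0 ∧ ∃ c' ∈ M.deg (n - r), c = gen k r 1 ^ r • c' := by
  have hfin : Module.Finite (B k r) M.carrier := inferInstance
  obtain ⟨J, hJ, d, q, hq⟩ := GrMod.exists_free_range_eq (M := M) (U := ⊤)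
    (fun _ _ _ => trivial) hfin.fg_top
  have hfree : Module.Finite (B k r) (GrMod.free (grading k r) d).carrier :=
    inferInstanceAs (Module.Finite (B k r) (J →₀ B k r))
  obtain ⟨n₀, h⟩ := exists_tail_generated (GrMod.isHomog_ker q)
    (Module.FinitePresentation.fg_ker q.toLin (LinearMap.range_eq_top.1 hq))
  refine ⟨n₀, fun n hn a ha c hc hac => ?_⟩
  obtain ⟨p, hp, rfl⟩ := exists_deg_of_mem_range q (by rw [hq]; trivial) ha
  obtain ⟨t, ht, rfl⟩ := exists_deg_of_mem_range q (by rw [hq]; trivial) hc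
  rw [← map_smul, ← map_smul, ← map_add] at hac
  have hdeg : ∀ (i : Fin 2) (v : (GrMod.free (grading k r) d).carrier),
      v ∈ (GrMod.free (grading k r) d).deg n →
      gen k r i • v ∈ (GrMod.free (grading k r) d).deg (n + 1) := by
    intro i v hv
    have := GrMod.smul_mem _ (gen_mem k r i) hv
    rwa [add_comm] at this
  -- The relation lifts to an element of the kernel of q, which is finitely generated; in large
  -- degree that element has coefficients a', c' in the kernel. Subtracting them leaves a relation
  -- in the free module.
  obtain ⟨a', ha', hda, c', hc', hdc, he⟩ := h n hn _ hac (add_mem (hdeg 0 p hp) (hdeg 1 t ht))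
  have he' : gen k r 0 • (p - a') + gen k r 1 • (t - c') = 0 := by
    rw [smul_sub, smul_sub, sub_add_sub_comm, sub_eq_zero]
    exact he
  obtain ⟨h1, h2⟩ := free_eq_zero_of_add_eq_zero he'
  refine ⟨?_, ?_⟩
  · rw [sub_eq_zero.1 h1]
    exact ha'
  · obtain ⟨v, hv, hv'⟩ := free_exists_eq_y_pow_smul (sub_mem ht hdc) h2
    refine ⟨q.toLin v, q.map_deg _ _ hv, ?_⟩
    rw [← map_smul, ← hv', map_sub, LinearMap.mem_ker.1 hc', sub_zero]

end FinitelyGenerated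

/-! ### Finite dimensional kernels and cokernels -/

section FiniteDimensional

variable {k : Type u} [Field k] {r : ℕ} {M : GrMod k (grading k r)}

theorem finite_of_proj_eq_zero (hfin : ∀ n, Module.Finite k (M.deg n))
    {V : Submodule (B k r) M.carrier} {n₁ n₂ : ℤ}
    (h₁ : ∀ v ∈ V, ∀ n < n₁, M.proj n v = 0) (h₂ : ∀ v ∈ V, ∀ n, n₂ ≤ n → M.proj n v = 0) :
    Module.Finite k V := by
  have hle : V.restrictScalars k ≤ (Finset.Ico n₁ n₂).sup M.deg := by
    intro v hv
    obtain ⟨s, hs, -⟩ := M.exists_sum_proj v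
    rw [hs]
    refine Submodule.sum_mem _ fun n _ => ?_
    by_cases hn : n ∈ Finset.Ico n₁ n₂
    · exact Finset.le_sup (f := M.deg) hn (M.proj_mem n v)
    · rw [Finset.mem_Ico, not_and_or, not_le, not_lt] at hn
      rw [hn.elim (h₁ v hv n) (h₂ v hv n)]
      exact zero_mem _
  exact Submodule.finiteDimensional_of_le hle

theorem proj_eq_zero_of_deg_eq_bot {n : ℤ} (h : M.deg n = ⊥) (v : M.carrier) : M.proj n v = 0 :=
  (Submodule.eq_bot_iff _).1 h _ (M.proj_mem n v)

/-- A homogeneous torsion submodule of a finitely presented module is finite dimensional. -/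
theorem finite_of_torsMod (hM : Module.FinitePresentation (B k r) M.carrier)
    {V : Submodule (B k r) M.carrier} (hV : M.IsHomog V) (h : ∀ v ∈ V, TorsMod (M := M) ⊥ v) :
    Module.Finite k V := by
  have hfin : Module.Finite (B k r) M.carrier := inferInstance
  obtain ⟨n₁, hn₁⟩ := exists_deg_eq_bot hfin
  obtain ⟨n₀, hn₀⟩ := exists_relations_trivial hM
  -- By the absence of relations (with c = 0), x is injective in large degrees. A torsion element is
  -- killed by a power of x, so V has no components there.
  have hx : ∀ (L : ℕ) (n : ℤ), n₀ ≤ n → ∀ v ∈ M.deg n, gen k r 0 ^ L • v = 0 → v = 0 := by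
    intro L
    induction L with
    | zero => intro n _ v _ hv; simpa using hv
    | succ L ih =>
      intro n hn v hv hL
      have hdeg : gen k r 0 • v ∈ M.deg (1 + n) := M.smul_mem (gen_mem k r 0) hv
      have h0 := ih (1 + n) (by omega) _ hdeg (by rw [← mul_smul, ← pow_succ]; exact hL)
      exact (hn₀ n hn v hv 0 (zero_mem _) (by rw [h0, smul_zero, add_zero])).1
  refine finite_of_proj_eq_zero (finite_deg hfin) (n₁ := n₁) (n₂ := n₀)
    (fun v _ n hn => proj_eq_zero_of_deg_eq_bot (hn₁ n hn) v) fun v hv n hn => ?_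
  obtain ⟨L, hL⟩ := h _ (hV v hv n)
  refine hx L n hn _ (M.proj_mem n v) ((Submodule.mem_bot (B k r)).1 (hL _ ?_))
  have := SetLike.pow_mem_graded L (gen_mem k r 0)
  simpa using this

/-- If a finitely generated module is torsion modulo a submodule, then the submodule contains all
elements of large degree. -/
theorem exists_deg_le_of_torsMod (hM : Module.Finite (B k r) M.carrier)
    {U : Submodule (B k r) M.carrier} (h : ∀ v, TorsMod U v) :
    ∃ n₂ : ℤ, ∀ n, n₂ ≤ n → ∀ v ∈ M.deg n, v ∈ U := by
  obtain ⟨J, hJ, d, q, hq⟩ := GrMod.exists_free_range_eq (M := M) (U := ⊤)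
    (fun _ _ _ => trivial) hM.fg_top
  let q' : (J →₀ B k r) →ₗ[B k r] M.carrier := q.toLin
  choose L hL using fun j => h (q' (Finsupp.single j 1))
  -- From degree d j + L j on, the coefficient of the generator j has degree at least L j and so
  -- carries it into U.
  obtain ⟨n₂, hn₂⟩ := (Set.finite_range fun j => d j + L j).bddAbove
  refine ⟨n₂, fun n hn v hv => ?_⟩
  obtain ⟨p, hp, rfl⟩ := exists_deg_of_mem_range q (by rw [hq]; trivial) hv
  have hsum : ∀ p : J →₀ B k r, q' p = p.sum fun j b => b • q' (Finsupp.single j 1) := by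
    intro p
    conv_lhs => rw [← Finsupp.sum_single p, map_finsuppSum]
    refine Finsupp.sum_congr fun j _ => ?_
    rw [← map_smul, Finsupp.smul_single_one]
  refine (hsum p).symm ▸ U.sum_mem fun j _ => ?_
  have hj : d j + L j ≤ n₂ := hn₂ ⟨j, rfl⟩
  refine smul_mem_of_le (n := (n - d j).toNat) (hL j) (by omega) _ ?_
  rw [Int.toNat_of_nonneg (by omega)]
  exact hp j

theorem finite_of_isUnionOfFiniteDim (hM : Module.Finite (B k r) M.carrier)
    (h : IsUnionOfFiniteDim k (B k r) M.carrier) : Module.Finite k M.carrier := by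
  obtain ⟨n₁, hn₁⟩ := exists_deg_eq_bot hM
  obtain ⟨n₂, hn₂⟩ := exists_deg_le_of_torsMod hM
    fun v => (exists_finite_submodule_iff v).1 (h v)
  have := finite_of_proj_eq_zero (V := ⊤) (finite_deg hM)
    (fun v _ n hn => proj_eq_zero_of_deg_eq_bot (hn₁ n hn) v)
    fun v _ n hn => (Submodule.mem_bot (B k r)).1 (hn₂ n hn _ (M.proj_mem n v))
  exact Module.Finite.equiv
    ((Submodule.topEquiv (R := B k r) (M := M.carrier)).restrictScalars k)

/-- For finitely presented modules a torsion kernel is finite dimensional by `finite_of_torsMod`,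
and a torsion cokernel is so because it is finitely generated. -/
theorem isoModFiniteDim_iff {M N : Grfp (grading k r)} (f : M ⟶ N) :
    isoModFiniteDim (grading k r) f ↔
      isoModFdim (grading k r) ((GrMod.isFP (grading k r)).ι.map f) := by
  constructor
  · rintro ⟨h, h'⟩
    exact ⟨isUnionOfFiniteDim_of_finite _, isUnionOfFiniteDim_of_finite _⟩
  · rintro ⟨h, h'⟩
    have hN : Module.FinitePresentation (B k r) N.obj.carrier := N.property
    refine ⟨finite_of_torsMod M.property (GrMod.isHomog_ker _)
      ((isUnionOfFiniteDim_submodule_iff _).1 h), ?_⟩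
    refine finite_of_isUnionOfFiniteDim (M := N.obj.quot _ (GrMod.isHomog_range _)) ?_ h'
    exact Module.Finite.of_surjective _ (N.obj.quotMk_surjective _ (GrMod.isHomog_range _))

end FiniteDimensional

/-! ### Finite presentation of the sections -/

section FinitePresentation

variable {k : Type u} [Field k] {r : ℕ}

/-- In large degrees the kernel of a morphism from a free module to a finitely presented module
that is surjective up to torsion is generated by its component of the preceding degree. -/
theorem exists_ker_tail_generated {J : Type u} [Finite J] {d : J → ℤ} {Y : GrMod k (grading k r)}
    (hY : Module.FinitePresentation (B k r) Y.carrier) (f : GrMod.free (grading k r) d ⟶ Y)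
    (hf : ∀ v, TorsMod (LinearMap.range f.toLin) v) :
    ∃ n₀ : ℤ, ∀ n, n₀ ≤ n → ∀ u ∈ LinearMap.ker f.toLin,
      u ∈ (GrMod.free (grading k r) d).deg (n + 1) →
      ∃ a ∈ LinearMap.ker f.toLin, a ∈ (GrMod.free (grading k r) d).deg n ∧
      ∃ c ∈ LinearMap.ker f.toLin, c ∈ (GrMod.free (grading k r) d).deg n ∧
        u = gen k r 0 • a + gen k r 1 • c := by
  obtain ⟨n₀, hn₀⟩ := exists_relations_trivial hY
  obtain ⟨n₂, hn₂⟩ := exists_deg_le_of_torsMod inferInstance hf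
  obtain ⟨n₃, hn₃⟩ := (Set.finite_range d).bddAbove
  -- The summand r is there because the element m with f(c) = y^r m, which must be lifted through f,
  -- has degree n - r.
  refine ⟨max n₀ (max (n₂ + r) n₃), fun n hn u hu hdeg => ?_⟩
  simp only [max_le_iff] at hn
  obtain ⟨a, ha, c, hc, rfl⟩ := free_exists_eq_add (fun j => (hn₃ ⟨j, rfl⟩).trans hn.2.2) hdeg
  rw [LinearMap.mem_ker, map_add, map_smul, map_smul] at hu
  obtain ⟨ha0, m, hm, hcm⟩ := hn₀ n hn.1 _ (f.map_deg _ _ ha) _ (f.map_deg _ _ hc) hu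
  obtain ⟨p, hp, rfl⟩ := exists_deg_of_mem_range f (hn₂ _ (by omega) m hm) hm
  -- Subtracting y^r p puts c into the kernel and leaves y c unchanged, because y^(r+1) = 0.
  refine ⟨a, ha0, ha, c - gen k r 1 ^ r • p, ?_, sub_mem hc ?_, ?_⟩
  · rw [LinearMap.mem_ker, map_sub, map_smul, hcm, sub_self]
  · have := GrMod.smul_mem _ (y_pow_mem (k := k) (r := r) r) hp
    rwa [add_sub_cancel] at this
  · rw [smul_sub, ← mul_smul, ← pow_succ', gen_pow, zero_smul, sub_zero]

/-- The sections of a finitely presented graded module are finitely presented. -/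
theorem sec_finitePresentation (hr : 1 ≤ r) {M : GrMod k (grading k r)}
    (hM : Module.FinitePresentation (B k r) M.carrier) :
    Module.FinitePresentation (SLim k r)ᵐᵒᵖ (Sec M) := by
  have hfin := sec_finite hr (M := M) inferInstance
  obtain ⟨s, hs⟩ := hfin.fg_top
  let π : (s →₀ (SLim k r)ᵐᵒᵖ) →ₗ[(SLim k r)ᵐᵒᵖ] Sec M :=
    Finsupp.linearCombination _ Subtype.val
  have hπ : Function.Surjective π := by
    rw [← LinearMap.range_eq_top, Finsupp.range_linearCombination, Subtype.range_coe]
    exact hs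
  let φ : Sec (freeZero k r s) →ₗ[(SLim k r)ᵐᵒᵖ] Sec M :=
    π ∘ₗ (secFreeEquiv k r s).symm.toLinearMap
  have hφ : Function.Surjective φ := hπ.comp (secFreeEquiv k r s).symm.surjective
  -- The surjection φ need not come from a graded morphism to M. It does after M is replaced by a
  -- finitely presented Y with the same sections, so the kernel of φ becomes the sections of a
  -- graded kernel.
  obtain ⟨Y, t, f, ht, hf, hY⟩ := exists_secMap_eq hr φ
  have hfree : Module.FinitePresentation (B k r) (freeZero k r s).carrier :=
    inferInstanceAs (Module.FinitePresentation (B k r) (s →₀ B k r))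
  have hsec : Module.FinitePresentation (SLim k r)ᵐᵒᵖ (Sec (freeZero k r s)) :=
    Module.FinitePresentation.of_equiv (secFreeEquiv k r s)
  have hY' := hY inferInstance hfree hM
  have hfs : Function.Surjective (Sec.map f) := by
    rw [hf]
    exact ht.2.comp hφ
  rw [← LinearMap.range_eq_top, range_secMap, secOfSub_eq_top_iff] at hfs
  obtain ⟨n₀, hn₀⟩ := exists_ker_tail_generated hY' f hfs
  refine Module.finitePresentation_of_surjective φ hφ ?_
  have hker : LinearMap.ker φ = LinearMap.ker (Sec.map f) := by
    rw [hf, LinearMap.ker_comp_of_ker_eq_bot _ (LinearMap.ker_eq_bot.2 ht.1)]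
  rw [hker, ker_secMap]
  exact secOfSub_fg hr (finite_deg inferInstance) hn₀

end FinitePresentation

/-! ### The equivalences -/

section Equivalences

variable (k : Type u) [Field k] (r : ℕ)

/-- `S` as a right module over itself is the free module of rank one over the opposite ring. -/
def opLinearEquivRight : (SLim k r)ᵐᵒᵖ ≃ₗ[(SLim k r)ᵐᵒᵖ] SLim k r where
  toFun := MulOpposite.unop
  invFun := MulOpposite.op
  left_inv _ := rfl
  right_inv _ := rfl
  map_add' _ _ := rfl
  map_smul' _ _ := rfl

variable {k r}

theorem secFunctor_essSurj (hr : 1 ≤ r) : (secFunctor k r).EssSurj where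
  mem_essImage N := by
    obtain ⟨M, ⟨e⟩, -⟩ := exists_sec_equiv (k := k) hr (N := N) id (by simp)
    exact ⟨M, ⟨e.toModuleIso⟩⟩

theorem isoModFdim_isEquivalence (hr : 1 ≤ r) :
    (Localization.Construction.lift (W := isoModFdim (grading k r)) (secFunctor k r)
      fun _ _ f hf => (isoModFdim_iff_isIso f).1 hf).IsEquivalence := by
  have := secFunctor_essSurj (k := k) hr
  refine isEquivalence_lift _ _ (fun _ _ f => isoModFdim_iff_isIso f) ?_ ?_
  · intro X Y f g h
    obtain ⟨Y', t, ht, hfg, -⟩ := exists_comp_eq_of_secMap_eq (f := f) (g := g)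
      (congrArg ModuleCat.Hom.hom h)
    exact ⟨Y', t, (isoModFdim_iff t).2 ht, hfg⟩
  · intro X Y φ
    obtain ⟨Y', s, f, hs, hf, -⟩ := exists_secMap_eq hr φ.hom
    exact ⟨Y', s, f, (isoModFdim_iff s).2 hs, ModuleCat.hom_ext hf⟩

/-- The sections of finitely presented graded modules. -/
def secFunctorFP (hr : 1 ≤ r) : Grfp (grading k r) ⥤ (isFPModS k r).FullSubcategory :=
  (isFPModS k r).lift ((GrMod.isFP (grading k r)).ι ⋙ secFunctor k r)
    fun M => sec_finitePresentation hr M.property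

theorem isoModFiniteDim_iff_isIso (hr : 1 ≤ r) {M N : Grfp (grading k r)} (f : M ⟶ N) :
    isoModFiniteDim (grading k r) f ↔ IsIso ((secFunctorFP hr).map f) := by
  rw [isoModFiniteDim_iff, isoModFdim_iff_isIso]
  exact isIso_iff_of_reflects_iso ((secFunctorFP hr).map f) (isFPModS k r).ι

theorem secFunctorFP_essSurj (hr : 1 ≤ r) : (secFunctorFP (k := k) hr).EssSurj where
  mem_essImage N := by
    have hN : Module.FinitePresentation (SLim k r)ᵐᵒᵖ N.obj := N.property
    obtain ⟨s, hs, hker⟩ := hN.out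
    obtain ⟨M, ⟨e⟩, hM⟩ := exists_sec_equiv hr (J := s) (N := N.obj) Subtype.val
      (by rw [Subtype.range_coe]; exact hs)
    exact ⟨⟨M, hM inferInstance hker⟩, ⟨(isFPModS k r).isoMk e.toModuleIso⟩⟩

theorem isoModFiniteDim_isEquivalence (hr : 1 ≤ r) :
    (Localization.Construction.lift (W := isoModFiniteDim (grading k r)) (secFunctorFP hr)
      fun _ _ f hf => (isoModFiniteDim_iff_isIso hr f).1 hf).IsEquivalence := by
  have := secFunctorFP_essSurj (k := k) hr
  refine isEquivalence_lift _ _ (fun _ _ f => isoModFiniteDim_iff_isIso hr f) ?_ ?_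
  · intro X Y f g h
    have hX : Module.FinitePresentation (B k r) X.obj.carrier := X.property
    obtain ⟨Y', t, ht, hfg, hY'⟩ := exists_comp_eq_of_secMap_eq (f := f.hom) (g := g.hom)
      (congrArg ModuleCat.Hom.hom (congrArg (isFPModS k r).ι.map h))
    exact ⟨⟨Y', hY' inferInstance Y.property⟩, ObjectProperty.homMk t,
      (isoModFiniteDim_iff _).2 ((isoModFdim_iff t).2 ht), ObjectProperty.hom_ext _ hfg⟩
  · intro X Y φ
    have hX : Module.FinitePresentation (B k r) X.obj.carrier := X.property
    have hX' : Module.Finite (B k r) X.obj.carrier := inferInstance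
    obtain ⟨Y', s, f, hs, hf, hY'⟩ := exists_secMap_eq hr φ.hom.hom
    exact ⟨⟨Y', hY' (sec_finite hr hX') X.property Y.property⟩, ObjectProperty.homMk s,
      ObjectProperty.homMk f, (isoModFiniteDim_iff _).2 ((isoModFdim_iff s).2 hs),
      ObjectProperty.hom_ext _ (ModuleCat.hom_ext hf)⟩

end Equivalences

end NCProj

end

theorem theorem1p1 (k : Type u) [Field k] (r : ℕ) (hr : 1 ≤ r) :
    ∃ (E : NCProj.QGr (NCProj.grading k r) ≌ NCProj.ModS k r)
      (e : NCProj.Qgrfp (NCProj.grading k r) ≌ (NCProj.isFPModS k r).FullSubcategory),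
      Nonempty (NCProj.qgrToQGr (NCProj.grading k r) ⋙ E.functor ≅
        e.functor ⋙ (NCProj.isFPModS k r).ι) ∧
      Nonempty (E.functor.obj (NCProj.structureSheaf (NCProj.grading k r)) ≅
        NCProj.SRight k r) := by
  have hE := NCProj.isoModFdim_isEquivalence (k := k) hr
  have he := NCProj.isoModFiniteDim_isEquivalence (k := k) hr
  refine ⟨@Functor.asEquivalence _ _ _ _ _ hE, @Functor.asEquivalence _ _ _ _ _ he,
    -- The square commutes strictly: before localization both composites are the functor of sections
    -- on finitely presented modules.
    ⟨eqToIso (Localization.Construction.uniq _ _ ?_)⟩, ⟨?_⟩⟩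
  · have h₁ := Localization.Construction.fac
      ((NCProj.GrMod.isFP (NCProj.grading k r)).ι ⋙ (NCProj.isoModFdim (NCProj.grading k r)).Q)
      (NCProj.isoModFiniteDim_inverts (NCProj.grading k r))
    have h₂ := Localization.Construction.fac (NCProj.secFunctor k r)
      fun _ _ f hf => (NCProj.isoModFdim_iff_isIso f).1 hf
    have h₃ := Localization.Construction.fac (NCProj.secFunctorFP (k := k) hr)
      fun _ _ f hf => (NCProj.isoModFiniteDim_iff_isIso hr f).1 hf
    exact (congrArg (· ⋙ Localization.Construction.lift (NCProj.secFunctor k r)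
      fun _ _ f hf => (NCProj.isoModFdim_iff_isIso f).1 hf) h₁).trans
      ((congrArg ((NCProj.GrMod.isFP (NCProj.grading k r)).ι ⋙ ·) h₂).trans
        (congrArg (· ⋙ (NCProj.isFPModS k r).ι) h₃).symm)
  · exact ((NCProj.secSelfEquiv (k := k) (r := r)).symm ≪≫ₗ
      NCProj.opLinearEquivRight k r).toModuleIso
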